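/- Setting. Let $A\in\mathbb R^{m\times n}$ be totally unimodular with full row rank $m$, let $b\in\mathbb R^m$, $c\in\mathbb R^n$, $N=\{1,\dots,n\}$, and assume that the linear program $$(P)\qquad \min\{c^\top x \mid Ax=b,\ x\ge 0\}$$ has at most one optimal solution. The *primal-simplex based Tardos' algorithm* starts with $\bar K=\emptyset$, $K=N$ and repeats the following steps. 1. Choose a nonsingular $m\times m$ submatrix $G$ of $A$ that contains the columns $A_{\bar K}$, put $H=G^{-1}$, let $H_1$ be the rows of $H$ that correspond to $\bar K$ and $H_2$ the other rows, and set $A'=H_2A_K$, $b'=H_2b$, $c'=c_K-(H_1A_K)^\top c_{\bar K}$, $m'=m-|\bar K|$, $n'=n-|\bar K|$. 2. Choose a basis $L\subseteq K$ of $A'$. If $(A'_L)^{-1}b'=0$, stop with the candidate $x$ given by $x_K=0$, $x_{\bar K}=H_1b$. Otherwise let $k=\|A'^\top(A'A'^\top)^{-1}b'\|_2/(m'+n'^2)$ and solve the *rounded problem* $$\min\{c'^\top x' \mid (A'_L)^{-1}A'x'=\lceil (A'_L)^{-1}b'/k\rceil,\ x'\ge0\}$$ by the two-phase simplex method with Dantzig's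 (most negative reduced cost) rule; in phase one the rows with negative right-hand side are multiplied by $-1$, each row gets an artificial variable, and the sum of the artificial variables is minimized starting from the artificial basis. Stop if the rounded problem is infeasible or unbounded. Otherwise let $x''$ be the optimal basic solution found and $L''$ its basis; if $\bar K\cup L''$ is an optimal basis of $(P)$, stop with its basic solution. 3. Replace $\bar K$ by $\bar K\cup J$ and $K$ by $K\setminus J$, where $J=\{i\in K\mid x''_i\ge n'\}$. If $|K|=n-m$, stop; otherwise go to 1. The *auxiliary problems* are the phase-one problem and the rounded problem itself, for every rounded problem that occurs; such a problem is *non-degenerate* if all basic variables are strictly positive in each of its basic feasible solutions. Theorem 1. Suppose that all the auxiliary problems that occur are non-degenerate. (a) For all choices of $G$ and $L$ and all tie-breaking in the simplex method, the algorithm never gets stuck and terminates. It solves at most $m$ rounded problems, and the total number of basic solutions that it generates (in both phases) is at most $$2mn\left\lceil (m^4n+m^3n^3+m^2)\log(m^4n+m^3n^3+m^2)\right\rceil$$ (for $m=0$ no basic solution is generated); for $n\ge2$ this number is at most $C\,m^4n^4\log n$ with a universal constant $C$. The stops are correct: a basis that it returns as optimal is an optimal basis of $(P)$; if the rounded problem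 is infeasible, or if $|K|=n-m$ in step 3, then $(P)$ is infeasible; if the rounded problem is unbounded, then $(P)$ is infeasible or unbounded; and if it stops with $(A'_L)^{-1}b'=0$, then either the candidate $x$ is nonnegative and is the optimal solution of $(P)$, or $x$ is not nonnegative and $(P)$ is infeasible, or $b=0$, $x=0$ and $(P)$ is unbounded. (b) The algorithm is strongly polynomial: there is an implementation that uses only additions, subtractions, multiplications, divisions and comparisons of numbers, and the loading of integers, that follows the steps above until it stops, and whose number of such operations is bounded by a polynomial in $m$ and $n$; moreover, if $b$ and $c$ are rational, then all the numbers that it produces are rational with a number of bits bounded by a polynomial in $m$, $n$ and the number of bits of $b$ and $c$. -/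

import Mathlib

namespace PrimalTardos

/-! ## Linear programs in standard form and the simplex method with Dantzig's rule -/

/-- The linear program `min {costᵀ x | M x = rhs, x ≥ 0}`, with rows `ρ` and columns `κ`. -/
structure LP (ρ κ : Type) where
  M : Matrix ρ κ ℝ
  rhs : ρ → ℝ
  cost : κ → ℝ

namespace LP

section
variable {ρ κ : Type} [Fintype ρ] [DecidableEq ρ] [Fintype κ] [DecidableEq κ]

def Feasible (P : LP ρ κ) (x : κ → ℝ) : Prop := P.M.mulVec x = P.rhs ∧ 0 ≤ x

def value (P : LP ρ κ) (x : κ → ℝ) : ℝ := ∑ j, P.cost j * x j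

def IsOptimal (P : LP ρ κ) (x : κ → ℝ) : Prop :=
  P.Feasible x ∧ ∀ y, P.Feasible y → P.value x ≤ P.value y

def Infeasible (P : LP ρ κ) : Prop := ∀ x, ¬ P.Feasible x

def Unbounded (P : LP ρ κ) : Prop := ∀ z : ℝ, ∃ x, P.Feasible x ∧ P.value x < z

/-- A basis is listed row by row: `β i` is the basic column of row `i`. -/
def IsBasis (P : LP ρ κ) (β : ρ → κ) : Prop := IsUnit (P.M.submatrix id β).det

/-- The values of the basic variables. -/
noncomputable def basicVal (P : LP ρ κ) (β : ρ → κ) : ρ → ℝ :=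
  ((P.M.submatrix id β)⁻¹).mulVec P.rhs

/-- The basic solution as a vector on all columns. -/
noncomputable def basicSol (P : LP ρ κ) (β : ρ → κ) : κ → ℝ :=
  fun j => ∑ i, if β i = j then P.basicVal β i else 0

noncomputable def tableau (P : LP ρ κ) (β : ρ → κ) : Matrix ρ κ ℝ :=
  (P.M.submatrix id β)⁻¹ * P.M

noncomputable def redCost (P : LP ρ κ) (β : ρ → κ) (j : κ) : ℝ :=
  P.cost j - ∑ i, P.cost (β i) * P.tableau β i j

/-- Every basic feasible solution has strictly positive basic variables. -/
def Nondegenerate (P : LP ρ κ) : Prop :=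
  ∀ β, P.IsBasis β → 0 ≤ P.basicVal β → ∀ i, 0 < P.basicVal β i

/-- Dantzig's rule: `s` has a most negative reduced cost (ties are broken arbitrarily). -/
def DantzigEntering (P : LP ρ κ) (β : ρ → κ) (s : κ) : Prop :=
  P.redCost β s < 0 ∧ ∀ j, P.redCost β s ≤ P.redCost β j

/-- One pivot: column `s` enters by Dantzig's rule, the basic column of row `r` leaves by the
minimum ratio test. -/
def DantzigPivot (P : LP ρ κ) (β β' : ρ → κ) : Prop :=
  ∃ (s : κ) (r : ρ), P.DantzigEntering β s ∧ 0 < P.tableau β r s ∧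
    (∀ i, 0 < P.tableau β i s →
      P.basicVal β r / P.tableau β r s ≤ P.basicVal β i / P.tableau β i s) ∧
    β' = Function.update β r s

/-- The simplex method stops with an optimal basis. -/
def OptimalTableau (P : LP ρ κ) (β : ρ → κ) : Prop := ∀ j, 0 ≤ P.redCost β j

/-- The simplex method stops because no row qualifies in the ratio test. -/
def UnboundedTableau (P : LP ρ κ) (β : ρ → κ) : Prop :=
  ∃ s, P.DantzigEntering β s ∧ ∀ i, P.tableau β i s ≤ 0

/-- The phase one problem of `P`: the rows with negative right-hand side are multiplied by `-1`,
every row gets an artificial variable, and the sum of the artificial variables is minimized. -/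
noncomputable def phaseOne (P : LP ρ κ) : LP ρ (κ ⊕ ρ) where
  M := fun i => Sum.elim (fun j => if P.rhs i < 0 then -P.M i j else P.M i j)
    (fun i' => if i = i' then 1 else 0)
  rhs := fun i => |P.rhs i|
  cost := Sum.elim (fun _ => 0) (fun _ => 1)

end

end LP

/-! ## The auxiliary problems of the algorithm -/

/-- The columns in `K`, the complement of `Kb`. -/
abbrev Col {n : ℕ} (Kb : Finset (Fin n)) : Type := {j : Fin n // j ∉ Kb}

/-- The rows of `H₂`. Here `σ` lists the columns of the nonsingular matrix `G`, and the rows of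
`H = G⁻¹` are matched with the columns of `G`. -/
abbrev Row {m n : ℕ} (Kb : Finset (Fin n)) (σ : Fin m → Fin n) : Type := {i : Fin m // σ i ∉ Kb}

section
variable {m n : ℕ} (A : Matrix (Fin m) (Fin n) ℝ) (b : Fin m → ℝ) (c : Fin n → ℝ)

/-- The original problem `min {cᵀ x | A x = b, x ≥ 0}`. -/
def original : LP (Fin m) (Fin n) := ⟨A, b, c⟩

/-- `σ` lists the columns of a nonsingular `m × m` submatrix `G` of `A` that contains all the
columns in `Kb`. -/
def Extends (Kb : Finset (Fin n)) (σ : Fin m → Fin n) : Prop :=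
  IsUnit (A.submatrix id σ).det ∧ ∀ j ∈ Kb, ∃ i, σ i = j

/-- `H = G⁻¹`. -/
noncomputable def Hmat (σ : Fin m → Fin n) : Matrix (Fin m) (Fin m) ℝ := (A.submatrix id σ)⁻¹

/-- The reduced problem, with `A' = H₂ A_K`, `b' = H₂ b`, `c' = c_K - (H₁ A_K)ᵀ c_Kb`. -/
noncomputable def reduced (Kb : Finset (Fin n)) (σ : Fin m → Fin n) :
    LP (Row Kb σ) (Col Kb) where
  M := fun i j => (Hmat A σ * A) i j
  rhs := fun i => (Hmat A σ).mulVec b i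
  cost := fun j => c j - ∑ i : {i : Fin m // σ i ∈ Kb}, (Hmat A σ * A) i j * c (σ i)

/-- The scaling factor `k = ‖A'ᵀ (A' A'ᵀ)⁻¹ b'‖₂ / (m' + n'²)` of a problem with `m'` rows and
`n'` columns. -/
noncomputable def scale {ρ κ : Type} [Fintype ρ] [DecidableEq ρ] [Fintype κ] (P : LP ρ κ) : ℝ :=
  ‖WithLp.toLp 2 ((P.M.transpose * (P.M * P.M.transpose)⁻¹).mulVec P.rhs)‖ /
    ((Fintype.card ρ : ℝ) + (Fintype.card κ : ℝ) ^ 2)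

/-- The rounded problem of `P` for the basis `L`, which is listed by `ℓ`:
`min {costᵀ x | M_L⁻¹ M x = ⌈M_L⁻¹ rhs / k⌉, x ≥ 0}`. -/
noncomputable def roundedOf {ρ κ : Type} [Fintype ρ] [DecidableEq ρ] [Fintype κ]
    (P : LP ρ κ) (ℓ : ρ → κ) : LP ρ κ where
  M := P.tableau ℓ
  rhs := fun i => (⌈P.basicVal ℓ i / scale P⌉ : ℝ)
  cost := P.cost

/-- The rounded problem of the algorithm. -/
noncomputable def rounded (Kb : Finset (Fin n)) (σ : Fin m → Fin n) (ℓ : Row Kb σ → Col Kb) :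
    LP (Row Kb σ) (Col Kb) :=
  roundedOf (reduced A b c Kb σ) ℓ

end

/-- The basis `Kb ∪ L''` of `A`, for a basis `L''` of `A'` listed by `β`. -/
def merge {m n : ℕ} {Kb : Finset (Fin n)} {σ : Fin m → Fin n} (β : Row Kb σ → Col Kb) :
    Fin m → Fin n :=
  fun i => if h : σ i ∉ Kb then (β ⟨i, h⟩ : Fin n) else σ i

/-! ## The algorithm as a transition system

A run may use any `G`, any basis `L`, and any resolution of the ties in the simplex method. -/

/-- The ways in which the algorithm stops; `V` is the type of the numbers. -/
inductive Outcome (V : Type) (n : ℕ) : Type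
  /-- `Kb ∪ L''` is an optimal basis of the original problem, with basic solution `x`. -/
  | optimalBasis (x : Fin n → V)
  /-- `A_L'⁻¹ b' = 0`; the candidate `x` has `x_K = 0` and `x_Kb = H₁ b`. -/
  | zeroRhs (x : Fin n → V)
  /-- The rounded problem is infeasible. -/
  | roundedInfeasible
  /-- The rounded problem is unbounded. -/
  | roundedUnbounded
  /-- `|K| = n - m` after the update of `K`. -/
  | exhausted

inductive Config (V : Type) (m n : ℕ) : Type
  /-- About to form the reduced problem for `Kb`. -/
  | start (Kb : Finset (Fin n))
  /-- About to solve the rounded problem given by `Kb`, `G` (listed by `σ`), `L` (listed by `ℓ`). -/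
  | roundedProblem (Kb : Finset (Fin n)) (σ : Fin m → Fin n) (ℓ : Row Kb σ → Col Kb)
  /-- The simplex method for the phase one problem is at the basic solution of the basis `β`. -/
  | phaseOne (Kb : Finset (Fin n)) (σ : Fin m → Fin n) (ℓ : Row Kb σ → Col Kb)
      (β : Row Kb σ → Col Kb ⊕ Row Kb σ)
  /-- The simplex method for the rounded problem is at the basic solution of the basis `β`. -/
  | phaseTwo (Kb : Finset (Fin n)) (σ : Fin m → Fin n) (ℓ : Row Kb σ → Col Kb)
      (β : Row Kb σ → Col Kb)
  | halt (o : Outcome V n)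

namespace Config

def isRounded {V : Type} {m n : ℕ} : Config V m n → Bool
  | roundedProblem _ _ _ => true
  | _ => false

/-- The configurations in which the algorithm generates a basic solution, in either phase. -/
def isBasicSolution {V : Type} {m n : ℕ} : Config V m n → Bool
  | phaseOne _ _ _ _ => true
  | phaseTwo _ _ _ _ => true
  | _ => false

end Config

section
variable {m n : ℕ} (A : Matrix (Fin m) (Fin n) ℝ) (b : Fin m → ℝ) (c : Fin n → ℝ)

/-- The set `J = {i ∈ K | x''_i ≥ n'}`. -/
noncomputable def largeSet (Kb : Finset (Fin n)) (σ : Fin m → Fin n) (ℓ β : Row Kb σ → Col Kb) :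
    Finset (Fin n) :=
  open Classical in
  Finset.univ.filter fun j => ∃ h : j ∉ Kb,
    (Fintype.card (Col Kb) : ℝ) ≤ (rounded A b c Kb σ ℓ).basicSol β ⟨j, h⟩

/-- `τ` lists an optimal basis of the original problem. -/
def IsOptimalBasis (τ : Fin m → Fin n) : Prop :=
  (original A b c).IsBasis τ ∧ (original A b c).IsOptimal ((original A b c).basicSol τ)

/-- One step of the primal-simplex based Tardos' algorithm. -/
inductive Step : Config ℝ m n → Config ℝ m n → Prop
  | zeroRhs (Kb : Finset (Fin n)) (σ : Fin m → Fin n) (ℓ : Row Kb σ → Col Kb)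
      (hσ : Extends A Kb σ) (hℓ : (reduced A b c Kb σ).IsBasis ℓ)
      (h0 : (reduced A b c Kb σ).basicVal ℓ = 0) :
      Step (.start Kb) (.halt (.zeroRhs fun j =>
        ∑ i, if σ i = j ∧ σ i ∈ Kb then (Hmat A σ).mulVec b i else 0))
  | round (Kb : Finset (Fin n)) (σ : Fin m → Fin n) (ℓ : Row Kb σ → Col Kb)
      (hσ : Extends A Kb σ) (hℓ : (reduced A b c Kb σ).IsBasis ℓ)
      (h0 : (reduced A b c Kb σ).basicVal ℓ ≠ 0) :
      Step (.start Kb) (.roundedProblem Kb σ ℓ)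
  | phaseOneInit (Kb : Finset (Fin n)) (σ : Fin m → Fin n) (ℓ : Row Kb σ → Col Kb) :
      Step (.roundedProblem Kb σ ℓ) (.phaseOne Kb σ ℓ Sum.inr)
  | phaseOnePivot (Kb : Finset (Fin n)) (σ : Fin m → Fin n) (ℓ : Row Kb σ → Col Kb)
      (β β' : Row Kb σ → Col Kb ⊕ Row Kb σ)
      (h : (rounded A b c Kb σ ℓ).phaseOne.DantzigPivot β β') :
      Step (.phaseOne Kb σ ℓ β) (.phaseOne Kb σ ℓ β')
  | infeasible (Kb : Finset (Fin n)) (σ : Fin m → Fin n) (ℓ : Row Kb σ → Col Kb)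
      (β : Row Kb σ → Col Kb ⊕ Row Kb σ)
      (h : (rounded A b c Kb σ ℓ).phaseOne.OptimalTableau β)
      (hpos : 0 < (rounded A b c Kb σ ℓ).phaseOne.value
        ((rounded A b c Kb σ ℓ).phaseOne.basicSol β)) :
      Step (.phaseOne Kb σ ℓ β) (.halt .roundedInfeasible)
  | phaseTwoInit (Kb : Finset (Fin n)) (σ : Fin m → Fin n) (ℓ β : Row Kb σ → Col Kb)
      (h : (rounded A b c Kb σ ℓ).phaseOne.OptimalTableau (Sum.inl ∘ β)) :
      Step (.phaseOne Kb σ ℓ (Sum.inl ∘ β)) (.phaseTwo Kb σ ℓ β)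
  | phaseTwoPivot (Kb : Finset (Fin n)) (σ : Fin m → Fin n) (ℓ β β' : Row Kb σ → Col Kb)
      (h : (rounded A b c Kb σ ℓ).DantzigPivot β β') :
      Step (.phaseTwo Kb σ ℓ β) (.phaseTwo Kb σ ℓ β')
  | unbounded (Kb : Finset (Fin n)) (σ : Fin m → Fin n) (ℓ β : Row Kb σ → Col Kb)
      (h : (rounded A b c Kb σ ℓ).UnboundedTableau β) :
      Step (.phaseTwo Kb σ ℓ β) (.halt .roundedUnbounded)
  | optimal (Kb : Finset (Fin n)) (σ : Fin m → Fin n) (ℓ β : Row Kb σ → Col Kb)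
      (h : (rounded A b c Kb σ ℓ).OptimalTableau β)
      (hopt : IsOptimalBasis A b c (merge β)) :
      Step (.phaseTwo Kb σ ℓ β)
        (.halt (.optimalBasis ((original A b c).basicSol (merge β))))
  | exhausted (Kb : Finset (Fin n)) (σ : Fin m → Fin n) (ℓ β : Row Kb σ → Col Kb)
      (h : (rounded A b c Kb σ ℓ).OptimalTableau β)
      (hopt : ¬ IsOptimalBasis A b c (merge β))
      (hcard : ((Kb ∪ largeSet A b c Kb σ ℓ β)ᶜ).card = n - m) :
      Step (.phaseTwo Kb σ ℓ β) (.halt .exhausted)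
  | iterate (Kb : Finset (Fin n)) (σ : Fin m → Fin n) (ℓ β : Row Kb σ → Col Kb)
      (h : (rounded A b c Kb σ ℓ).OptimalTableau β)
      (hopt : ¬ IsOptimalBasis A b c (merge β))
      (hcard : ((Kb ∪ largeSet A b c Kb σ ℓ β)ᶜ).card ≠ n - m) :
      Step (.phaseTwo Kb σ ℓ β) (.start (Kb ∪ largeSet A b c Kb σ ℓ β))

/-- A (possibly unfinished) run of the algorithm. -/
def IsRun (run : List (Config ℝ m n)) : Prop :=
  run.head? = some (.start ∅) ∧ run.IsChain (Step A b c)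

/-- The auxiliary problems (both phases of every rounded problem) that occur in the run are
non-degenerate. -/
def AuxNondegenerate (run : List (Config ℝ m n)) : Prop :=
  ∀ (Kb : Finset (Fin n)) (σ : Fin m → Fin n) (ℓ : Row Kb σ → Col Kb),
    Config.roundedProblem Kb σ ℓ ∈ run →
      (rounded A b c Kb σ ℓ).phaseOne.Nondegenerate ∧ (rounded A b c Kb σ ℓ).Nondegenerate

/-- What an outcome tells about the original problem. -/
def Correct : Outcome ℝ n → Prop
  | .optimalBasis x => (original A b c).IsOptimal x
  | .zeroRhs x => (0 ≤ x ∧ (original A b c).IsOptimal x) ∨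
      (¬ 0 ≤ x ∧ (original A b c).Infeasible) ∨
      (b = 0 ∧ x = 0 ∧ (original A b c).Unbounded)
  | .roundedInfeasible => (original A b c).Infeasible
  | .roundedUnbounded => (original A b c).Infeasible ∨ (original A b c).Unbounded
  | .exhausted => (original A b c).Infeasible

/-- The standing assumptions: `A` is totally unimodular and has full row rank, and the original
problem has at most one optimal solution. -/
def Admissible : Prop :=
  A.IsTotallyUnimodular ∧ A.rank = m ∧
    ∀ x y, (original A b c).IsOptimal x → (original A b c).IsOptimal y → x = y

end

/-! ## Programs made of elementary arithmetic operations

A program has access to its numbers, which are of an arbitrary type `V`, only through the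
operations below; each of them costs one unit. -/

inductive Arith : Type
  | add | sub | mul | div

inductive Prog (V α : Type) : Type
  | ret (a : α)
  /-- Load an integer (loop counters and dimensions of the problem). -/
  | load (z : ℤ) (k : V → Prog V α)
  | arith (o : Arith) (x y : V) (k : V → Prog V α)
  /-- The comparison `x < y`. -/
  | lt (x y : V) (k : Bool → Prog V α)

namespace Prog

def bind {V α β : Type} : Prog V α → (α → Prog V β) → Prog V β
  | ret a, f => f a
  | load z k, f => load z fun v => (k v).bind f
  | arith o x y k, f => arith o x y fun v => (k v).bind f
  | lt x y k, f => lt x y fun v => (k v).bind f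

instance instMonad {V : Type} : Monad (Prog V) where
  pure := ret
  bind := bind

section
variable {F : Type} [Field F] [LinearOrder F]

def evalArith : Arith → F → F → F
  | .add, x, y => x + y
  | .sub, x, y => x - y
  | .mul, x, y => x * y
  | .div, x, y => x / y

def result {α : Type} : Prog F α → α
  | ret a => a
  | load z k => (k (z : F)).result
  | arith o x y k => (k (evalArith o x y)).result
  | lt x y k => (k (decide (x < y))).result

/-- The number of elementary operations. -/
def cost {α : Type} : Prog F α → ℕ
  | ret _ => 0
  | load z k => (k (z : F)).cost + 1
  | arith o x y k => (k (evalArith o x y)).cost + 1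
  | lt x y k => (k (decide (x < y))).cost + 1

/-- All the numbers that are produced. -/
def values {α : Type} : Prog F α → List F
  | ret _ => []
  | load z k => (z : F) :: (k (z : F)).values
  | arith o x y k => evalArith o x y :: (k (evalArith o x y)).values
  | lt x y k => (k (decide (x < y))).values

end

section
variable {V : Type}

def int (z : ℤ) : Prog V V := load z ret
def add (x y : V) : Prog V V := arith .add x y ret
def sub (x y : V) : Prog V V := arith .sub x y ret
def mul (x y : V) : Prog V V := arith .mul x y ret
def div (x y : V) : Prog V V := arith .div x y ret
def less (x y : V) : Prog V Bool := lt x y ret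

def isZero (x : V) : Prog V Bool := do
  let z ← int 0
  let l ← less x z
  let g ← less z x
  return !l && !g

/-! ### Vectors and sums -/

def tabFin {α : Type} : (k : ℕ) → (Fin k → Prog V α) → Prog V (Fin k → α)
  | 0, _ => return Fin.elim0
  | k + 1, f => do
    let a ← f 0
    let r ← tabFin k fun i => f i.succ
    return Fin.cons a r

def tab {ι α : Type} [FinEnum ι] (f : ι → Prog V α) : Prog V (ι → α) := do
  let g ← tabFin (FinEnum.card ι) fun i => f (FinEnum.equiv.symm i)
  return fun i => g (FinEnum.equiv i)

def sumList {ι : Type} (f : ι → Prog V V) : List ι → V → Prog V V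
  | [], acc => return acc
  | i :: l, acc => do
    let t ← f i
    let acc' ← add acc t
    sumList f l acc'

def sum {ι : Type} [FinEnum ι] (f : ι → Prog V V) : Prog V V := do
  let z ← int 0
  sumList f (FinEnum.toList ι) z

/-- The first element of the list at which `f` is nonzero. -/
def firstNonzero {ι : Type} (f : ι → V) : List ι → Prog V (Option ι)
  | [] => return none
  | i :: l => do
    let z ← isZero (f i)
    if z then firstNonzero f l else return some i

/-- The first element with the least value of `f` among `best` and the list. -/
def argminFrom {ι : Type} (f : ι → V) : List ι → ι → Prog V ι
  | [], best => return best
  | i :: l, best => do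
    let t ← less (f i) (f best)
    argminFrom f l (if t then i else best)

def argmin {ι : Type} (f : ι → V) : List ι → Prog V (Option ι)
  | [] => return none
  | i :: l => do
    let s ← argminFrom f l i
    return some s

/-! ### Pivoting and Gauss-Jordan elimination -/

/-- A tableau: the matrix and the right-hand side. -/
abbrev Tab (V ρ κ : Type) : Type := (ρ → κ → V) × (ρ → V)

def pivot {ρ κ : Type} [FinEnum ρ] [FinEnum κ] (T : Tab V ρ κ) (r : ρ) (s : κ) :
    Prog V (Tab V ρ κ) := do
  let Tr ← tab fun j => div (T.1 r j) (T.1 r s)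
  let wr ← div (T.2 r) (T.1 r s)
  let M ← tab fun i => if i = r then pure Tr else tab fun j => do
    let t ← mul (T.1 i s) (Tr j)
    sub (T.1 i j) t
  let w ← tab fun i => if i = r then pure wr else do
    let t ← mul (T.1 i s) wr
    sub (T.2 i) t
  return (M, w)

def gaussLoop {ρ κ : Type} [FinEnum ρ] [FinEnum κ] (allowed : List κ) :
    List ρ → Tab V ρ κ → (ρ → Option κ) → Prog V (Option (Tab V ρ κ × (ρ → Option κ)))
  | [], T, σ => return some (T, σ)
  | i :: l, T, σ => do
    let p ← firstNonzero (T.1 i) allowed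
    match p with
    | none => return none
    | some s => do
      let T' ← pivot T i s
      gaussLoop allowed l T' (Function.update σ i (some s))

/-- Gauss-Jordan elimination: finds a basis `σ` among the allowed columns, together with the
tableau of this basis. -/
def gauss {ρ κ : Type} [FinEnum ρ] [FinEnum κ] (allowed : List κ) (T : Tab V ρ κ) :
    Prog V (Option (Tab V ρ κ × (ρ → κ))) := do
  let R ← gaussLoop allowed (FinEnum.toList ρ) T fun _ => none
  match R with
  | none => return none
  | some (T', σ) =>
    if h : ∀ i, (σ i).isSome then return some (T', fun i => (σ i).get (h i)) else return none

/-! ### The simplex method with Dantzig's rule -/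

inductive Status : Type
  | optimal | unbounded | timeout

def ratioTest {ρ κ : Type} (T : Tab V ρ κ) (s : κ) :
    List ρ → Option (ρ × V) → Prog V (Option (ρ × V))
  | [], best => return best
  | i :: l, best => do
    let z ← int 0
    let p ← less z (T.1 i s)
    if p then do
      let q ← div (T.2 i) (T.1 i s)
      match best with
      | none => ratioTest T s l (some (i, q))
      | some (i', q') => do
        let t ← less q q'
        ratioTest T s l (some (if t then (i, q) else (i', q')))
    else ratioTest T s l best

structure SimplexResult (V ρ κ : Type) where
  status : Status
  tab : Tab V ρ κ
  basis : ρ → κ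
  /-- All the bases that were visited. -/
  visited : List (ρ → κ)

def SimplexResult.visit {ρ κ : Type} (β : ρ → κ) (R : SimplexResult V ρ κ) :
    SimplexResult V ρ κ :=
  { R with visited := β :: R.visited }

/-- The first argument makes the recursion structural; it is instantiated below with an upper
bound for the number of bases. -/
def simplexLoop {ρ κ : Type} [FinEnum ρ] [FinEnum κ] (c : κ → V) :
    ℕ → Tab V ρ κ → (ρ → κ) → Prog V (SimplexResult V ρ κ)
  | 0, T, β => return ⟨.timeout, T, β, []⟩
  | fuel + 1, T, β => do
    let red ← tab fun j => do
      let z ← sum fun i => mul (c (β i)) (T.1 i j)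
      sub (c j) z
    let e ← argmin red (FinEnum.toList κ)
    match e with
    | none => return ⟨.optimal, T, β, [β]⟩
    | some s => do
      let z ← int 0
      let neg ← less (red s) z
      if neg then do
        let q ← ratioTest T s (FinEnum.toList ρ) none
        match q with
        | none => return ⟨.unbounded, T, β, [β]⟩
        | some (r, _) => do
          let T' ← pivot T r s
          let R ← simplexLoop c fuel T' (Function.update β r s)
          return R.visit β
      else return ⟨.optimal, T, β, [β]⟩

def simplex {ρ κ : Type} [FinEnum ρ] [FinEnum κ] (c : κ → V) (T : Tab V ρ κ) (β : ρ → κ) :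
    Prog V (SimplexResult V ρ κ) :=
  simplexLoop c (FinEnum.card κ ^ FinEnum.card ρ) T β

/-! ### Scaling and rounding -/

/-- The squared norm of the shortest solution `x = Mᵀ (M Mᵀ)⁻¹ w` of `M x = w`. -/
def minNormSq {ρ κ : Type} [FinEnum ρ] [FinEnum κ] (T : Tab V ρ κ) : Prog V V := do
  let S ← tab fun i => tab fun i' => sum fun j => mul (T.1 i j) (T.1 i' j)
  let G ← gauss (FinEnum.toList ρ) (S, T.2)
  match G with
  | none => int 0
  | some (T', π) => sum fun i => mul (T.2 (π i)) (T'.2 i)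

/-- The number of `t` with `0 ≤ t < N` and `(t - B) |t - B| s < u`. -/
def countBelow (B : ℕ) (s u : V) : ℕ → Prog V ℕ
  | 0 => return 0
  | N + 1 => do
    let a ← countBelow B s u N
    let t ← int (((N : ℤ) - B) * |(N : ℤ) - B|)
    let p ← mul t s
    let l ← less p u
    return if l then a + 1 else a

/-- `⌈v μ / √s⌉`, if its absolute value is at most `B`. As `y ↦ y |y|` is increasing, `t < v μ / √s`
is equivalent to `t |t| s < v μ |v μ|`, so that no square root is needed. -/
def ceilScaled (B μ : ℕ) (s v : V) : Prog V ℤ := do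
  let μ' ← int μ
  let w ← mul v μ'
  let q ← mul w w
  let z ← int 0
  let neg ← less w z
  let u ← if neg then sub z q else pure q
  let a ← countBelow B s u (2 * B)
  return (a : ℤ) - B

/-! ### The algorithm -/

/-- Solves `min {cᵀ x | E x = g, x ≥ 0}` by the two-phase simplex method. The result consists of
the bases visited in phase one, and of `none` if the problem is infeasible or the run of the
simplex method of phase two. -/
def twoPhase {ρ κ : Type} [FinEnum ρ] [FinEnum κ] (E : ρ → κ → V) (g : ρ → ℤ) (c : κ → V) :
    Prog V (List (ρ → κ ⊕ ρ) × Status × Option (SimplexResult V ρ κ)) := do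
  let zero ← int 0
  let one ← int 1
  let M ← tab fun i => tab fun j => if g i < 0 then sub zero (E i j) else pure (E i j)
  let w ← tab fun i => int |g i|
  let T : Tab V ρ (κ ⊕ ρ) := (fun i => Sum.elim (M i) fun i' => if i = i' then one else zero, w)
  let R ← simplex (Sum.elim (fun _ => zero) fun _ => one) T Sum.inr
  let val ← sum fun i => if (R.basis i).isRight then pure (R.tab.2 i) else int 0
  let pos ← less zero val
  if pos then return (R.visited, R.status, none)
  else if h : ∀ i, (R.basis i).isLeft then do
    let R' ← simplex c (fun i j => R.tab.1 i (Sum.inl j), R.tab.2)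
      fun i => (R.basis i).getLeft (h i)
    return (R.visited, R.status, some R')
  else return (R.visited, .timeout, none)

/-- The vector with entries `w i` at `σ i`, if `keep i`, and `0` elsewhere. -/
def scatter {m n : ℕ} (σ : Fin m → Fin n) (keep : Fin m → Bool) (w : Fin m → V) :
    Prog V (Fin n → V) :=
  tab fun j => sum fun i => if σ i = j ∧ keep i then pure (w i) else int 0

/-- The main loop. The first argument makes the recursion structural; it is instantiated below
with `n + 1`. The basis that extends `Kb` is looked for among the columns in `allowed`. -/
def mainLoop {m n : ℕ} (A : Fin m → Fin n → V) (b : Fin m → V) (c : Fin n → V) :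
    ℕ → Finset (Fin n) → List (Fin n) → Prog V (List (Config V m n))
  | 0, _, _ => return []
  | fuel + 1, Kb, allowed => do
    let G ← gauss allowed (A, b)
    match G with
    | none => return [.start Kb]
    | some ((T, w), σ) => do
      -- the reduced problem and its basis `L`, the part of `σ` outside of `Kb`
      let E : Row Kb σ → Col Kb → V := fun i j => T i j
      let v : Row Kb σ → V := fun i => w i
      let ℓ : Row Kb σ → Col Kb := fun i => ⟨σ i, i.2⟩
      let c' : Col Kb → V ← tab fun j => do
        let z ← sum fun i : {i : Fin m // σ i ∈ Kb} => mul (T i j) (c (σ i))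
        sub (c j) z
      let nz ← firstNonzero v (FinEnum.toList (Row Kb σ))
      match nz with
      | none => do
        let x ← scatter σ (fun i => decide (σ i ∈ Kb)) w
        return [.start Kb, .halt (.zeroRhs x)]
      | some _ => do
        -- scaling and rounding
        let m' := FinEnum.card (Row Kb σ)
        let n' := FinEnum.card (Col Kb)
        let s ← minNormSq (E, v)
        let g ← tab fun i => ceilScaled (n' * (m' + n' ^ 2)) (m' + n' ^ 2) s (v i)
        -- the rounded problem
        let Q ← twoPhase E g c'
        let pre : List (Config V m n) :=
          [.start Kb, .roundedProblem Kb σ ℓ] ++ Q.1.map (.phaseOne Kb σ ℓ)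
        match Q.2 with
        | (.optimal, none) => return pre ++ [.halt .roundedInfeasible]
        | (.optimal, some R) => do
          let pre' := pre ++ R.visited.map (.phaseTwo Kb σ ℓ)
          match R.status with
          | .timeout => return pre'
          | .unbounded => return pre' ++ [.halt .roundedUnbounded]
          | .optimal => do
            -- is `Kb ∪ L''` an optimal basis of the original problem?
            let τ := merge R.basis
            let allowed' := (List.finRange n).filter fun j => ∃ i, τ i = j
            let G' ← gauss allowed' (A, b)
            match G' with
            | none => return pre'
            | some ((_, x), τ') => do
              let zero ← int 0
              let bad ← tab fun i => less (x i) zero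
              if ∀ i, bad i = false then do
                let y ← scatter τ' (fun _ => true) x
                return pre' ++ [.halt (.optimalBasis y)]
              else do
                let big ← int n'
                let small ← tab fun i => less (R.tab.2 i) big
                let Kb' := Kb ∪ Finset.univ.filter fun j =>
                  ∃ i, (R.basis i : Fin n) = j ∧ small i = false
                if (Kb'ᶜ).card = n - m then return pre' ++ [.halt .exhausted]
                else do
                  let rest ← mainLoop A b c fuel Kb' allowed'
                  return pre' ++ rest
        | _ => return pre

/-- An implementation of the primal-simplex based Tardos' algorithm by elementary arithmetic
operations. It returns the list of the configurations that it went through. -/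
def tardos {m n : ℕ} (A : Fin m → Fin n → V) (b : Fin m → V) (c : Fin n → V) :
    Prog V (List (Config V m n)) :=
  mainLoop A b c (n + 1) ∅ (List.finRange n)

end

end Prog

/-- The number of bits of a rational number. -/
def bits (q : ℚ) : ℕ := 1 + Nat.size q.num.natAbs + Nat.size q.den

end PrimalTardos

open PrimalTardos

set_option linter.unusedSectionVars false
set_option linter.unusedSimpArgs false

namespace PrimalTardos

/-! ## Basic solutions and tableaus -/

namespace LP

section
variable {ρ κ : Type} [Fintype ρ] [DecidableEq ρ] [Fintype κ] [DecidableEq κ] {P : LP ρ κ}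
  {β : ρ → κ}

lemma IsBasis.mul_tableau (h : P.IsBasis β) : P.M.submatrix id β * P.tableau β = P.M := by
  rw [tableau, Matrix.mul_nonsing_inv_cancel_left _ _ h]

lemma IsBasis.mulVec_basicVal (h : P.IsBasis β) :
    (P.M.submatrix id β).mulVec (P.basicVal β) = P.rhs := by
  rw [basicVal, Matrix.mulVec_mulVec, Matrix.mul_nonsing_inv _ h, Matrix.one_mulVec]

lemma IsBasis.mulVec_cancel (h : P.IsBasis β) {u v : ρ → ℝ}
    (huv : (P.M.submatrix id β).mulVec u = (P.M.submatrix id β).mulVec v) : u = v := by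
  have := congrArg (fun w => ((P.M.submatrix id β)⁻¹).mulVec w) huv
  simpa [Matrix.mulVec_mulVec, Matrix.nonsing_inv_mul _ h] using this

lemma IsBasis.eq_basicVal (h : P.IsBasis β) {u : ρ → ℝ}
    (hu : (P.M.submatrix id β).mulVec u = P.rhs) : P.basicVal β = u :=
  h.mulVec_cancel (h.mulVec_basicVal.trans hu.symm)

lemma IsBasis.mulVec_tableau_col (h : P.IsBasis β) (j : κ) :
    (P.M.submatrix id β).mulVec (fun i => P.tableau β i j) = fun i => P.M i j := by
  funext i
  have := congrFun (congrFun h.mul_tableau i) j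
  rwa [Matrix.mul_apply] at this

lemma IsBasis.tableau_col_eq (h : P.IsBasis β) {u : ρ → ℝ} {j : κ}
    (hu : (P.M.submatrix id β).mulVec u = fun i => P.M i j) :
    (fun i => P.tableau β i j) = u :=
  h.mulVec_cancel ((h.mulVec_tableau_col j).trans hu.symm)

lemma IsBasis.tableau_basis (h : P.IsBasis β) (i i' : ρ) :
    P.tableau β i (β i') = if i = i' then 1 else 0 := by
  have := h.tableau_col_eq (u := Pi.single i' 1) (j := β i') (by
    rw [Matrix.mulVec_single_one]; rfl)
  rw [congrFun this i, Pi.single_apply]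

lemma IsBasis.injective (h : P.IsBasis β) : Function.Injective β := by
  intro i i' hii
  by_contra hne
  have h1 := h.tableau_basis i i'
  rw [← hii, h.tableau_basis i i, if_pos rfl, if_neg hne] at h1
  exact one_ne_zero h1

lemma sum_mul_basicSol (P : LP ρ κ) (β : ρ → κ) (f : κ → ℝ) :
    ∑ j, f j * P.basicSol β j = ∑ i, f (β i) * P.basicVal β i := by
  simp only [basicSol, Finset.mul_sum]
  rw [Finset.sum_comm]
  refine Finset.sum_congr rfl fun i _ => ?_
  simp

lemma basicSol_of_notMem (P : LP ρ κ) {j : κ} (hj : ∀ i, β i ≠ j) : P.basicSol β j = 0 := by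
  simp [basicSol, hj]

lemma basicSol_apply_of_injective (P : LP ρ κ) (h : Function.Injective β) (i : ρ) :
    P.basicSol β (β i) = P.basicVal β i := by
  simp [basicSol, h.eq_iff]

lemma IsBasis.basicSol_apply (h : P.IsBasis β) (i : ρ) :
    P.basicSol β (β i) = P.basicVal β i := P.basicSol_apply_of_injective h.injective i

lemma mulVec_basicSol_eq (P : LP ρ κ) (β : ρ → κ) :
    P.M.mulVec (P.basicSol β) = (P.M.submatrix id β).mulVec (P.basicVal β) := by
  funext k
  simp only [Matrix.mulVec, dotProduct]
  rw [P.sum_mul_basicSol β (fun j => P.M k j)]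
  rfl

lemma IsBasis.mulVec_basicSol (h : P.IsBasis β) : P.M.mulVec (P.basicSol β) = P.rhs := by
  rw [mulVec_basicSol_eq, h.mulVec_basicVal]

lemma basicSol_nonneg (P : LP ρ κ) (h : 0 ≤ P.basicVal β) : 0 ≤ P.basicSol β := fun j =>
  Finset.sum_nonneg fun i _ => by split_ifs; exacts [h i, le_rfl]

lemma IsBasis.feasible (h : P.IsBasis β) (h0 : 0 ≤ P.basicVal β) : P.Feasible (P.basicSol β) :=
  ⟨h.mulVec_basicSol, P.basicSol_nonneg h0⟩

lemma IsBasis.nonneg_of_basicSol (h : P.IsBasis β) (h0 : 0 ≤ P.basicSol β) :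
    0 ≤ P.basicVal β := fun i => by rw [← h.basicSol_apply]; exact h0 _

lemma tableau_mulVec (P : LP ρ κ) (β : ρ → κ) (x : κ → ℝ) :
    (P.tableau β).mulVec x = ((P.M.submatrix id β)⁻¹).mulVec (P.M.mulVec x) := by
  rw [tableau, Matrix.mulVec_mulVec]

lemma tableau_mulVec_of_eq {x : κ → ℝ} (hx : P.M.mulVec x = P.rhs) :
    (P.tableau β).mulVec x = P.basicVal β := by
  rw [tableau_mulVec, hx]; rfl

lemma tableau_mulVec_of_eq_zero {x : κ → ℝ} (hx : P.M.mulVec x = 0) :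
    (P.tableau β).mulVec x = 0 := by
  rw [tableau_mulVec, hx, Matrix.mulVec_zero]

lemma IsBasis.mulVec_eq_zero (h : P.IsBasis β) {x : κ → ℝ} (hx : (P.tableau β).mulVec x = 0) :
    P.M.mulVec x = 0 := by
  rw [← h.mul_tableau, ← Matrix.mulVec_mulVec, hx, Matrix.mulVec_zero]

lemma IsBasis.redCost_basis (h : P.IsBasis β) (i : ρ) : P.redCost β (β i) = 0 := by
  simp [redCost, h.tableau_basis]

lemma sum_redCost_mul (P : LP ρ κ) (β : ρ → κ) (x : κ → ℝ) :
    ∑ j, P.redCost β j * x j = P.value x - ∑ i, P.cost (β i) * (P.tableau β).mulVec x i := by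
  simp only [redCost, sub_mul, Finset.sum_sub_distrib, value, Matrix.mulVec, dotProduct,
    Finset.mul_sum, Finset.sum_mul]
  congr 1
  rw [Finset.sum_comm]
  simp only [mul_assoc]

lemma value_basicSol (P : LP ρ κ) (β : ρ → κ) :
    P.value (P.basicSol β) = ∑ i, P.cost (β i) * P.basicVal β i :=
  P.sum_mul_basicSol β P.cost

lemma value_eq_add (P : LP ρ κ) (β : ρ → κ) {x : κ → ℝ} (hx : P.M.mulVec x = P.rhs) :
    P.value x = P.value (P.basicSol β) + ∑ j, P.redCost β j * x j := by
  rw [sum_redCost_mul, tableau_mulVec_of_eq hx, value_basicSol]; ring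

lemma OptimalTableau.value_le (h : P.OptimalTableau β) {x : κ → ℝ} (hx : P.Feasible x) :
    P.value (P.basicSol β) ≤ P.value x := by
  rw [P.value_eq_add β hx.1]
  have : 0 ≤ ∑ j, P.redCost β j * x j :=
    Finset.sum_nonneg fun j _ => mul_nonneg (h j) (hx.2 j)
  linarith

lemma OptimalTableau.isOptimal (h : P.OptimalTableau β) (hb : P.IsBasis β)
    (h0 : 0 ≤ P.basicVal β) : P.IsOptimal (P.basicSol β) :=
  ⟨hb.feasible h0, fun _ hy => h.value_le hy⟩

lemma OptimalTableau.not_unbounded (h : P.OptimalTableau β) : ¬ P.Unbounded := fun hu => by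
  obtain ⟨x, hx, hlt⟩ := hu (P.value (P.basicSol β))
  exact absurd (h.value_le hx) (not_le.2 hlt)

lemma value_add (P : LP ρ κ) (x y : κ → ℝ) : P.value (x + y) = P.value x + P.value y := by
  simp [value, mul_add, Finset.sum_add_distrib]

lemma value_sub (P : LP ρ κ) (x y : κ → ℝ) : P.value (x - y) = P.value x - P.value y := by
  simp [value, mul_sub, Finset.sum_sub_distrib]

lemma value_smul (P : LP ρ κ) (t : ℝ) (x : κ → ℝ) : P.value (t • x) = t * P.value x := by
  simp [value, Finset.mul_sum, mul_left_comm]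

/-- The direction in which the nonbasic variable `s` increases. -/
noncomputable def ray (P : LP ρ κ) (β : ρ → κ) (s : κ) : κ → ℝ :=
  fun j => (if j = s then 1 else 0) - ∑ i, if β i = j then P.tableau β i s else 0

lemma sum_mul_ray (P : LP ρ κ) (β : ρ → κ) (s : κ) (f : κ → ℝ) :
    ∑ j, f j * P.ray β s j = f s - ∑ i, f (β i) * P.tableau β i s := by
  simp only [ray, mul_sub, Finset.sum_sub_distrib, Finset.mul_sum]
  rw [Finset.sum_comm (γ := κ)]
  simp

lemma IsBasis.mulVec_ray (hb : P.IsBasis β) (s : κ) : P.M.mulVec (P.ray β s) = 0 := by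
  funext k
  have := congrFun (hb.mulVec_tableau_col s) k
  simp only [Matrix.mulVec, dotProduct, Matrix.submatrix_apply, id] at this
  simp only [Matrix.mulVec, dotProduct, Pi.zero_apply]
  rw [P.sum_mul_ray β s (fun j => P.M k j), this, sub_self]

lemma UnboundedTableau.exists_ray (h : P.UnboundedTableau β) (hb : P.IsBasis β) :
    ∃ d : κ → ℝ, 0 ≤ d ∧ P.M.mulVec d = 0 ∧ P.value d < 0 := by
  obtain ⟨s, ⟨hs, -⟩, hcol⟩ := h
  refine ⟨P.ray β s, fun j => ?_, hb.mulVec_ray s, ?_⟩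
  · have h1 : (∑ i, if β i = j then P.tableau β i s else 0) ≤ 0 :=
      Finset.sum_nonpos fun i _ => by split_ifs; exacts [hcol i, le_rfl]
    have h2 : (0 : ℝ) ≤ if j = s then 1 else 0 := by split_ifs <;> norm_num
    simp only [ray, Pi.zero_apply]
    linarith
  · rw [value, P.sum_mul_ray β s P.cost]
    exact hs

/-! ### Pivoting -/

lemma submatrix_update (P : LP ρ κ) (β : ρ → κ) (r : ρ) (s : κ) :
    P.M.submatrix id (Function.update β r s) =
      (P.M.submatrix id β).updateCol r (fun i => P.M i s) := by
  ext i k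
  by_cases hk : k = r
  · subst hk; simp
  · simp [Function.update_of_ne hk, Matrix.updateCol_ne hk]

lemma IsBasis.update (h : P.IsBasis β) {r : ρ} {s : κ} (hrs : P.tableau β r s ≠ 0) :
    P.IsBasis (Function.update β r s) := by
  have hdet : (P.M.submatrix id (Function.update β r s)).det =
      (P.M.submatrix id β).det * P.tableau β r s := by
    have h1 : P.M.submatrix id (Function.update β r s) = P.M.submatrix id β *
        (1 : Matrix ρ ρ ℝ).updateCol r (fun i => P.tableau β i s) := by
      rw [submatrix_update, Matrix.mul_updateCol, mul_one, h.mulVec_tableau_col]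
    have h2 : ((1 : Matrix ρ ρ ℝ).updateCol r (fun i => P.tableau β i s)).det =
        P.tableau β r s := by
      rw [← Matrix.cramer_apply, Matrix.cramer_one]; rfl
    rw [h1, Matrix.det_mul, h2]
  rw [IsBasis, hdet]
  exact (IsUnit.mul_iff).2 ⟨h, isUnit_iff_ne_zero.2 hrs⟩

/-- The effect of a pivot at row `r` on a column; `t` is the entering column. -/
noncomputable def pivotVec (r : ρ) (t u : ρ → ℝ) : ρ → ℝ :=
  fun i => if i = r then u r / t r else u i - t i * (u r / t r)

lemma updateCol_mulVec_pivotVec (B : Matrix ρ ρ ℝ) {r : ρ} {t u : ρ → ℝ} (ht : t r ≠ 0) :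
    (B.updateCol r (B.mulVec t)).mulVec (pivotVec r t u) = B.mulVec u := by
  have h1 : pivotVec r t u = u - (u r / t r) • t + Pi.single r (u r / t r) := by
    funext i
    by_cases hi : i = r
    · subst hi; simp [pivotVec]; field_simp; ring
    · simp [pivotVec, hi]; ring
  have h2 : B.updateCol r (B.mulVec t) =
      B + Matrix.of (fun i k => if k = r then B.mulVec t i - B i r else 0) := by
    ext i k
    by_cases hk : k = r
    · subst hk; simp
    · simp [hk]
  have h3 : ∀ v : ρ → ℝ, (Matrix.of (fun i k => if k = r then B.mulVec t i - B i r else 0)).mulVec v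
      = v r • (B.mulVec t - fun i => B i r) := by
    intro v; funext i; simp [Matrix.mulVec, dotProduct, mul_comm]
  have h4 : pivotVec r t u r = u r / t r := by simp [pivotVec]
  rw [h2, Matrix.add_mulVec, h3, h4, h1, Matrix.mulVec_add, Matrix.mulVec_sub, Matrix.mulVec_smul,
    Matrix.mulVec_single]
  funext i
  simp [Matrix.col]
  ring

lemma IsBasis.basicVal_update (h : P.IsBasis β) {r : ρ} {s : κ} (hrs : P.tableau β r s ≠ 0) :
    P.basicVal (Function.update β r s) =
      pivotVec r (fun i => P.tableau β i s) (P.basicVal β) := by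
  refine (h.update hrs).eq_basicVal ?_
  rw [submatrix_update, ← h.mulVec_tableau_col s, updateCol_mulVec_pivotVec _ (t := fun i => P.tableau β i s) hrs,
    h.mulVec_basicVal]

lemma IsBasis.tableau_update (h : P.IsBasis β) {r : ρ} {s : κ} (hrs : P.tableau β r s ≠ 0)
    (j : κ) : (fun i => P.tableau (Function.update β r s) i j) =
      pivotVec r (fun i => P.tableau β i s) (fun i => P.tableau β i j) := by
  refine (h.update hrs).tableau_col_eq ?_
  rw [submatrix_update, ← h.mulVec_tableau_col s, updateCol_mulVec_pivotVec _ (t := fun i => P.tableau β i s) hrs,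
    h.mulVec_tableau_col]

/-- A basis of a basic feasible solution. -/
def IsFeasibleBasis (P : LP ρ κ) (β : ρ → κ) : Prop := P.IsBasis β ∧ 0 ≤ P.basicVal β

lemma DantzigPivot.isFeasibleBasis {β' : ρ → κ} (h : P.DantzigPivot β β')
    (hb : P.IsFeasibleBasis β) : P.IsFeasibleBasis β' := by
  obtain ⟨s, r, hs, hr, hmin, rfl⟩ := h
  refine ⟨hb.1.update hr.ne', ?_⟩
  rw [hb.1.basicVal_update hr.ne']
  have h0 : 0 ≤ P.basicVal β r / P.tableau β r s := div_nonneg (hb.2 r) hr.le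
  intro i
  simp only [pivotVec, Pi.zero_apply]
  split_ifs with hi
  · exact h0
  · rcases lt_or_ge 0 (P.tableau β i s) with hpos | hneg
    · have := hmin i hpos
      rw [le_div_iff₀ hpos] at this
      linarith
    · have := mul_nonneg (neg_nonneg.2 hneg) h0
      have := hb.2 i
      simp only [Pi.zero_apply] at this
      linarith

lemma DantzigPivot.exists_value {β' : ρ → κ} (h : P.DantzigPivot β β') (hb : P.IsFeasibleBasis β) :
    ∃ s r, P.DantzigEntering β s ∧ β' r = s ∧
      P.value (P.basicSol β') = P.value (P.basicSol β) + P.redCost β s * P.basicVal β' r := by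
  have hb' := h.isFeasibleBasis hb
  obtain ⟨s, r, hs, hr, hmin, rfl⟩ := h
  refine ⟨s, r, hs, by simp, ?_⟩
  rw [P.value_eq_add β hb'.1.mulVec_basicSol, P.sum_mul_basicSol, Finset.sum_eq_single r]
  · simp
  · intro i _ hi
    rw [Function.update_of_ne hi, hb.1.redCost_basis, zero_mul]
  · simp

lemma DantzigPivot.value_lt {β' : ρ → κ} (h : P.DantzigPivot β β') (hb : P.IsFeasibleBasis β)
    (hnd : P.Nondegenerate) : P.value (P.basicSol β') < P.value (P.basicSol β) := by
  have hb' := h.isFeasibleBasis hb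
  obtain ⟨s, r, hs, -, hv⟩ := h.exists_value hb
  have := mul_neg_of_neg_of_pos hs.1 (hnd _ hb'.1 hb'.2 r)
  linarith

/-- In every tableau the simplex method stops or makes a pivot. -/
lemma optimal_or_unbounded_or_pivot (P : LP ρ κ) (β : ρ → κ) :
    P.OptimalTableau β ∨ P.UnboundedTableau β ∨ ∃ β', P.DantzigPivot β β' := by
  by_cases hopt : P.OptimalTableau β
  · exact Or.inl hopt
  · simp only [OptimalTableau, not_forall, not_le] at hopt
    obtain ⟨j, hj⟩ := hopt
    have : Nonempty κ := ⟨j⟩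
    obtain ⟨s, hs⟩ := Finite.exists_min (P.redCost β)
    have hs' : P.DantzigEntering β s := ⟨(hs j).trans_lt hj, hs⟩
    right
    by_cases hcol : ∀ i, P.tableau β i s ≤ 0
    · exact Or.inl ⟨s, hs', hcol⟩
    · right
      push Not at hcol
      obtain ⟨i, hi⟩ := hcol
      have : Nonempty {i // 0 < P.tableau β i s} := ⟨⟨i, hi⟩⟩
      obtain ⟨r, hr⟩ := Finite.exists_min
        fun i : {i // 0 < P.tableau β i s} => P.basicVal β i / P.tableau β i s
      exact ⟨_, s, r, hs', r.2, fun i hi => hr ⟨i, hi⟩, rfl⟩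

/-! ### Sequences of pivots -/

/-- `T` pivots lead from `β₀` to `β`. -/
inductive PivotPath (P : LP ρ κ) (β₀ : ρ → κ) : ℕ → (ρ → κ) → Prop
  | refl : PivotPath P β₀ 0 β₀
  | snoc {T : ℕ} {β β' : ρ → κ} : PivotPath P β₀ T β → P.DantzigPivot β β' →
      PivotPath P β₀ (T + 1) β'

lemma PivotPath.cons {β₀ β₁ β : ρ → κ} {T : ℕ} (h : P.DantzigPivot β₀ β₁)
    (hp : P.PivotPath β₁ T β) : P.PivotPath β₀ (T + 1) β := by
  induction hp with
  | refl => exact PivotPath.snoc .refl h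
  | snoc _ h' ih => exact PivotPath.snoc ih h'

lemma PivotPath.exists_seq {β₀ β : ρ → κ} {T : ℕ} (h : P.PivotPath β₀ T β) :
    ∃ f : ℕ → ρ → κ, f 0 = β₀ ∧ f T = β ∧ ∀ t < T, P.DantzigPivot (f t) (f (t + 1)) := by
  induction h with
  | refl => exact ⟨fun _ => β₀, rfl, rfl, by simp⟩
  | @snoc T β β' _ h' ih =>
    obtain ⟨f, h0, hT, hf⟩ := ih
    refine ⟨fun t => if t ≤ T then f t else β', by simp [h0], by simp, fun t ht => ?_⟩
    rcases Nat.lt_succ_iff_lt_or_eq.1 ht with ht | rfl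
    · have : t + 1 ≤ T := ht
      simp [ht.le, this, hf t ht]
    · simp [hT, h']

lemma PivotPath.isFeasibleBasis {β₀ β : ρ → κ} {T : ℕ} (h : P.PivotPath β₀ T β)
    (h0 : P.IsFeasibleBasis β₀) : P.IsFeasibleBasis β := by
  induction h with
  | refl => exact h0
  | snoc _ h' ih => exact h'.isFeasibleBasis ih

lemma isFeasibleBasis_of_seq {f : ℕ → ρ → κ} {T : ℕ} (h0 : P.IsFeasibleBasis (f 0))
    (hf : ∀ t < T, P.DantzigPivot (f t) (f (t + 1))) :
    ∀ t ≤ T, P.IsFeasibleBasis (f t) := by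
  intro t
  induction t with
  | zero => exact fun _ => h0
  | succ t ih => exact fun ht => (hf t ht).isFeasibleBasis (ih (by omega))

/-- No basis is repeated, as the objective function decreases. -/
lemma PivotPath.lt_card {β₀ β : ρ → κ} {T : ℕ} (h : P.PivotPath β₀ T β)
    (h0 : P.IsFeasibleBasis β₀) (hnd : P.Nondegenerate) :
    T < Fintype.card κ ^ Fintype.card ρ := by
  obtain ⟨f, hf0, -, hf⟩ := h.exists_seq
  have hfb := isFeasibleBasis_of_seq (P := P) (hf0 ▸ h0) hf
  have hanti : ∀ s t, s < t → t ≤ T →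
      P.value (P.basicSol (f t)) < P.value (P.basicSol (f s)) := by
    intro s t hst
    induction t, hst using Nat.le_induction with
    | base => exact fun hs => (hf s hs).value_lt (hfb s (by omega)) hnd
    | succ t ht ih =>
      exact fun hT => ((hf t hT).value_lt (hfb t (by omega)) hnd).trans (ih (by omega))
  have hinj : Function.Injective fun t : Fin (T + 1) => f t := by
    intro s t hst
    by_contra hne
    rcases lt_or_gt_of_ne (fun h => hne (Fin.ext h) : (s : ℕ) ≠ t) with hlt | hlt
    · have := hanti s t hlt (by omega)
      simp only at hst
      rw [hst] at this
      exact lt_irrefl _ this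
    · have := hanti t s hlt (by omega)
      simp only at hst
      rw [hst] at this
      exact lt_irrefl _ this
  have := Fintype.card_le_of_injective _ hinj
  rw [Fintype.card_fin, Fintype.card_fun] at this
  omega

end

end LP

end PrimalTardos

namespace PrimalTardos

/-! ## Total unimodularity -/

section
variable {ρ κ : Type} [Fintype ρ] [DecidableEq ρ] [Fintype κ] [DecidableEq κ]

lemma sign_mul {x y : ℝ} (hx : x ∈ Set.range SignType.cast) (hy : y ∈ Set.range SignType.cast) :
    x * y ∈ Set.range (SignType.cast : SignType → ℝ) := by
  obtain ⟨a, rfl⟩ := hx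
  obtain ⟨b, rfl⟩ := hy
  exact ⟨a * b, by simp⟩

lemma abs_sign_le {x : ℝ} (hx : x ∈ Set.range (SignType.cast : SignType → ℝ)) : |x| ≤ 1 := by
  obtain ⟨a, rfl⟩ := hx
  cases a <;> simp

lemma sign_int {x : ℝ} (hx : x ∈ Set.range (SignType.cast : SignType → ℝ)) :
    ∃ z : ℤ, x = z ∧ |z| ≤ 1 := by
  obtain ⟨a, rfl⟩ := hx
  refine ⟨(a : ℤ), by simp, ?_⟩
  cases a <;> simp

lemma sign_inv {x : ℝ} (hx : x ∈ Set.range (SignType.cast : SignType → ℝ)) :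
    x⁻¹ ∈ Set.range (SignType.cast : SignType → ℝ) := by
  obtain ⟨a, rfl⟩ := hx
  refine ⟨a, ?_⟩
  cases a <;> simp

open Matrix in
lemma isTotallyUnimodular_smul_rows {M : Matrix ρ κ ℝ} (hM : M.IsTotallyUnimodular) (ε : ρ → ℝ)
    (hε : ∀ i, ε i ∈ Set.range (SignType.cast : SignType → ℝ)) :
    (Matrix.of fun i j => ε i * M i j).IsTotallyUnimodular := by
  intro k f g hf hg
  have h1 : (Matrix.of fun i j => ε i * M i j).submatrix f g =
      Matrix.of fun a b => (fun a => ε (f a)) a * (M.submatrix f g) a b := by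
    ext a b; simp
  rw [h1, Matrix.det_mul_column]
  refine sign_mul ?_ (hM k f g hf hg)
  exact Finset.prod_induction _ (· ∈ Set.range (SignType.cast : SignType → ℝ))
    (fun _ _ => sign_mul) ⟨1, by simp⟩ fun a _ => hε _

namespace LP

variable {P : LP ρ κ} {β : ρ → κ}

lemma det_mem_sign (hM : P.M.IsTotallyUnimodular) (β : ρ → κ) :
    (P.M.submatrix id β).det ∈ Set.range (SignType.cast : SignType → ℝ) :=
  (Matrix.isTotallyUnimodular_iff_fintype P.M).1 hM ρ id β

open Matrix in
lemma IsBasis.isTotallyUnimodular_tableau (h : P.IsBasis β) (hM : P.M.IsTotallyUnimodular) :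
    (P.tableau β).IsTotallyUnimodular := by
  classical
  intro k f g hf hg
  let p : ρ → Prop := fun i => ∃ a, f a = i
  let γ : ρ → κ := fun i => if hi : p i then g hi.choose else β i
  have hγf : ∀ a, γ (f a) = g a := fun a => by
    have hi : p (f a) := ⟨a, rfl⟩
    simp only [γ, dif_pos hi]
    rw [hf hi.choose_spec]
  have hW : ((P.tableau β).submatrix id γ).det ∈ Set.range (SignType.cast : SignType → ℝ) := by
    have h1 : (P.tableau β).submatrix id γ = (P.M.submatrix id β)⁻¹ * P.M.submatrix id γ := by
      ext i j; rfl
    rw [h1, Matrix.det_mul, Matrix.det_nonsing_inv, Ring.inverse_eq_inv']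
    exact sign_mul (sign_inv (det_mem_sign hM β)) (det_mem_sign hM γ)
  rw [Matrix.twoBlockTriangular_det' _ p] at hW
  · have h2 : (((P.tableau β).submatrix id γ).toSquareBlockProp fun i => ¬ p i) = 1 := by
      ext ⟨i, hi⟩ ⟨j, hj⟩
      simp only [toSquareBlockProp, Matrix.submatrix_apply, id, Matrix.one_apply, Subtype.mk.injEq,
        Matrix.toBlock_apply]
      rw [show γ j = β j from dif_neg hj, h.tableau_basis]
    have h3 : (((P.tableau β).submatrix id γ).toSquareBlockProp p).det =
        ((P.tableau β).submatrix f g).det := by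
      let e : Fin k ≃ {i // p i} := Equiv.ofInjective f hf
      rw [← Matrix.det_submatrix_equiv_self e]
      congr 1
      ext a b
      have : ∀ a, (e a : ρ) = f a := fun a => rfl
      simp [toSquareBlockProp, this, hγf]
    rwa [h2, h3, Matrix.det_one, mul_one] at hW
  · intro i hi j hj
    have hij : i ≠ j := by rintro rfl; exact hj hi
    simp only [Matrix.submatrix_apply, id]
    rw [show γ j = β j from dif_neg hj, h.tableau_basis, if_neg hij]

/-- The problem with a unit column added for every row. -/
noncomputable def withUnits (P : LP ρ κ) : LP ρ (κ ⊕ ρ) :=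
  ⟨Matrix.fromCols P.M 1, P.rhs, Sum.elim P.cost 0⟩

lemma withUnits_submatrix_inl (P : LP ρ κ) (β : ρ → κ) :
    P.withUnits.M.submatrix id (fun i => Sum.inl (β i)) = P.M.submatrix id β := by
  ext i j; simp [withUnits]

lemma withUnits_isBasis_inl : P.withUnits.IsBasis (fun i => Sum.inl (β i)) ↔ P.IsBasis β := by
  rw [IsBasis, withUnits_submatrix_inl]; rfl

lemma withUnits_basicVal_inl (P : LP ρ κ) (β : ρ → κ) :
    P.withUnits.basicVal (fun i => Sum.inl (β i)) = P.basicVal β := by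
  rw [basicVal, withUnits_submatrix_inl]; rfl

lemma withUnits_tableau_inl (P : LP ρ κ) (β : ρ → κ) (i : ρ) (j : κ) :
    P.withUnits.tableau (fun i => Sum.inl (β i)) i (Sum.inl j) = P.tableau β i j := by
  rw [tableau, withUnits_submatrix_inl]; simp [withUnits, tableau, Matrix.mul_apply]

lemma withUnits_tableau_inr (P : LP ρ κ) (β : ρ → κ ⊕ ρ) (i k : ρ) :
    P.withUnits.tableau β i (Sum.inr k) = (P.withUnits.M.submatrix id β)⁻¹ i k := by
  rw [tableau]; simp [withUnits, Matrix.mul_apply, Matrix.one_apply]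

lemma withUnits_isBasis_inr (P : LP ρ κ) : P.withUnits.IsBasis Sum.inr := by
  have : P.withUnits.M.submatrix id Sum.inr = 1 := by ext i j; simp [withUnits]
  rw [IsBasis, this]; simp

lemma withUnits_tableau_init (P : LP ρ κ) (i : ρ) (j : κ) :
    P.withUnits.tableau Sum.inr i (Sum.inl j) = P.M i j := by
  have : P.withUnits.M.submatrix id Sum.inr = 1 := by ext i j; simp [withUnits]
  rw [tableau, this]; simp [withUnits]

lemma withUnits_basicVal_init (P : LP ρ κ) : P.withUnits.basicVal Sum.inr = P.rhs := by
  have : P.withUnits.M.submatrix id Sum.inr = 1 := by ext i j; simp [withUnits]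
  rw [basicVal, this]; simp [withUnits]

lemma withUnits_isTotallyUnimodular (hM : P.M.IsTotallyUnimodular) :
    P.withUnits.M.IsTotallyUnimodular := by
  rw [withUnits, Matrix.fromCols_one_isTotallyUnimodular_iff]; exact hM

lemma IsBasis.inv_mem_sign (h : P.IsBasis β) (hM : P.M.IsTotallyUnimodular) (i k : ρ) :
    (P.M.submatrix id β)⁻¹ i k ∈ Set.range (SignType.cast : SignType → ℝ) := by
  have := ((withUnits_isBasis_inl.2 h).isTotallyUnimodular_tableau
    (withUnits_isTotallyUnimodular hM)).apply i (Sum.inr k)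
  rwa [withUnits_tableau_inr, withUnits_submatrix_inl] at this

lemma IsBasis.abs_basicVal_le (h : P.IsBasis β) (hM : P.M.IsTotallyUnimodular) (i : ρ) :
    |P.basicVal β i| ≤ ∑ k, |P.rhs k| := by
  rw [basicVal, Matrix.mulVec, dotProduct]
  refine (Finset.abs_sum_le_sum_abs _ _).trans (Finset.sum_le_sum fun k _ => ?_)
  rw [abs_mul]
  exact mul_le_of_le_one_left (abs_nonneg _) (abs_sign_le (h.inv_mem_sign hM i k))

lemma IsBasis.exists_int_basicVal (h : P.IsBasis β) (hM : P.M.IsTotallyUnimodular)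
    (hr : ∀ k, ∃ z : ℤ, P.rhs k = z) (i : ρ) : ∃ z : ℤ, P.basicVal β i = z := by
  choose z hz using hr
  choose y hy _ using fun k => sign_int (h.inv_mem_sign hM i k)
  refine ⟨∑ k, y k * z k, ?_⟩
  simp [basicVal, Matrix.mulVec, dotProduct, hy, hz]

/-! ## Phase one -/

/-- The sign by which a row is multiplied in phase one. -/
noncomputable def rowSign (P : LP ρ κ) (i : ρ) : ℝ := if P.rhs i < 0 then -1 else 1

lemma rowSign_mul_self (P : LP ρ κ) (i : ρ) : P.rowSign i * P.rowSign i = 1 := by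
  unfold rowSign; split_ifs <;> simp

lemma phaseOne_M_inl (P : LP ρ κ) (i : ρ) (j : κ) :
    P.phaseOne.M i (Sum.inl j) = P.rowSign i * P.M i j := by
  simp only [phaseOne, rowSign, Sum.elim_inl]; split_ifs <;> simp

lemma phaseOne_M_inr (P : LP ρ κ) (i k : ρ) :
    P.phaseOne.M i (Sum.inr k) = if i = k then 1 else 0 := by
  simp [phaseOne]

lemma phaseOne_rhs (P : LP ρ κ) (i : ρ) : P.phaseOne.rhs i = P.rowSign i * P.rhs i := by
  simp only [phaseOne, rowSign]
  split_ifs with h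
  · rw [abs_of_neg h]; ring
  · rw [abs_of_nonneg (not_lt.1 h)]; ring

lemma phaseOne_isTotallyUnimodular (hM : P.M.IsTotallyUnimodular) :
    P.phaseOne.M.IsTotallyUnimodular := by
  have h1 : P.phaseOne.M = Matrix.fromCols (Matrix.of fun i j => P.rowSign i * P.M i j) 1 := by
    ext i (j | k)
    · simp [phaseOne_M_inl]
    · simp [phaseOne_M_inr, Matrix.one_apply]
  rw [h1, Matrix.fromCols_one_isTotallyUnimodular_iff]
  refine isTotallyUnimodular_smul_rows hM _ fun i => ?_
  unfold rowSign
  split_ifs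
  exacts [⟨-1, by simp⟩, ⟨1, by simp⟩]

lemma phaseOne_submatrix_inr (P : LP ρ κ) : P.phaseOne.M.submatrix id Sum.inr = 1 := by
  ext i j; simp [phaseOne_M_inr, Matrix.one_apply]

lemma phaseOne_basicVal_inr (P : LP ρ κ) : P.phaseOne.basicVal Sum.inr = P.phaseOne.rhs := by
  rw [basicVal, phaseOne_submatrix_inr]; simp

lemma phaseOne_tableau_inr (P : LP ρ κ) : P.phaseOne.tableau Sum.inr = P.phaseOne.M := by
  rw [tableau, phaseOne_submatrix_inr]; simp

lemma phaseOne_isFeasibleBasis (P : LP ρ κ) : P.phaseOne.IsFeasibleBasis Sum.inr := by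
  refine ⟨?_, ?_⟩
  · rw [IsBasis, phaseOne_submatrix_inr]; simp
  · rw [phaseOne_basicVal_inr]; exact fun i => abs_nonneg _

lemma phaseOne_value (P : LP ρ κ) (x : κ ⊕ ρ → ℝ) :
    P.phaseOne.value x = ∑ i, x (Sum.inr i) := by
  simp [value, phaseOne]

lemma phaseOne_not_unboundedTableau {β : ρ → κ ⊕ ρ} (hb : P.phaseOne.IsBasis β) :
    ¬ P.phaseOne.UnboundedTableau β := fun h => by
  obtain ⟨d, hd, -, hv⟩ := h.exists_ray hb
  rw [phaseOne_value] at hv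
  exact absurd (Finset.sum_nonneg fun i _ => hd (Sum.inr i)) (not_le.2 hv)

lemma infeasible_of_phaseOne {β : ρ → κ ⊕ ρ} (h : P.phaseOne.OptimalTableau β)
    (hpos : 0 < P.phaseOne.value (P.phaseOne.basicSol β)) : P.Infeasible := fun x hx => by
  have hfe : P.phaseOne.Feasible (Sum.elim x 0) := by
    refine ⟨?_, fun j => ?_⟩
    · funext i
      have := congrFun hx.1 i
      simp only [Matrix.mulVec, dotProduct] at this
      simp only [Matrix.mulVec, dotProduct, Fintype.sum_sum_type, phaseOne_M_inl, phaseOne_rhs,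
        Sum.elim_inl, Sum.elim_inr, Pi.zero_apply, mul_zero, Finset.sum_const_zero, add_zero,
        mul_assoc, ← Finset.mul_sum, this]
    · rcases j with j | j
      exacts [hx.2 j, le_rfl]
  have := h.value_le hfe
  rw [phaseOne_value _ (Sum.elim x 0)] at this
  simp at this
  linarith

lemma isLeft_of_phaseOne_value {β : ρ → κ ⊕ ρ} (hb : P.phaseOne.IsFeasibleBasis β)
    (hnd : P.phaseOne.Nondegenerate)
    (hv : P.phaseOne.value (P.phaseOne.basicSol β) ≤ 0) (i : ρ) : (β i).isLeft := by
  by_contra hi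
  obtain ⟨k, hk⟩ : ∃ k, β i = Sum.inr k := by
    rcases hβ : β i with j | k
    · simp [hβ] at hi
    · exact ⟨k, rfl⟩
  rw [phaseOne_value] at hv
  have h1 : P.phaseOne.basicSol β (Sum.inr k) ≤ ∑ i, P.phaseOne.basicSol β (Sum.inr i) :=
    Finset.single_le_sum (f := fun i => P.phaseOne.basicSol β (Sum.inr i))
      (fun i _ => P.phaseOne.basicSol_nonneg hb.2 _) (Finset.mem_univ k)
  rw [← hk, hb.1.basicSol_apply] at h1
  have := hnd β hb.1 hb.2 i
  linarith

lemma phaseOne_submatrix_inl (P : LP ρ κ) (β : ρ → κ) :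
    P.phaseOne.M.submatrix id (Sum.inl ∘ β) =
      Matrix.diagonal P.rowSign * P.M.submatrix id β := by
  ext i j; simp [phaseOne_M_inl, Matrix.diagonal_mul]

lemma diagonal_rowSign_mulVec (P : LP ρ κ) (v : ρ → ℝ) :
    (Matrix.diagonal P.rowSign).mulVec v = fun i => P.rowSign i * v i := by
  funext i; rw [Matrix.mulVec_diagonal]

lemma phaseOne_isBasis_inl : P.phaseOne.IsBasis (Sum.inl ∘ β) ↔ P.IsBasis β := by
  rw [IsBasis, phaseOne_submatrix_inl, Matrix.det_mul, IsUnit.mul_iff, IsBasis]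
  refine and_iff_right ?_
  rw [Matrix.det_diagonal, isUnit_iff_ne_zero, Finset.prod_ne_zero_iff]
  intro i _ h0
  have := P.rowSign_mul_self i
  rw [h0] at this
  simp at this

lemma IsBasis.phaseOne_basicVal_inl (h : P.IsBasis β) :
    P.phaseOne.basicVal (Sum.inl ∘ β) = P.basicVal β := by
  refine (phaseOne_isBasis_inl.2 h).eq_basicVal ?_
  rw [phaseOne_submatrix_inl, ← Matrix.mulVec_mulVec, h.mulVec_basicVal, diagonal_rowSign_mulVec]
  funext i
  rw [phaseOne_rhs]

lemma IsBasis.phaseOne_tableau_inl (h : P.IsBasis β) (i : ρ) (j : κ) :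
    P.phaseOne.tableau (Sum.inl ∘ β) i (Sum.inl j) = P.tableau β i j := by
  refine congrFun ((phaseOne_isBasis_inl.2 h).tableau_col_eq (u := fun i => P.tableau β i j) ?_) i
  rw [phaseOne_submatrix_inl, ← Matrix.mulVec_mulVec, h.mulVec_tableau_col,
    diagonal_rowSign_mulVec]
  funext i
  rw [phaseOne_M_inl]

lemma isFeasibleBasis_of_phaseOne (h : P.phaseOne.IsFeasibleBasis (Sum.inl ∘ β)) :
    P.IsFeasibleBasis β := by
  have hb := phaseOne_isBasis_inl.1 h.1
  exact ⟨hb, hb.phaseOne_basicVal_inl ▸ h.2⟩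

end LP

end

end PrimalTardos

namespace PrimalTardos

/-- **Farkas' lemma** for finitely many linear functionals. -/
theorem farkas {V : Type} [AddCommGroup V] [Module ℝ V] :
    ∀ (k : ℕ) (a : Fin k → V →ₗ[ℝ] ℝ) (c : V →ₗ[ℝ] ℝ),
      (∀ x, (∀ i, 0 ≤ a i x) → 0 ≤ c x) → ∃ s : Fin k → ℝ, 0 ≤ s ∧ c = ∑ i, s i • a i := by
  intro k
  induction k with
  | zero =>
    intro a c h
    refine ⟨0, le_rfl, ?_⟩
    ext x
    have h1 := h x (fun i => i.elim0)
    have h2 := h (-x) (fun i => i.elim0)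
    rw [map_neg] at h2
    simp
    linarith
  | succ k ih =>
    intro a c h
    by_cases hc : ∀ x, (∀ i : Fin k, 0 ≤ a i.succ x) → 0 ≤ c x
    · obtain ⟨s, hs, rfl⟩ := ih (fun i => a i.succ) c hc
      refine ⟨Fin.cons 0 s, fun i => ?_, ?_⟩
      · refine Fin.cases ?_ (fun i => ?_) i
        · simp
        · simpa using hs i
      · simp [Fin.sum_univ_succ]
    · push Not at hc
      obtain ⟨x₀, hx₀, hcx₀⟩ := hc
      have ha0 : a 0 x₀ < 0 := by
        by_contra hn
        exact absurd (h x₀ (Fin.cases (not_lt.1 hn) hx₀)) (not_le.2 hcx₀)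
      let x₁ : V := (-(a 0 x₀))⁻¹ • x₀
      have hpos : 0 < (-(a 0 x₀))⁻¹ := inv_pos.2 (by linarith)
      have h01 : a 0 x₁ = -1 := by
        simp only [x₁, map_smul, smul_eq_mul]
        rw [inv_neg, neg_mul, inv_mul_cancel₀ ha0.ne]
      have hi1 : ∀ i : Fin k, 0 ≤ a i.succ x₁ := fun i => by
        simp only [x₁, map_smul, smul_eq_mul]
        exact mul_nonneg hpos.le (hx₀ i)
      have hc1 : c x₁ < 0 := by
        simp only [x₁, map_smul, smul_eq_mul]
        exact mul_neg_of_pos_of_neg hpos hcx₀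
      obtain ⟨s, hs, hcs⟩ := ih (fun i => a i.succ + a i.succ x₁ • a 0) (c + c x₁ • a 0) (by
        intro x hx
        have := h (x + a 0 x • x₁) (by
          refine Fin.cases ?_ (fun i => ?_)
          · simp [h01]
          · have := hx i
            simp only [LinearMap.add_apply, LinearMap.smul_apply, smul_eq_mul] at this
            simp only [map_add, map_smul, smul_eq_mul]
            linarith)
        simp only [map_add, map_smul, smul_eq_mul] at this
        simp only [LinearMap.add_apply, LinearMap.smul_apply, smul_eq_mul]
        linarith)
      refine ⟨Fin.cons (∑ i, s i * a i.succ x₁ - c x₁) s, ?_, ?_⟩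
      · intro i
        refine Fin.cases ?_ (fun i => ?_) i
        · have : 0 ≤ ∑ i, s i * a i.succ x₁ :=
            Finset.sum_nonneg fun i _ => mul_nonneg (hs i) (hi1 i)
          simp only [Pi.zero_apply, Fin.cons_zero]
          linarith
        · simpa using hs i
      · have h2 : c = ∑ i, s i • (a i.succ + a i.succ x₁ • a 0) - c x₁ • a 0 := by
          rw [← hcs]; simp
        conv_lhs => rw [h2]
        simp only [Fin.sum_univ_succ, Fin.cons_zero, Fin.cons_succ, smul_add, Finset.sum_add_distrib,
          sub_smul, ← Finset.sum_smul, smul_smul]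
        module

theorem farkas_fintype {V ι : Type} [AddCommGroup V] [Module ℝ V] [Fintype ι]
    (a : ι → V →ₗ[ℝ] ℝ) (c : V →ₗ[ℝ] ℝ) (h : ∀ x, (∀ i, 0 ≤ a i x) → 0 ≤ c x) :
    ∃ s : ι → ℝ, 0 ≤ s ∧ c = ∑ i, s i • a i := by
  let e := Fintype.equivFin ι
  obtain ⟨s, hs, hc⟩ := farkas _ (fun i => a (e.symm i)) c fun x hx => h x fun i => by
    simpa using hx (e i)
  refine ⟨fun i => s (e i), fun i => hs _, ?_⟩
  rw [hc]
  exact Fintype.sum_equiv e.symm _ _ (by simp)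

namespace LP

section
variable {ρ κ : Type} [Fintype ρ] [DecidableEq ρ] [Fintype κ] [DecidableEq κ] {P : LP ρ κ}

/-- A lower bound `z` for the values of the feasible solutions with `∑ x ≤ M` has a dual
certificate. -/
lemma exists_dual (P : LP ρ κ) {M z : ℝ}
    (hz : ∀ x, P.Feasible x → ∑ j, x j ≤ M → z ≤ P.value x) :
    ∃ (s : κ → ℝ) (l μ : ℝ), 0 ≤ s ∧ 0 ≤ l ∧ 0 ≤ μ ∧ ∀ x, P.M.mulVec x = P.rhs →
      P.value x - z - μ = ∑ j, s j * x j + l * (M - ∑ j, x j) := by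
  let row : ρ → ((κ → ℝ) × ℝ) →ₗ[ℝ] ℝ := fun i =>
    ∑ j, P.M i j • (LinearMap.proj j ∘ₗ LinearMap.fst ℝ (κ → ℝ) ℝ) -
      P.rhs i • LinearMap.snd ℝ (κ → ℝ) ℝ
  let tot : ((κ → ℝ) × ℝ) →ₗ[ℝ] ℝ := ∑ j, (LinearMap.proj j ∘ₗ LinearMap.fst ℝ (κ → ℝ) ℝ)
  let a : (ρ ⊕ ρ) ⊕ (κ ⊕ (Unit ⊕ Unit)) → ((κ → ℝ) × ℝ) →ₗ[ℝ] ℝ :=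
    Sum.elim (Sum.elim row fun i => - row i)
      (Sum.elim (fun j => LinearMap.proj j ∘ₗ LinearMap.fst ℝ (κ → ℝ) ℝ)
        (Sum.elim (fun _ => M • LinearMap.snd ℝ (κ → ℝ) ℝ - tot)
          fun _ => LinearMap.snd ℝ (κ → ℝ) ℝ))
  let c : ((κ → ℝ) × ℝ) →ₗ[ℝ] ℝ := ∑ j, P.cost j • (LinearMap.proj j ∘ₗ LinearMap.fst ℝ (κ → ℝ) ℝ) -
      z • LinearMap.snd ℝ (κ → ℝ) ℝ
  have hrow : ∀ i v, row i v = P.M.mulVec v.1 i - P.rhs i * v.2 := by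
    intro i v; simp [row, Matrix.mulVec, dotProduct]
  have htot : ∀ v, tot v = ∑ j, v.1 j := by intro v; simp [tot]
  have hc : ∀ v, c v = P.value v.1 - z * v.2 := by intro v; simp [c, value]
  obtain ⟨s, hs, hcs⟩ := farkas_fintype a c (by
    rintro ⟨x, t⟩ h
    have h1 : ∀ i, P.M.mulVec x i = t * P.rhs i := fun i => by
      have h1 := h (.inl (.inl i))
      have h2 := h (.inl (.inr i))
      simp only [a, Sum.elim_inl, Sum.elim_inr, LinearMap.neg_apply, hrow] at h1 h2
      linarith
    have h2 : ∀ j, 0 ≤ x j := fun j => by simpa [a] using h (.inr (.inl j))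
    have h3 : ∑ j, x j ≤ M * t := by
      have := h (.inr (.inr (.inl ())))
      simp only [a, Sum.elim_inl, Sum.elim_inr, LinearMap.sub_apply, htot, LinearMap.smul_apply,
        LinearMap.snd_apply, smul_eq_mul] at this
      linarith
    have h4 : 0 ≤ t := by simpa [a] using h (.inr (.inr (.inr ())))
    rw [hc]
    rcases h4.eq_or_lt with rfl | hpos
    · have hx : x = 0 := by
        rw [mul_zero] at h3
        have h5 := (Finset.sum_eq_zero_iff_of_nonneg fun j _ => h2 j).1
          (le_antisymm h3 (Finset.sum_nonneg fun j _ => h2 j))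
        funext j
        exact h5 j (Finset.mem_univ j)
      simp [hx, value]
    · have := hz (t⁻¹ • x) ⟨?_, fun j => mul_nonneg (inv_nonneg.2 h4) (h2 j)⟩ ?_
      · rw [value_smul] at this
        simp only
        have h5 := mul_le_mul_of_nonneg_left this h4
        rw [← mul_assoc, mul_inv_cancel₀ hpos.ne', one_mul] at h5
        linarith
      · rw [Matrix.mulVec_smul]
        funext i
        simp only [Pi.smul_apply, smul_eq_mul, h1]
        field_simp
      · simp only [Pi.smul_apply, smul_eq_mul, ← Finset.mul_sum]
        rw [inv_mul_le_iff₀ hpos]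
        linarith)
  have key : ∀ x, P.M.mulVec x = P.rhs → P.value x - z =
      ∑ j, s (.inr (.inl j)) * x j + s (.inr (.inr (.inl ()))) * (M - ∑ j, x j) +
        s (.inr (.inr (.inr ()))) := by
    intro x hx
    have h1 := LinearMap.congr_fun hcs (x, 1)
    rw [hc] at h1
    simp only [LinearMap.sum_apply, LinearMap.smul_apply, smul_eq_mul, Fintype.sum_sum_type, a,
      Sum.elim_inl, Sum.elim_inr, LinearMap.neg_apply, hrow, hx, LinearMap.comp_apply,
      LinearMap.fst_apply, LinearMap.proj_apply, LinearMap.sub_apply, LinearMap.snd_apply,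
      htot] at h1
    simp [hrow, htot, hx] at h1
    rw [h1, add_assoc]
  refine ⟨fun j => s (.inr (.inl j)), s (.inr (.inr (.inl ()))), s (.inr (.inr (.inr ()))),
    fun j => hs _, hs _, hs _, fun x hx => ?_⟩
  rw [key x hx]; ring

/-! ## The number of pivots -/

/-- The length of a sequence of pivots after which a variable has vanished for good. -/
noncomputable def stageLength (R : ℝ) : ℕ := ⌈(R + 1) * Real.log (2 * R + 1)⌉₊

lemma pow_stageLength_lt {R : ℝ} (hR : 0 < R) :
    (2 * R + 1) * (1 - 1 / (R + 1)) ^ stageLength R < 1 := by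
  have hlog : 0 < Real.log (2 * R + 1) := Real.log_pos (by linarith)
  have hL : (R + 1) * Real.log (2 * R + 1) ≤ stageLength R := Nat.le_ceil _
  have hL0 : stageLength R ≠ 0 := by
    intro h0
    rw [h0, Nat.cast_zero] at hL
    have : 0 < (R + 1) * Real.log (2 * R + 1) := by positivity
    linarith
  have h1 : 1 - 1 / (R + 1) < Real.exp (-(1 / (R + 1))) := by
    have := Real.add_one_lt_exp (x := -(1 / (R + 1))) (by
      have : (0 : ℝ) < 1 / (R + 1) := by positivity
      linarith)
    linarith
  have h0 : 0 ≤ 1 - 1 / (R + 1) := by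
    rw [sub_nonneg, div_le_one (by linarith)]; linarith
  have h2 : (1 - 1 / (R + 1)) ^ stageLength R < Real.exp (-(1 / (R + 1))) ^ stageLength R :=
    pow_lt_pow_left₀ h1 h0 hL0
  have h3 : Real.exp (-(1 / (R + 1))) ^ stageLength R ≤ (2 * R + 1)⁻¹ := by
    rw [← Real.exp_nat_mul, ← Real.exp_log (show 0 < 2 * R + 1 by linarith), ← Real.exp_neg,
      Real.exp_le_exp]
    have : Real.log (2 * R + 1) ≤ stageLength R / (R + 1) := by
      rw [le_div_iff₀ (by linarith)]; linarith
    have h4 : (stageLength R : ℝ) * -(1 / (R + 1)) = -(stageLength R / (R + 1)) := by ring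
    rw [h4]
    linarith
  calc (2 * R + 1) * (1 - 1 / (R + 1)) ^ stageLength R
      < (2 * R + 1) * (2 * R + 1)⁻¹ := by
        apply mul_lt_mul_of_pos_left (h2.trans_le h3); linarith
    _ = 1 := mul_inv_cancel₀ (by linarith)

section KitaharaMizuno

variable {f : ℕ → ρ → κ} {T : ℕ} {δ γ : ℝ}

lemma sum_basicSol (P : LP ρ κ) (β : ρ → κ) : ∑ j, P.basicSol β j = ∑ i, P.basicVal β i := by
  simpa using P.sum_mul_basicSol β fun _ => 1

/-- After `stageLength R` pivots, some variable that was positive has vanished for good. -/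
lemma exists_vanishing [Nonempty ρ]
    (hf : ∀ t < T, P.DantzigPivot (f t) (f (t + 1)))
    (hfb : ∀ t ≤ T, P.IsFeasibleBasis (f t))
    (hδ : 0 < δ)
    (hbd : ∀ β, P.IsFeasibleBasis β → ∀ i, δ ≤ P.basicVal β i ∧ P.basicVal β i ≤ γ)
    {t : ℕ} (ht : t + stageLength (Fintype.card ρ * γ / δ) ≤ T) (htT : t < T) :
    ∃ i, ∀ k, t + stageLength (Fintype.card ρ * γ / δ) ≤ k → k ≤ T →
      P.basicSol (f k) (f t i) = 0 := by
  set m : ℝ := (Fintype.card ρ : ℝ) with hm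
  set R : ℝ := m * γ / δ with hRdef
  set L := stageLength R with hL
  set M : ℝ := m * γ + δ with hMdef
  have hm1 : 1 ≤ m := by rw [hm]; exact_mod_cast Fintype.card_pos
  have hδγ : δ ≤ γ := by
    obtain ⟨i⟩ := ‹Nonempty ρ›
    have := hbd _ (hfb 0 (by omega)) i
    linarith
  have hR : 0 < R := by rw [hRdef]; apply div_pos <;> nlinarith
  have hMR : M = δ * (R + 1) := by rw [hMdef, hRdef]; field_simp
  have hMpos : 0 < M := by rw [hMR]; positivity
  have hsum_le : ∀ k ≤ T, ∑ j, P.basicSol (f k) j ≤ m * γ := fun k hk => by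
    rw [sum_basicSol]
    calc ∑ i, P.basicVal (f k) i ≤ ∑ _i : ρ, γ :=
          Finset.sum_le_sum fun i _ => (hbd _ (hfb k hk) i).2
      _ = m * γ := by simp [hm]
  have hfeas : ∀ k ≤ T, P.Feasible (P.basicSol (f k)) := fun k hk =>
    (hfb k hk).1.feasible (hfb k hk).2
  -- the lower bound that the pivots give for the values
  have hex : ∀ t, ∃ Δ : ℝ, t < T → 0 < Δ ∧ (∀ j, -Δ ≤ P.redCost (f t) j) ∧
      P.value (P.basicSol (f (t + 1))) ≤ P.value (P.basicSol (f t)) - Δ * δ := by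
    intro t
    by_cases ht : t < T
    · obtain ⟨s, r, hs, -, hv⟩ := (hf t ht).exists_value (hfb t ht.le)
      refine ⟨-P.redCost (f t) s, fun _ => ⟨by linarith [hs.1], fun j => by
        linarith [hs.2 j], ?_⟩⟩
      rw [hv]
      have := (hbd _ (hfb (t + 1) ht) r).1
      nlinarith [hs.1]
    · exact ⟨0, fun h => absurd h ht⟩
  choose Δ hΔ using hex
  obtain ⟨t₀, ht₀, hmax⟩ := Finset.exists_max_image (Finset.range T)
    (fun t => P.value (P.basicSol (f t)) - Δ t * M) ⟨t, Finset.mem_range.2 htT⟩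
  set z := P.value (P.basicSol (f t₀)) - Δ t₀ * M with hz
  have hlow : ∀ x, P.Feasible x → ∑ j, x j ≤ M → z ≤ P.value x := by
    intro x hx hxM
    have h1 := hΔ t₀ (Finset.mem_range.1 ht₀)
    rw [P.value_eq_add (f t₀) hx.1, hz]
    have h2 : ∑ j, -Δ t₀ * x j ≤ ∑ j, P.redCost (f t₀) j * x j :=
      Finset.sum_le_sum fun j _ => mul_le_mul_of_nonneg_right (h1.2.1 j) (hx.2 j)
    rw [← Finset.mul_sum] at h2
    nlinarith [h1.1]
  obtain ⟨s, l, μ, hs, hl, hμ, hdual⟩ := P.exists_dual hlow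
  -- the gap
  let D : ℕ → ℝ := fun k => P.value (P.basicSol (f k)) - z - μ
  have hD : ∀ k ≤ T, D k = ∑ j, s j * P.basicSol (f k) j + l * (M - ∑ j, P.basicSol (f k) j) :=
    fun k hk => hdual _ (hfeas k hk).1
  have hslack : ∀ k ≤ T, δ ≤ M - ∑ j, P.basicSol (f k) j := fun k hk => by
    have := hsum_le k hk
    rw [hMdef]; linarith
  have hterm : ∀ k ≤ T, ∀ j, 0 ≤ s j * P.basicSol (f k) j := fun k hk j =>
    mul_nonneg (hs j) ((hfeas k hk).2 j)
  have hDj : ∀ k ≤ T, ∀ j, s j * P.basicSol (f k) j ≤ D k := fun k hk j => by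
    rw [hD k hk]
    have h1 := Finset.single_le_sum (fun j _ => hterm k hk j) (Finset.mem_univ j)
    have h2 := mul_nonneg hl (hδ.le.trans (hslack k hk))
    linarith
  have hDl : ∀ k ≤ T, l * δ ≤ D k := fun k hk => by
    rw [hD k hk]
    have h1 : 0 ≤ ∑ j, s j * P.basicSol (f k) j := Finset.sum_nonneg fun j _ => hterm k hk j
    have h2 := mul_le_mul_of_nonneg_left (hslack k hk) hl
    linarith
  set q : ℝ := 1 - 1 / (R + 1) with hq
  have hq0 : 0 ≤ q := by rw [hq, sub_nonneg, div_le_one (by linarith)]; linarith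
  have hq1 : q ≤ 1 := by
    rw [hq]
    have : (0 : ℝ) < 1 / (R + 1) := by positivity
    linarith
  have hstep : ∀ k < T, D (k + 1) ≤ q * D k := fun k hk => by
    have h1 := hΔ k hk
    have h2 : D k ≤ Δ k * M := by
      have := hmax k (Finset.mem_range.2 hk)
      simp only [D]
      linarith
    have h3 : D (k + 1) ≤ D k - Δ k * δ := by simp only [D]; linarith [h1.2.2]
    have h4 : D k / (R + 1) ≤ Δ k * δ := by
      rw [div_le_iff₀ (by linarith)]
      calc D k ≤ Δ k * M := h2
        _ = Δ k * δ * (R + 1) := by rw [hMR]; ring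
    have h5 : q * D k = D k - D k / (R + 1) := by rw [hq]; ring
    linarith
  have hD0 : ∀ k ≤ T, 0 ≤ D k := fun k hk => (mul_nonneg hl hδ.le).trans (hDl k hk)
  have hpow : ∀ e, t + e ≤ T → D (t + e) ≤ q ^ e * D t := by
    intro e
    induction e with
    | zero => simp
    | succ e ih =>
      intro he
      calc D (t + (e + 1)) ≤ q * D (t + e) := hstep (t + e) (by omega)
        _ ≤ q * (q ^ e * D t) := mul_le_mul_of_nonneg_left (ih (by omega)) hq0
        _ = q ^ (e + 1) * D t := by ring
  have hlate : ∀ k, t + L ≤ k → k ≤ T → D k ≤ q ^ L * D t := fun k hk hkT => by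
    obtain ⟨e, rfl⟩ := Nat.exists_eq_add_of_le hk
    have h1 := hpow (L + e) (by omega)
    rw [← add_assoc] at h1
    refine h1.trans (mul_le_mul_of_nonneg_right ?_ (hD0 t (by omega)))
    exact pow_le_pow_of_le_one hq0 hq1 (by omega)
  have hDt : 0 < D t := by
    have h1 := hΔ t htT
    have h2 := hD0 (t + 1) htT
    have h3 : D (t + 1) ≤ D t - Δ t * δ := by simp only [D]; linarith [h1.2.2]
    nlinarith [h1.1]
  by_contra hcon
  push Not at hcon
  set E := q ^ L * D t with hE
  have hsi : ∀ i, s (f t i) * δ ≤ E := fun i => by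
    obtain ⟨k, hk1, hk2, hk3⟩ := hcon i
    refine le_trans ?_ (hlate k hk1 hk2)
    refine le_trans ?_ (hDj k hk2 (f t i))
    refine mul_le_mul_of_nonneg_left ?_ (hs _)
    by_contra hlt
    apply hk3
    by_cases hr : ∃ i', f k i' = f t i
    · obtain ⟨i', hi'⟩ := hr
      rw [← hi', (hfb k hk2).1.basicSol_apply] at hlt
      exact absurd (hbd _ (hfb k hk2) i').1 hlt
    · push Not at hr
      exact P.basicSol_of_notMem hr
  have hsum : ∑ j, s j * P.basicSol (f t) j ≤ m * (E / δ * γ) := by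
    rw [P.sum_mul_basicSol]
    calc ∑ i, s (f t i) * P.basicVal (f t) i ≤ ∑ _i : ρ, E / δ * γ := by
          refine Finset.sum_le_sum fun i _ => ?_
          have h1 : s (f t i) ≤ E / δ := by rw [le_div_iff₀ hδ]; exact hsi i
          have h2 := hbd _ (hfb t htT.le) i
          exact mul_le_mul h1 h2.2 (hδ.le.trans h2.1) ((hs _).trans h1)
      _ = m * (E / δ * γ) := by simp [hm]
  have hlE : l ≤ E / δ := by
    rw [le_div_iff₀ hδ]; exact (hDl T le_rfl).trans (hlate T ht le_rfl)
  have hfin : D t ≤ (2 * R + 1) * E := by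
    rw [hD t htT.le]
    have h1 : l * (M - ∑ j, P.basicSol (f t) j) ≤ E / δ * M := by
      have h2 : 0 ≤ ∑ j, P.basicSol (f t) j := Finset.sum_nonneg fun j _ => (hfeas t htT.le).2 j
      refine mul_le_mul hlE (by linarith) (hδ.le.trans (hslack t htT.le)) (hl.trans hlE)
    have h3 : m * (E / δ * γ) + E / δ * M = (2 * R + 1) * E := by
      rw [hMdef, hRdef]; field_simp; ring
    linarith
  have := pow_stageLength_lt hR
  rw [← hL, ← hq] at this
  have h4 : (2 * R + 1) * E = ((2 * R + 1) * q ^ L) * D t := by rw [hE]; ring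
  nlinarith

/-- The bound of Kitahara and Mizuno for the number of pivots. -/
theorem PivotPath.le_of_bounds [Nonempty ρ] {β₀ β : ρ → κ} (h : P.PivotPath β₀ T β)
    (h0 : P.IsFeasibleBasis β₀) (hδ : 0 < δ)
    (hbd : ∀ β, P.IsFeasibleBasis β → ∀ i, δ ≤ P.basicVal β i ∧ P.basicVal β i ≤ γ) :
    T ≤ (Fintype.card κ - Fintype.card ρ) * stageLength (Fintype.card ρ * γ / δ) := by
  classical
  obtain ⟨f, hf0, -, hf⟩ := h.exists_seq
  have hfb := isFeasibleBasis_of_seq (P := P) (hf0 ▸ h0) hf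
  set L := stageLength (Fintype.card ρ * γ / δ) with hL
  let Z : ℕ → Finset κ := fun t =>
    Finset.univ.filter fun j => ∃ k, t ≤ k ∧ k ≤ T ∧ P.basicSol (f k) j ≠ 0
  have hne : ∀ k ≤ T, ∀ i, P.basicSol (f k) (f k i) ≠ 0 := fun k hk i => by
    rw [(hfb k hk).1.basicSol_apply]
    exact (hδ.trans_le (hbd _ (hfb k hk) i).1).ne'
  have hlast : ∀ t < T, Fintype.card ρ + 1 ≤ (Z t).card := by
    intro t ht
    obtain ⟨s, r, hs, hsr, -⟩ := (hf t ht).exists_value (hfb t ht.le)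
    have hsn : ∀ i, f t i ≠ s := fun i hi => by
      have := hs.1
      rw [← hi, (hfb t ht.le).1.redCost_basis] at this
      exact lt_irrefl _ this
    have hsub : insert s (Finset.univ.image (f t)) ⊆ Z t := by
      intro j hj
      rw [Finset.mem_insert, Finset.mem_image] at hj
      rw [Finset.mem_filter]
      refine ⟨Finset.mem_univ _, ?_⟩
      rcases hj with rfl | ⟨i, -, rfl⟩
      · exact ⟨t + 1, by omega, ht, hsr ▸ hne (t + 1) ht r⟩
      · exact ⟨t, le_rfl, ht.le, hne t ht.le i⟩
    have := Finset.card_le_card hsub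
    rw [Finset.card_insert_of_notMem (by simpa using hsn),
      Finset.card_image_of_injective _ (hfb t ht.le).1.injective, Finset.card_univ] at this
    exact this
  have hdec : ∀ t < T, t + L ≤ T → (Z (t + L)).card + 1 ≤ (Z t).card := by
    intro t ht htL
    obtain ⟨i, hi⟩ := exists_vanishing hf hfb hδ hbd htL ht
    refine Finset.card_lt_card ((Finset.ssubset_iff_of_subset fun j hj => ?_).2 ⟨f t i, ?_, ?_⟩)
    · rw [Finset.mem_filter] at hj ⊢
      obtain ⟨k, hk, hk'⟩ := hj.2
      exact ⟨Finset.mem_univ _, k, by omega, hk'⟩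
    · rw [Finset.mem_filter]
      exact ⟨Finset.mem_univ _, t, le_rfl, ht.le, hne t ht.le i⟩
    · rw [Finset.mem_filter]
      rintro ⟨-, k, hk1, hk2, hk3⟩
      exact hk3 (hi k hk1 hk2)
  have hind : ∀ p : ℕ, p * L < T → (Z (p * L)).card + p ≤ Fintype.card κ := by
    intro p
    induction p with
    | zero => intro _; simpa using Finset.card_le_univ (Z 0)
    | succ p ih =>
      intro hp
      rw [Nat.succ_mul] at hp ⊢
      have h1 := ih (by omega)
      have h2 := hdec (p * L) (by omega) hp.le
      omega
  by_contra hcon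
  push Not at hcon
  have h1 := hind _ hcon
  have h2 := hlast _ hcon
  have : Fintype.card ρ ≤ Fintype.card κ :=
    Fintype.card_le_of_injective _ (hfb 0 (Nat.zero_le _)).1.injective
  omega

end KitaharaMizuno

end

end LP

end PrimalTardos

namespace PrimalTardos

namespace LP

section
variable {ρ κ : Type} [Fintype ρ] [DecidableEq ρ] [Fintype κ] [DecidableEq κ] {P : LP ρ κ}

/-! ## Solutions with independent support -/

lemma exists_step {x d : κ → ℝ} (hx : 0 ≤ x) (hd : ∀ j, x j = 0 → 0 ≤ d j) :
    ∃ t : ℝ, 0 < t ∧ 0 ≤ x + t • d := by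
  have h : ∀ᶠ t in nhdsWithin (0 : ℝ) (Set.Ioi 0), ∀ j, 0 ≤ x j + t * d j := by
    rw [Filter.eventually_all]
    intro j
    rcases (hx j).eq_or_lt with h0 | hpos
    · filter_upwards [self_mem_nhdsWithin] with t ht
      rw [← h0]
      have := mul_nonneg (le_of_lt ht) (hd j h0.symm)
      simpa using this
    · have hc : Filter.Tendsto (fun t : ℝ => x j + t * d j) (nhds 0) (nhds (x j + 0 * d j)) := by
        apply Continuous.tendsto; fun_prop
      rw [zero_mul, add_zero] at hc
      exact nhdsWithin_le_nhds ((hc.eventually (lt_mem_nhds hpos)).mono fun t ht => ht.le)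
  obtain ⟨t, ht, ht0⟩ := (h.and self_mem_nhdsWithin).exists
  exact ⟨t, ht0, fun j => ht j⟩

/-- A step to the boundary: some variable vanishes. -/
lemma exists_boundary_step {x d : κ → ℝ} (hx : 0 ≤ x) (hd : ∃ j, d j < 0) :
    ∃ t : ℝ, 0 ≤ t ∧ 0 ≤ x + t • d ∧ ∃ j, d j < 0 ∧ x j + t * d j = 0 := by
  obtain ⟨j₁, hj₁⟩ := hd
  have : Nonempty {j // d j < 0} := ⟨⟨j₁, hj₁⟩⟩
  obtain ⟨r, hr⟩ := Finite.exists_min fun j : {j // d j < 0} => x j / (-d j)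
  have hrneg : 0 < -d r := by linarith [r.2]
  have ht : 0 ≤ x r / (-d r) := div_nonneg (hx r) hrneg.le
  refine ⟨x r / (-d r), ht, fun j => ?_, r, r.2, ?_⟩
  · simp only [Pi.zero_apply, Pi.add_apply, Pi.smul_apply, smul_eq_mul]
    rcases lt_or_ge (d j) 0 with hj | hj
    · have := hr ⟨j, hj⟩
      rw [le_div_iff₀ (by linarith)] at this
      linarith
    · have := mul_nonneg ht hj
      have := hx j
      simp only [Pi.zero_apply] at this
      linarith
  · have : d r ≠ 0 := r.2.ne
    field_simp
    ring

/-- The columns on which `x` is nonzero are linearly independent. -/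
def IndepSupport (P : LP ρ κ) (x : κ → ℝ) : Prop :=
  ∀ h, P.M.mulVec h = 0 → (∀ j, x j = 0 → h j = 0) → h = 0

lemma exists_indepSupport (P : LP ρ κ) {x : κ → ℝ} (hx : P.Feasible x) :
    (∃ h : κ → ℝ, 0 ≤ h ∧ h ≠ 0 ∧ (∀ j, x j = 0 → h j = 0) ∧ P.M.mulVec h = 0 ∧ P.value h < 0) ∨
    ∃ y, P.Feasible y ∧ (∀ j, x j = 0 → y j = 0) ∧ P.value y ≤ P.value x ∧ P.IndepSupport y := by
  induction hk : (Finset.univ.filter fun j => x j ≠ 0).card using Nat.strong_induction_on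
    generalizing x with
  | _ k ih =>
  by_cases hind : P.IndepSupport x
  · exact Or.inr ⟨x, hx, fun _ h => h, le_rfl, hind⟩
  simp only [IndepSupport, not_forall] at hind
  obtain ⟨h, hM, hsupp, hne⟩ := hind
  have main : ∀ g : κ → ℝ, P.M.mulVec g = 0 → (∀ j, x j = 0 → g j = 0) → P.value g ≤ 0 →
      (∃ j, g j < 0) →
      (∃ h : κ → ℝ, 0 ≤ h ∧ h ≠ 0 ∧ (∀ j, x j = 0 → h j = 0) ∧ P.M.mulVec h = 0 ∧ P.value h < 0) ∨
      ∃ y, P.Feasible y ∧ (∀ j, x j = 0 → y j = 0) ∧ P.value y ≤ P.value x ∧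
        P.IndepSupport y := by
    intro g hgM hgs hgv hgn
    obtain ⟨t, ht, hnn, j₀, hj₀, hz⟩ := exists_boundary_step hx.2 hgn
    have hfe : P.Feasible (x + t • g) := by
      refine ⟨?_, hnn⟩
      rw [Matrix.mulVec_add, Matrix.mulVec_smul, hgM, hx.1, smul_zero, add_zero]
    have hsub : ∀ j, x j = 0 → (x + t • g) j = 0 := fun j hj => by simp [hj, hgs j hj]
    have hval : P.value (x + t • g) ≤ P.value x := by
      rw [value_add, value_smul]
      have := mul_nonneg_of_nonpos_of_nonpos (neg_nonpos.2 ht) hgv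
      linarith
    have hlt : (Finset.univ.filter fun j => (x + t • g) j ≠ 0).card < k := by
      rw [← hk]
      refine Finset.card_lt_card ((Finset.ssubset_iff_of_subset fun j hj => ?_).2 ⟨j₀, ?_, ?_⟩)
      · simp only [Finset.mem_filter, Finset.mem_univ, true_and] at hj ⊢
        exact fun h0 => hj (hsub j h0)
      · simp only [Finset.mem_filter, Finset.mem_univ, true_and]
        exact fun h0 => hj₀.ne (hgs _ h0)
      · simpa using hz
    rcases ih _ hlt hfe rfl with ⟨h, h1, h2, h3, h4⟩ | ⟨y, h1, h2, h3, h4⟩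
    · exact Or.inl ⟨h, h1, h2, fun j hj => h3 j (hsub j hj), h4⟩
    · exact Or.inr ⟨y, h1, fun j hj => h2 j (hsub j hj), h3.trans hval, h4⟩
  have hvneg : P.value (-h) = - P.value h := by
    have := P.value_smul (-1) h
    simpa using this
  have hnegM : P.M.mulVec (-h) = 0 := by rw [Matrix.mulVec_neg, hM, neg_zero]
  have hnegs : ∀ j, x j = 0 → (-h) j = 0 := fun j hj => by simp [hsupp j hj]
  have hnn : ∀ g : κ → ℝ, g ≠ 0 → 0 ≤ g → ∃ j, (-g) j < 0 := fun g hg h0 => by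
    by_contra hcon
    push Not at hcon
    apply hg
    funext j
    have h1 := hcon j
    have h2 := h0 j
    simp only [Pi.neg_apply, Pi.zero_apply] at *
    linarith
  have hneg : ∀ g : κ → ℝ, ¬ 0 ≤ g → ∃ j, g j < 0 := fun g hg => by
    simpa [Pi.le_def] using hg
  rcases lt_trichotomy (P.value h) 0 with hv | hv | hv
  · by_cases h0 : 0 ≤ h
    · exact Or.inl ⟨h, h0, hne, hsupp, hM, hv⟩
    · exact main h hM hsupp hv.le (hneg h h0)
  · by_cases h0 : 0 ≤ h
    · exact main (-h) hnegM hnegs (by rw [hvneg, hv, neg_zero]) (hnn h hne h0)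
    · exact main h hM hsupp hv.le (hneg h h0)
  · by_cases h0 : 0 ≤ -h
    · exact Or.inl ⟨-h, h0, neg_ne_zero.2 hne, hnegs, hnegM, by linarith⟩
    · exact main (-h) hnegM hnegs (by linarith) (hneg _ h0)

/-- A linear program without an optimal solution is infeasible or unbounded. -/
theorem infeasible_or_unbounded (h : ∀ x, ¬ P.IsOptimal x) : P.Infeasible ∨ P.Unbounded := by
  by_contra hcon
  simp only [Infeasible, Unbounded, not_or, not_forall, not_exists, not_and, not_not, not_lt]
    at hcon
  obtain ⟨⟨x₀, hx₀⟩, z, hz⟩ := hcon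
  have hred : ∀ x, P.Feasible x → ∃ y, P.Feasible y ∧ P.value y ≤ P.value x ∧
      P.IndepSupport y := by
    intro x hx
    rcases P.exists_indepSupport hx with ⟨h, h0, -, -, hM, hv⟩ | ⟨y, h1, -, h2, h3⟩
    · exfalso
      let t := (P.value x - z + 1) / (-P.value h)
      have ht : 0 ≤ t := div_nonneg (by linarith [hz x hx]) (by linarith)
      have := hz (x + t • h) ⟨by
        rw [Matrix.mulVec_add, Matrix.mulVec_smul, hM, hx.1, smul_zero, add_zero],
        add_nonneg hx.2 (smul_nonneg ht h0)⟩
      rw [value_add, value_smul] at this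
      have h2 : t * P.value h = -(P.value x - z + 1) := by
        simp only [t]
        have : P.value h ≠ 0 := hv.ne
        field_simp
      linarith
    · exact ⟨y, h1, h2, h3⟩
  let V : Set (κ → ℝ) := {y | P.Feasible y ∧ P.IndepSupport y}
  have hfin : V.Finite := by
    refine Set.Finite.of_injOn (f := fun y => Finset.univ.filter fun j => y j = 0)
      (t := Set.univ) (fun _ _ => Set.mem_univ _) ?_ Set.finite_univ
    intro x hx y hy hxy
    have hiff : ∀ j, x j = 0 ↔ y j = 0 := fun j => by
      have := Finset.ext_iff.1 hxy j
      simpa using this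
    have := hx.2 (x - y) (by rw [Matrix.mulVec_sub, hx.1.1, hy.1.1, sub_self]) fun j hj => by
      simp [hj, (hiff j).1 hj]
    exact sub_eq_zero.1 this
  obtain ⟨y₀, hy₀, -, hy₀'⟩ := hred x₀ hx₀
  obtain ⟨y, hy, hmin⟩ := Set.exists_min_image V P.value hfin ⟨y₀, hy₀, hy₀'⟩
  refine h y ⟨hy.1, fun x hx => ?_⟩
  obtain ⟨w, hw, hwx, hw'⟩ := hred x hx
  exact (hmin w ⟨hw, hw'⟩).trans hwx

/-- Linearly independent columns are part of a basis. -/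
lemma IsBasis.exists_extension {ℓ : ρ → κ} (hℓ : P.IsBasis ℓ) (S : Finset κ)
    (hS : ∀ h, P.M.mulVec h = 0 → (∀ j ∉ S, h j = 0) → h = 0) :
    ∃ β, P.IsBasis β ∧ ∀ j ∈ S, ∃ i, β i = j := by
  suffices h : ∀ S' ⊆ S, ∃ β, P.IsBasis β ∧ ∀ j ∈ S', ∃ i, β i = j from h S subset_rfl
  intro S'
  induction S' using Finset.induction_on with
  | empty => exact fun _ => ⟨ℓ, hℓ, by simp⟩
  | insert s S' hs ih =>
    intro hsub
    obtain ⟨β, hβ, hS'⟩ := ih ((Finset.subset_insert _ _).trans hsub)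
    by_cases hsr : ∃ i, β i = s
    · refine ⟨β, hβ, fun j hj => ?_⟩
      rcases Finset.mem_insert.1 hj with rfl | hj
      exacts [hsr, hS' j hj]
    push Not at hsr
    obtain ⟨r, hr, hrS⟩ : ∃ r, P.tableau β r s ≠ 0 ∧ β r ∉ S' := by
      by_contra hcon
      push Not at hcon
      have := hS (P.ray β s) (hβ.mulVec_ray s) fun j hj => by
        have hjs : j ≠ s := by rintro rfl; exact hj (hsub (Finset.mem_insert_self _ _))
        rw [ray, if_neg hjs, zero_sub, neg_eq_zero]
        refine Finset.sum_eq_zero fun i _ => ?_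
        split_ifs with hi
        · by_contra h0
          exact hj (hsub (Finset.mem_insert_of_mem (hi ▸ hcon i h0)))
        · rfl
      have h1 := congrFun this s
      simp [ray, hsr] at h1
    refine ⟨_, hβ.update hr, fun j hj => ?_⟩
    rcases Finset.mem_insert.1 hj with rfl | hj
    · exact ⟨r, by simp⟩
    · obtain ⟨i, hi⟩ := hS' j hj
      refine ⟨i, ?_⟩
      rw [Function.update_of_ne, hi]
      rintro rfl
      exact hrS (hi ▸ hj)

/-- A solution that vanishes outside of the basis is the basic solution. -/
lemma IsBasis.eq_basicSol {β : ρ → κ} (hβ : P.IsBasis β) {x : κ → ℝ}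
    (hx : P.M.mulVec x = P.rhs) (h0 : ∀ j, (∀ i, β i ≠ j) → x j = 0) : x = P.basicSol β := by
  have h1 : x = fun j => ∑ i, if β i = j then x (β i) else 0 := by
    funext j
    by_cases hj : ∃ i, β i = j
    · obtain ⟨i, rfl⟩ := hj
      simp [hβ.injective.eq_iff]
    · push Not at hj
      simp [hj, h0 j hj]
  have h2 : P.basicVal β = fun i => x (β i) := by
    rw [← tableau_mulVec_of_eq hx]
    funext i
    rw [Matrix.mulVec, dotProduct]
    conv_lhs => rw [h1]
    simp only [Finset.mul_sum, mul_ite, mul_zero]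
    rw [Finset.sum_comm]
    simp [hβ.tableau_basis]
  rw [h1]
  funext j
  simp [basicSol, h2]

/-! ## Proximity -/

/-- If no nonzero kernel vector is sign-compatible with `d`, then the entries of `d` are bounded
by the norm of `M d`. -/
lemma abs_le_of_no_conformal (hM : P.M.IsTotallyUnimodular) {ℓ : ρ → κ} (hℓ : P.IsBasis ℓ)
    {d : κ → ℝ} (hno : ∀ h, P.M.mulVec h = 0 → (∀ j, d j = 0 → h j = 0) →
      (∀ j, 0 ≤ h j * d j) → h = 0) (j₀ : κ) :
    |d j₀| ≤ ∑ i, |P.M.mulVec d i| := by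
  let ε : κ → ℝ := fun j => if d j < 0 then -1 else 1
  have hεε : ∀ j, ε j * ε j = 1 := fun j => by simp only [ε]; split_ifs <;> norm_num
  have hεd : ∀ j, ε j * |d j| = d j := fun j => by
    simp only [ε]; split_ifs with h
    · rw [abs_of_neg h]; ring
    · rw [abs_of_nonneg (not_lt.1 h)]; ring
  have hεd' : ∀ j, ε j * d j = |d j| := fun j => by
    rw [← hεd j, ← mul_assoc, hεε, one_mul, abs_mul, abs_abs]
    simp only [ε]; split_ifs <;> simp
  let Q : LP ρ κ := ⟨Matrix.of fun i j => P.M i j * ε j, P.M.mulVec d,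
    fun j => if j = j₀ then -1 else 0⟩
  have hQM : ∀ x : κ → ℝ, Q.M.mulVec x = P.M.mulVec (fun j => ε j * x j) := fun x => by
    funext i
    simp [Q, Matrix.mulVec, dotProduct, mul_assoc]
  have hQv : ∀ x : κ → ℝ, Q.value x = - x j₀ := fun x => by simp [Q, value]
  have hfe : Q.Feasible fun j => |d j| := by
    refine ⟨?_, fun j => abs_nonneg _⟩
    rw [hQM]; simp only [hεd]; rfl
  rcases Q.exists_indepSupport hfe with ⟨h, h0, hne, hs, hk, -⟩ | ⟨y, hy, hs, hv, hind⟩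
  · exfalso
    apply hne
    have h1 := hno (fun j => ε j * h j) (by rw [← hQM, hk]) (fun j hj => by
      have := hs j (by simp [hj])
      simp [this]) fun j => by
        have : ε j * h j * d j = h j * |d j| := by rw [← hεd']; ring
        rw [this]
        exact mul_nonneg (h0 j) (abs_nonneg _)
    funext j
    have h2 := congrFun h1 j
    simp only [Pi.zero_apply] at h2 ⊢
    have h3 : ε j * (ε j * h j) = h j := by rw [← mul_assoc, hεε, one_mul]
    rw [← h3, h2, mul_zero]
  · rw [hQv, hQv] at hv
    obtain ⟨β, hβ, hβs⟩ := hℓ.exists_extension (Finset.univ.filter fun j => y j ≠ 0) (by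
      intro h hh hhs
      have h1 := hind (fun j => ε j * h j) (by
        rw [hQM]; simp only [← mul_assoc, hεε, one_mul]; exact hh) fun j hj => by
          rw [hhs j (by simp [hj]), mul_zero]
      funext j
      have h2 := congrFun h1 j
      simp only [Pi.zero_apply] at h2 ⊢
      have h3 : ε j * (ε j * h j) = h j := by rw [← mul_assoc, hεε, one_mul]
      rw [← h3, h2, mul_zero])
    let P' : LP ρ κ := ⟨P.M, P.M.mulVec d, P.cost⟩
    have hβ' : P'.IsBasis β := hβ
    have hyβ : ∀ j, (∀ i, β i ≠ j) → y j = 0 := fun j hj => by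
      by_contra h0
      obtain ⟨i, hi⟩ := hβs j (by simp [h0])
      exact hj i hi
    have h4 := hβ'.eq_basicSol (x := fun j => ε j * y j) (by
      rw [← hy.1, hQM]) fun j hj => by rw [hyβ j hj, mul_zero]
    have h5 : |d j₀| ≤ y j₀ := by linarith
    by_cases hj : ∃ i, β i = j₀
    · obtain ⟨i, hi⟩ := hj
      have h6 := hβ'.abs_basicVal_le hM i
      rw [← hβ'.basicSol_apply, ← h4, hi] at h6
      refine h5.trans (le_trans ?_ h6)
      rw [abs_mul, show |ε j₀| = 1 by simp only [ε]; split_ifs <;> simp, one_mul]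
      exact le_abs_self _
    · push Not at hj
      rw [hyβ j₀ hj] at h5
      exact h5.trans (Finset.sum_nonneg fun i _ => abs_nonneg _)

/-! ## Directions at a unique optimal solution -/

lemma IsOptimal.value_nonneg {x d : κ → ℝ} (hx : P.IsOptimal x) (hd : P.M.mulVec d = 0)
    (h0 : ∀ j, x j = 0 → 0 ≤ d j) : 0 ≤ P.value d := by
  obtain ⟨t, ht, hnn⟩ := exists_step hx.1.2 h0
  have := hx.2 (x + t • d) ⟨by
    rw [Matrix.mulVec_add, Matrix.mulVec_smul, hd, hx.1.1, smul_zero, add_zero], hnn⟩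
  rw [value_add, value_smul] at this
  by_contra hneg
  nlinarith

lemma IsOptimal.eq_zero_of_value_nonpos {x d : κ → ℝ} (hx : P.IsOptimal x)
    (huniq : ∀ y, P.IsOptimal y → y = x) (hd : P.M.mulVec d = 0)
    (h0 : ∀ j, x j = 0 → 0 ≤ d j) (hv : P.value d ≤ 0) : d = 0 := by
  obtain ⟨t, ht, hnn⟩ := exists_step hx.1.2 h0
  have hfe : P.Feasible (x + t • d) := ⟨by
    rw [Matrix.mulVec_add, Matrix.mulVec_smul, hd, hx.1.1, smul_zero, add_zero], hnn⟩
  have := huniq (x + t • d) ⟨hfe, fun y hy => by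
    rw [value_add, value_smul]
    have := hx.2 y hy
    nlinarith⟩
  have h1 : t • d = 0 := by simpa using this
  exact (smul_eq_zero.1 h1).resolve_left ht.ne'

end

end LP

end PrimalTardos

namespace PrimalTardos

namespace LP

section
variable {ρ κ : Type} [Fintype ρ] [DecidableEq ρ] [Fintype κ] [DecidableEq κ] {P : LP ρ κ}
  {ℓ β : ρ → κ}

/-! ## Rounding -/

lemma roundedOf_submatrix (P : LP ρ κ) (ℓ β : ρ → κ) :
    (roundedOf P ℓ).M.submatrix id β = (P.M.submatrix id ℓ)⁻¹ * P.M.submatrix id β := by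
  ext i j; rfl

lemma IsBasis.roundedOf_isBasis_iff (hℓ : P.IsBasis ℓ) :
    (roundedOf P ℓ).IsBasis β ↔ P.IsBasis β := by
  rw [IsBasis, roundedOf_submatrix, Matrix.det_mul, IsUnit.mul_iff, IsBasis]
  refine and_iff_right ?_
  rw [Matrix.det_nonsing_inv]
  exact IsUnit.ringInverse hℓ

lemma IsBasis.roundedOf_tableau (hℓ : P.IsBasis ℓ) (β : ρ → κ) :
    (roundedOf P ℓ).tableau β = P.tableau β := by
  rw [tableau, roundedOf_submatrix, Matrix.mul_inv_rev, Matrix.nonsing_inv_nonsing_inv _ hℓ]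
  change _ * ((P.M.submatrix id ℓ)⁻¹ * P.M) = _
  rw [Matrix.mul_assoc, Matrix.mul_nonsing_inv_cancel_left _ _ hℓ]
  rfl

lemma IsBasis.roundedOf_redCost (hℓ : P.IsBasis ℓ) (β : ρ → κ) (j : κ) :
    (roundedOf P ℓ).redCost β j = P.redCost β j := by
  rw [redCost, hℓ.roundedOf_tableau]; rfl

lemma IsBasis.roundedOf_isTotallyUnimodular (hℓ : P.IsBasis ℓ) (hM : P.M.IsTotallyUnimodular) :
    (roundedOf P ℓ).M.IsTotallyUnimodular := hℓ.isTotallyUnimodular_tableau hM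

lemma IsBasis.roundedOf_isBasis_self (hℓ : P.IsBasis ℓ) : (roundedOf P ℓ).IsBasis ℓ :=
  hℓ.roundedOf_isBasis_iff.2 hℓ

/-- The shortest solution of `M x = rhs`. -/
noncomputable def minNormSol (P : LP ρ κ) : κ → ℝ :=
  (P.M.transpose * (P.M * P.M.transpose)⁻¹).mulVec P.rhs

lemma IsBasis.isUnit_gram (hℓ : P.IsBasis ℓ) : IsUnit (P.M * P.M.transpose).det := by
  rw [isUnit_iff_ne_zero]
  intro h0
  obtain ⟨u, hu, hu0⟩ := Matrix.exists_mulVec_eq_zero_iff.2 h0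
  apply hu
  have h1 : dotProduct (P.M.transpose.mulVec u) (P.M.transpose.mulVec u) = 0 := by
    rw [Matrix.dotProduct_mulVec, Matrix.vecMul_transpose, Matrix.mulVec_mulVec, hu0,
      zero_dotProduct]
  have h2 := dotProduct_self_eq_zero.1 h1
  have h3 : (P.M.submatrix id ℓ).transpose.mulVec u = 0 := by
    funext i
    exact congrFun h2 (ℓ i)
  have hdet : IsUnit (P.M.submatrix id ℓ).transpose.det := by rw [Matrix.det_transpose]; exact hℓ
  have h4 := congrArg (fun w => ((P.M.submatrix id ℓ).transpose⁻¹).mulVec w) h3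
  simpa only [Matrix.mulVec_mulVec, Matrix.nonsing_inv_mul _ hdet, Matrix.one_mulVec,
    Matrix.mulVec_zero] using h4

lemma IsBasis.mulVec_minNormSol (hℓ : P.IsBasis ℓ) : P.M.mulVec P.minNormSol = P.rhs := by
  rw [minNormSol, Matrix.mulVec_mulVec, ← Matrix.mul_assoc,
    Matrix.mul_nonsing_inv _ hℓ.isUnit_gram, Matrix.one_mulVec]

lemma IsBasis.minNormSol_le (hℓ : P.IsBasis ℓ) {x : κ → ℝ} (hx : P.M.mulVec x = P.rhs) :
    dotProduct P.minNormSol P.minNormSol ≤ dotProduct x x := by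
  have h1 : dotProduct P.minNormSol (x - P.minNormSol) = 0 := by
    have h2 : P.minNormSol = Matrix.vecMul ((P.M * P.M.transpose)⁻¹.mulVec P.rhs) P.M := by
      rw [minNormSol, ← Matrix.mulVec_mulVec, ← Matrix.vecMul_transpose,
        Matrix.transpose_transpose]
    have h3 : P.M.mulVec (x - P.minNormSol) = 0 := by
      rw [Matrix.mulVec_sub, hx, hℓ.mulVec_minNormSol, sub_self]
    conv_lhs => rw [h2]
    rw [← Matrix.dotProduct_mulVec, ← h2, h3, dotProduct_zero]
  have h2 : dotProduct x x = dotProduct P.minNormSol P.minNormSol +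
      2 * dotProduct P.minNormSol (x - P.minNormSol) +
      dotProduct (x - P.minNormSol) (x - P.minNormSol) := by
    simp only [dotProduct, Finset.mul_sum, ← Finset.sum_add_distrib, Pi.sub_apply]
    exact Finset.sum_congr rfl fun j _ => by ring
  have h3 : 0 ≤ dotProduct (x - P.minNormSol) (x - P.minNormSol) :=
    Finset.sum_nonneg fun j _ => mul_self_nonneg _
  linarith

lemma scale_eq (P : LP ρ κ) : scale P = √(dotProduct P.minNormSol P.minNormSol) /
    ((Fintype.card ρ : ℝ) + (Fintype.card κ : ℝ) ^ 2) := by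
  rw [scale, EuclideanSpace.norm_eq]
  congr 2
  exact Finset.sum_congr rfl fun j _ => by
    rw [Real.norm_eq_abs, sq_abs, sq]; rfl

section
variable (hℓ : P.IsBasis ℓ) (hv : P.basicVal ℓ ≠ 0)
include hℓ hv

lemma minNormSol_pos : 0 < dotProduct P.minNormSol P.minNormSol := by
  refine lt_of_le_of_ne (Finset.sum_nonneg fun j _ => mul_self_nonneg _) fun h0 => hv ?_
  have h1 := dotProduct_self_eq_zero.1 h0.symm
  have h2 := hℓ.mulVec_minNormSol
  rw [h1, Matrix.mulVec_zero] at h2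
  rw [basicVal, ← h2, Matrix.mulVec_zero]

lemma nonempty_rows : Nonempty ρ := by
  by_contra h
  rw [not_nonempty_iff] at h
  exact hv (funext fun i => h.elim i)

lemma card_rows_pos : 1 ≤ Fintype.card ρ := by
  have := nonempty_rows hℓ hv
  exact Fintype.card_pos

lemma card_rows_le_card_cols : Fintype.card ρ ≤ Fintype.card κ :=
  Fintype.card_le_of_injective _ hℓ.injective

lemma scale_pos : 0 < scale P := by
  rw [scale_eq]
  have h1 := minNormSol_pos hℓ hv
  have h2 : (1 : ℝ) ≤ Fintype.card ρ := by exact_mod_cast card_rows_pos hℓ hv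
  have := Real.sqrt_pos.2 h1
  positivity

/-- The excess of the rounded right-hand side. -/
lemma rounded_excess (i : ρ) : 0 ≤ (roundedOf P ℓ).rhs i - P.basicVal ℓ i / scale P ∧
    (roundedOf P ℓ).rhs i - P.basicVal ℓ i / scale P < 1 := by
  have h1 := Int.le_ceil (P.basicVal ℓ i / scale P)
  have h2 := Int.ceil_lt_add_one (P.basicVal ℓ i / scale P)
  simp only [roundedOf]
  constructor <;> linarith

lemma roundedOf_feasible {x : κ → ℝ} (hx : P.Feasible x) : ∃ y, (roundedOf P ℓ).Feasible y := by
  have hk := scale_pos hℓ hv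
  refine ⟨(scale P)⁻¹ • x + fun j => ∑ i, if ℓ i = j then
    (roundedOf P ℓ).rhs i - P.basicVal ℓ i / scale P else 0, ?_, ?_⟩
  · rw [Matrix.mulVec_add, Matrix.mulVec_smul]
    change (scale P)⁻¹ • (P.tableau ℓ).mulVec x + (P.tableau ℓ).mulVec _ = _
    rw [tableau_mulVec_of_eq hx.1]
    funext i
    simp only [Pi.add_apply, Pi.smul_apply, smul_eq_mul, Matrix.mulVec, dotProduct,
      Finset.mul_sum, mul_ite, mul_zero]
    rw [Finset.sum_comm]
    simp only [Finset.sum_ite_eq, Finset.mem_univ, if_true, hℓ.tableau_basis]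
    simp
    ring
  · refine add_nonneg (smul_nonneg (inv_nonneg.2 hk.le) hx.2) fun j => ?_
    refine Finset.sum_nonneg fun i _ => ?_
    split_ifs
    exacts [(rounded_excess hℓ hv i).1, le_rfl]

lemma abs_basicVal_div_scale_le (hM : P.M.IsTotallyUnimodular) (i : ρ) :
    |P.basicVal ℓ i / scale P| ≤ Fintype.card κ * (Fintype.card ρ + (Fintype.card κ : ℝ) ^ 2) := by
  have hk := scale_pos hℓ hv
  rw [abs_div, abs_of_pos hk, div_le_iff₀ hk, scale_eq]
  have h2 : (1 : ℝ) ≤ Fintype.card ρ := by exact_mod_cast card_rows_pos hℓ hv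
  have hn1 : (1 : ℝ) ≤ Fintype.card κ := by
    exact_mod_cast (card_rows_pos hℓ hv).trans (card_rows_le_card_cols hℓ hv)
  have hpos : (0 : ℝ) < (Fintype.card ρ : ℝ) + (Fintype.card κ : ℝ) ^ 2 := by positivity
  rw [mul_assoc, mul_div_cancel₀ _ hpos.ne']
  refine abs_le_of_sq_le_sq ?_ (by positivity)
  rw [mul_pow, Real.sq_sqrt (minNormSol_pos hℓ hv).le, ← tableau_mulVec_of_eq hℓ.mulVec_minNormSol]
  have h3 : ((P.tableau ℓ).mulVec P.minNormSol i) ^ 2 ≤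
      (∑ j, P.tableau ℓ i j ^ 2) * ∑ j, P.minNormSol j ^ 2 :=
    Finset.sum_mul_sq_le_sq_mul_sq _ _ _
  have h4 : ∑ j, P.tableau ℓ i j ^ 2 ≤ (Fintype.card κ : ℝ) := by
    calc ∑ j, P.tableau ℓ i j ^ 2 ≤ ∑ _j : κ, (1 : ℝ) := Finset.sum_le_sum fun j _ => by
          have := abs_sign_le ((hℓ.isTotallyUnimodular_tableau hM).apply i j)
          rw [← sq_abs]
          exact pow_le_one₀ (abs_nonneg _) this
      _ = Fintype.card κ := by simp
  have h5 : ∑ j, P.minNormSol j ^ 2 = dotProduct P.minNormSol P.minNormSol :=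
    Finset.sum_congr rfl fun j _ => sq _
  rw [h5] at h3
  refine h3.trans (mul_le_mul_of_nonneg_right (h4.trans ?_) (minNormSol_pos hℓ hv).le)
  nlinarith

lemma abs_rounded_rhs_le (hM : P.M.IsTotallyUnimodular) (i : ρ) :
    |⌈P.basicVal ℓ i / scale P⌉| ≤
      ((Fintype.card κ * (Fintype.card ρ + Fintype.card κ ^ 2) : ℕ) : ℤ) := by
  have h := abs_le.1 (abs_basicVal_div_scale_le hℓ hv hM i)
  rw [abs_le]
  constructor
  · rw [Int.le_ceil_iff]
    push_cast
    linarith [h.1]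
  · rw [Int.ceil_le]
    push_cast
    exact h.2

/-- A feasible solution of the rounded problem has a large entry. -/
lemma exists_large {x : κ → ℝ} (hx : (roundedOf P ℓ).Feasible x) :
    ∃ j, (Fintype.card κ : ℝ) ≤ x j := by
  by_contra hcon
  push Not at hcon
  have hk := scale_pos hℓ hv
  let F : κ → ℝ := fun j => ∑ i, if ℓ i = j then
    (roundedOf P ℓ).rhs i - P.basicVal ℓ i / scale P else 0
  have hF : ∀ j, 0 ≤ F j ∧ F j < 1 := by
    intro j
    by_cases hj : ∃ i, ℓ i = j
    · obtain ⟨i, rfl⟩ := hj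
      have : F (ℓ i) = (roundedOf P ℓ).rhs i - P.basicVal ℓ i / scale P := by
        simp [F, hℓ.injective.eq_iff]
      rw [this]
      exact rounded_excess hℓ hv i
    · push Not at hj
      simp [F, hj]
  have hsol : P.M.mulVec (scale P • (x - F)) = P.rhs := by
    have h1 : (P.tableau ℓ).mulVec (scale P • (x - F)) = P.basicVal ℓ := by
      rw [Matrix.mulVec_smul, Matrix.mulVec_sub]
      have h2 : (P.tableau ℓ).mulVec x = (roundedOf P ℓ).rhs := hx.1
      rw [h2]
      funext i
      simp only [F, Pi.smul_apply, Pi.sub_apply, smul_eq_mul, Matrix.mulVec, dotProduct,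
        Finset.mul_sum, mul_ite, mul_zero]
      rw [Finset.sum_comm]
      simp only [Finset.sum_ite_eq, Finset.mem_univ, if_true, hℓ.tableau_basis]
      simp
      field_simp
    rw [← hℓ.mul_tableau, ← Matrix.mulVec_mulVec, h1, hℓ.mulVec_basicVal]
  have h1 := hℓ.minNormSol_le hsol
  have hn1 : (1 : ℝ) ≤ Fintype.card κ := by
    exact_mod_cast (card_rows_pos hℓ hv).trans (card_rows_le_card_cols hℓ hv)
  have hm1 : (1 : ℝ) ≤ Fintype.card ρ := by exact_mod_cast card_rows_pos hℓ hv
  set n' : ℝ := (Fintype.card κ : ℝ) with hn'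
  set m' : ℝ := (Fintype.card ρ : ℝ) with hm'
  have hne : Nonempty κ := by
    obtain ⟨i⟩ := nonempty_rows hℓ hv
    exact ⟨ℓ i⟩
  have h2 : dotProduct (x - F) (x - F) < n' * n' ^ 2 := by
    calc dotProduct (x - F) (x - F) = ∑ j, (x j - F j) ^ 2 :=
          Finset.sum_congr rfl fun j _ => by rw [Pi.sub_apply, sq]
      _ < ∑ _j : κ, n' ^ 2 := by
          refine Finset.sum_lt_sum_of_nonempty Finset.univ_nonempty fun j _ => ?_
          have h3 := hcon j
          have h4 := hF j
          have h5 := hx.2 j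
          simp only [Pi.zero_apply] at h5
          exact sq_lt_sq' (by linarith) (by linarith)
      _ = n' * n' ^ 2 := by simp [hn']
  have h3 : dotProduct (scale P • (x - F)) (scale P • (x - F)) =
      scale P ^ 2 * dotProduct (x - F) (x - F) := by
    rw [smul_dotProduct, dotProduct_smul, smul_eq_mul, smul_eq_mul]; ring
  have hpos : (0 : ℝ) < m' + n' ^ 2 := by positivity
  have h4 : scale P ^ 2 * (m' + n' ^ 2) ^ 2 = dotProduct P.minNormSol P.minNormSol := by
    rw [scale_eq, div_pow, Real.sq_sqrt (minNormSol_pos hℓ hv).le, ← hm', ← hn',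
      div_mul_cancel₀ _ (by positivity)]
  rw [h3, ← h4] at h1
  have h5 : (m' + n' ^ 2) ^ 2 ≤ dotProduct (x - F) (x - F) :=
    le_of_mul_le_mul_left h1 (by positivity)
  have h6 : n' * n' ^ 2 ≤ (n' ^ 2) ^ 2 := by
    have : n' ≤ n' ^ 2 := by nlinarith
    rw [sq (n' ^ 2)]
    exact mul_le_mul_of_nonneg_right this (by positivity)
  have h7 : (n' ^ 2) ^ 2 ≤ (m' + n' ^ 2) ^ 2 :=
    pow_le_pow_left₀ (by positivity) (by linarith) 2
  linarith

/-- The proximity of an optimal solution `x` of the rounded problem and the solution `y` of the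
original problem: if `x j ≥ n'` and `y j = 0`, then there is a kernel vector along which `x` can
be decreased and `y` can be increased. -/
lemma exists_kernel_of_large (hM : P.M.IsTotallyUnimodular) {x y : κ → ℝ}
    (hx : (roundedOf P ℓ).IsOptimal x) (hy : P.Feasible y) {j₀ : κ}
    (hj : (Fintype.card κ : ℝ) ≤ x j₀) (hyj : y j₀ = 0) :
    ∃ h : κ → ℝ, h ≠ 0 ∧ P.M.mulVec h = 0 ∧ (∀ j, y j = 0 → 0 ≤ h j) ∧ P.value h ≤ 0 := by
  have hk := scale_pos hℓ hv
  by_contra hcon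
  have hno : ∀ h, (roundedOf P ℓ).M.mulVec h = 0 →
      (∀ j, (x - (scale P)⁻¹ • y) j = 0 → h j = 0) →
      (∀ j, 0 ≤ h j * (x - (scale P)⁻¹ • y) j) → h = 0 := by
    intro h hh hs hc
    by_contra hne
    refine hcon ⟨h, hne, hℓ.mulVec_eq_zero hh, fun j hyj => ?_, ?_⟩
    · by_cases h0 : (x - (scale P)⁻¹ • y) j = 0
      · exact (hs j h0).ge
      · have h1 := hc j
        have h2 := hx.1.2 j
        simp only [Pi.sub_apply, Pi.smul_apply, hyj, smul_zero, sub_zero, Pi.zero_apply] at h0 h1 h2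
        have h3 : 0 < x j := lt_of_le_of_ne h2 (Ne.symm h0)
        exact nonneg_of_mul_nonneg_left h1 h3
    · have h1 := hx.value_nonneg (d := -h) (by rw [Matrix.mulVec_neg, hh, neg_zero])
        fun j hxj => by
          have h2 := hc j
          have h3 : 0 ≤ (scale P)⁻¹ * y j := mul_nonneg (inv_nonneg.2 hk.le) (hy.2 j)
          simp only [Pi.sub_apply, Pi.smul_apply, hxj, smul_eq_mul, zero_sub, Pi.neg_apply] at h2 ⊢
          rcases h3.eq_or_lt with h4 | h4
          · rw [hs j (by simp only [Pi.sub_apply, Pi.smul_apply, smul_eq_mul, hxj, ← h4, sub_zero])]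
            simp
          · by_contra hneg
            nlinarith
      have h4 : (roundedOf P ℓ).value (-h) = -P.value h := by
        simp [value, roundedOf]
      linarith
  have hbound := abs_le_of_no_conformal (hℓ.roundedOf_isTotallyUnimodular hM)
    hℓ.roundedOf_isBasis_self hno j₀
  have hexc : (roundedOf P ℓ).M.mulVec (x - (scale P)⁻¹ • y) =
      fun i => (roundedOf P ℓ).rhs i - P.basicVal ℓ i / scale P := by
    rw [Matrix.mulVec_sub, hx.1.1, Matrix.mulVec_smul]
    change _ - (scale P)⁻¹ • (P.tableau ℓ).mulVec y = _
    rw [tableau_mulVec_of_eq hy.1]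
    funext i
    simp only [Pi.sub_apply, Pi.smul_apply, smul_eq_mul]
    ring
  rw [hexc] at hbound
  have hne := nonempty_rows hℓ hv
  have h1 : ∑ i, |(roundedOf P ℓ).rhs i - P.basicVal ℓ i / scale P| < ∑ _i : ρ, (1 : ℝ) := by
    refine Finset.sum_lt_sum_of_nonempty Finset.univ_nonempty fun i _ => ?_
    have := rounded_excess hℓ hv i
    rw [abs_of_nonneg this.1]
    exact this.2
  simp only [Finset.sum_const, Finset.card_univ, nsmul_eq_mul, mul_one] at h1
  have h2 : (Fintype.card ρ : ℝ) ≤ Fintype.card κ := by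
    exact_mod_cast card_rows_le_card_cols hℓ hv
  simp only [Pi.sub_apply, Pi.smul_apply, hyj, smul_zero, sub_zero] at hbound
  have h3 := le_abs_self (x j₀)
  linarith

end

end

end LP

end PrimalTardos

namespace PrimalTardos

/-! ## The reduced problem -/

section
variable {m n : ℕ} {A : Matrix (Fin m) (Fin n) ℝ} {b : Fin m → ℝ} {c : Fin n → ℝ}
  {Kb : Finset (Fin n)} {σ : Fin m → Fin n}

lemma Extends.isBasis (hσ : Extends A Kb σ) : (original A b c).IsBasis σ := hσ.1

lemma Hmat_mul (A : Matrix (Fin m) (Fin n) ℝ) (b : Fin m → ℝ) (c : Fin n → ℝ)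
    (σ : Fin m → Fin n) : Hmat A σ * A = (original A b c).tableau σ := rfl

lemma reduced_M (i : Row Kb σ) (j : Col Kb) :
    (reduced A b c Kb σ).M i j = (original A b c).tableau σ i j := rfl

lemma reduced_rhs (i : Row Kb σ) :
    (reduced A b c Kb σ).rhs i = (original A b c).basicVal σ i := rfl

lemma Extends.sum_split (hσ : Extends A Kb σ) (f : Fin n → ℝ) :
    ∑ j, f j = ∑ j : Col Kb, f j + ∑ i : {i : Fin m // σ i ∈ Kb}, f (σ i) := by
  rw [← Fintype.sum_subtype_add_sum_subtype (fun j => j ∉ Kb) f]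
  congr 1
  symm
  have hinj : Function.Injective σ := (hσ.isBasis (b := 0) (c := 0)).injective
  refine Fintype.sum_bijective
    (fun i : {i : Fin m // σ i ∈ Kb} => (⟨σ i, not_not.2 i.2⟩ : {j // ¬ j ∉ Kb})) ⟨?_, ?_⟩ _ _
    fun _ => rfl
  · intro i i' h
    exact Subtype.ext (hinj (congrArg Subtype.val h))
  · rintro ⟨j, hj⟩
    obtain ⟨i, rfl⟩ := hσ.2 j (not_not.1 hj)
    exact ⟨⟨i, not_not.1 hj⟩, rfl⟩

lemma sum_row (f : Fin m → ℝ) (hf : ∀ i, σ i ∈ Kb → f i = 0) :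
    ∑ i, f i = ∑ i : Row Kb σ, f i := by
  rw [← Fintype.sum_subtype_add_sum_subtype (fun i => σ i ∉ Kb) f, Finset.sum_eq_zero
    (s := (Finset.univ : Finset {i // ¬ σ i ∉ Kb})) fun i _ => hf i (not_not.1 i.2), add_zero]

lemma Extends.tableau_mulVec_row (hσ : Extends A Kb σ) (y : Fin n → ℝ) (i : Row Kb σ) :
    (reduced A b c Kb σ).M.mulVec (fun j => y j) i = ((original A b c).tableau σ).mulVec y i := by
  rw [Matrix.mulVec, Matrix.mulVec, dotProduct, dotProduct, hσ.sum_split]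
  have h0 : ∑ i' : {i : Fin m // σ i ∈ Kb},
      (original A b c).tableau σ i (σ i') * y (σ i') = 0 := by
    refine Finset.sum_eq_zero fun i' _ => ?_
    rw [hσ.isBasis.tableau_basis, if_neg, zero_mul]
    intro h
    exact i.2 (h ▸ i'.2)
  exact ((congrArg _ h0).trans (add_zero _)).symm

lemma Extends.tableau_mulVec_of_mem (hσ : Extends A Kb σ) (y : Fin n → ℝ)
    (i : {i : Fin m // σ i ∈ Kb}) :
    ((original A b c).tableau σ).mulVec y i =
      y (σ i) + ∑ j : Col Kb, (original A b c).tableau σ i j * y j := by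
  rw [Matrix.mulVec, dotProduct, hσ.sum_split, add_comm]
  congr 1
  rw [Finset.sum_eq_single i]
  · rw [hσ.isBasis.tableau_basis, if_pos rfl, one_mul]
  · intro i' _ hi'
    rw [hσ.isBasis.tableau_basis, if_neg fun h => hi' (Subtype.ext h.symm), zero_mul]
  · simp

lemma Extends.value_eq (hσ : Extends A Kb σ) (y : Fin n → ℝ) :
    (original A b c).value y = (reduced A b c Kb σ).value (fun j => y j) +
      ∑ i : {i : Fin m // σ i ∈ Kb}, c (σ i) * ((original A b c).tableau σ).mulVec y i := by
  simp only [hσ.tableau_mulVec_of_mem, mul_add, Finset.sum_add_distrib]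
  rw [LP.value, hσ.sum_split]
  have h1 : (reduced A b c Kb σ).value (fun j => y j) = ∑ j : Col Kb, c j * y j -
      ∑ i : {i : Fin m // σ i ∈ Kb}, c (σ i) *
        ∑ j : Col Kb, (original A b c).tableau σ i j * y j := by
    simp only [LP.value, reduced, sub_mul, Finset.sum_sub_distrib, Finset.sum_mul,
      Finset.mul_sum, Hmat_mul A b c]
    congr 1
    rw [Finset.sum_comm]
    exact Finset.sum_congr rfl fun i _ => Finset.sum_congr rfl fun j _ => by ring
  rw [h1]
  simp only [original]
  ring

lemma Extends.value_eq_of_eq_zero (hσ : Extends A Kb σ) {y : Fin n → ℝ} (hy : A.mulVec y = 0) :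
    (original A b c).value y = (reduced A b c Kb σ).value (fun j => y j) := by
  have h := LP.tableau_mulVec_of_eq_zero (P := original A b c) (β := σ) hy
  rw [hσ.value_eq, h]
  simp

lemma Extends.mulVec_restrict (hσ : Extends A Kb σ) {y : Fin n → ℝ} (hy : A.mulVec y = b) :
    (reduced A b c Kb σ).M.mulVec (fun j => y j) = (reduced A b c Kb σ).rhs := by
  funext i
  rw [hσ.tableau_mulVec_row, LP.tableau_mulVec_of_eq (P := original A b c) hy]
  rfl

lemma Extends.feasible_restrict (hσ : Extends A Kb σ) {y : Fin n → ℝ}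
    (hy : (original A b c).Feasible y) : (reduced A b c Kb σ).Feasible fun j => y j :=
  ⟨hσ.mulVec_restrict hy.1, fun j => hy.2 j⟩

/-- Kernel vectors of the reduced problem extend to kernel vectors of the original problem. -/
lemma Extends.exists_kernel (hσ : Extends A Kb σ) {h : Col Kb → ℝ}
    (hh : (reduced A b c Kb σ).M.mulVec h = 0) :
    ∃ y : Fin n → ℝ, A.mulVec y = 0 ∧ (∀ j : Col Kb, y j = h j) ∧
      (original A b c).value y = (reduced A b c Kb σ).value h := by
  have hb := hσ.isBasis (b := b) (c := c)
  let y : Fin n → ℝ := fun j => if hj : j ∉ Kb then h ⟨j, hj⟩ else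
    ∑ i, if σ i = j then -∑ j' : Col Kb, (original A b c).tableau σ i j' * h j' else 0
  have hyK : ∀ j : Col Kb, y j = h j := fun j => dif_pos j.2
  have hyK' : (fun j : Col Kb => y j) = h := funext hyK
  have hyB : ∀ i : {i : Fin m // σ i ∈ Kb},
      y (σ i) = -∑ j' : Col Kb, (original A b c).tableau σ i j' * h j' := fun i => by
    simp only [y]
    rw [dif_neg (not_not.2 i.2)]
    simp [hb.injective.eq_iff]
  have hA : A.mulVec y = 0 := by
    refine hb.mulVec_eq_zero (funext fun i => ?_)
    by_cases hi : σ i ∈ Kb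
    · rw [hσ.tableau_mulVec_of_mem y ⟨i, hi⟩, hyB ⟨i, hi⟩]
      simp [hyK]
    · rw [← hσ.tableau_mulVec_row y ⟨i, hi⟩, hyK', hh]
      rfl
  exact ⟨y, hA, hyK, by rw [hσ.value_eq_of_eq_zero hA, hyK']⟩

lemma merge_of_notMem {β : Row Kb σ → Col Kb} (i : Row Kb σ) : merge β i = β i := dif_pos i.2

lemma merge_of_mem {β : Row Kb σ → Col Kb} {i : Fin m} (hi : σ i ∈ Kb) : merge β i = σ i :=
  dif_neg (not_not.2 hi)

lemma tableau_submatrix (τ : Fin m → Fin n) :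
    ((original A b c).tableau σ).submatrix id τ =
      (A.submatrix id σ)⁻¹ * A.submatrix id τ := by
  ext i j; rfl

lemma Extends.merge_isBasis_iff (hσ : Extends A Kb σ) {β : Row Kb σ → Col Kb} :
    (original A b c).IsBasis (merge β) ↔ (reduced A b c Kb σ).IsBasis β := by
  have hb := hσ.isBasis (b := b) (c := c)
  have h1 : IsUnit (((original A b c).tableau σ).submatrix id (merge β)).det ↔
      (original A b c).IsBasis (merge β) := by
    rw [tableau_submatrix, Matrix.det_mul, IsUnit.mul_iff, LP.IsBasis]
    refine and_iff_right ?_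
    rw [Matrix.det_nonsing_inv]
    exact IsUnit.ringInverse hσ.1
  rw [← h1, Matrix.twoBlockTriangular_det' _ (fun i => σ i ∉ Kb)]
  · have h2 : ((((original A b c).tableau σ).submatrix id (merge β)).toSquareBlockProp
        fun i => ¬ σ i ∉ Kb) = 1 := by
      ext ⟨i, hi⟩ ⟨j, hj⟩
      simp only [Matrix.toSquareBlockProp, Matrix.submatrix_apply, id, Matrix.one_apply,
        Subtype.mk.injEq, Matrix.toBlock_apply]
      rw [merge_of_mem (not_not.1 hj), hb.tableau_basis]
    have h3 : (((original A b c).tableau σ).submatrix id (merge β)).toSquareBlockProp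
        (fun i => σ i ∉ Kb) = (reduced A b c Kb σ).M.submatrix id β := by
      ext i j
      simp only [Matrix.toSquareBlockProp, Matrix.submatrix_apply, id, Matrix.toBlock_apply,
        merge_of_notMem]
      rfl
    rw [h2, h3, Matrix.det_one, mul_one, LP.IsBasis]
  · intro i hi j hj
    simp only [Matrix.submatrix_apply, id]
    rw [merge_of_mem (not_not.1 hj), hb.tableau_basis, if_neg]
    rintro rfl
    exact hj hi

lemma Extends.merge_mulVec (hσ : Extends A Kb σ) (β : Row Kb σ → Col Kb) (u : Fin m → ℝ)
    (i : Row Kb σ) :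
    ((reduced A b c Kb σ).M.submatrix id β).mulVec (fun i => u i) i =
      ((A.submatrix id σ)⁻¹).mulVec ((A.submatrix id (merge β)).mulVec u) i := by
  rw [Matrix.mulVec_mulVec, ← tableau_submatrix (b := b) (c := c), Matrix.mulVec, Matrix.mulVec,
    dotProduct, dotProduct, sum_row (Kb := Kb) (σ := σ)]
  · refine Finset.sum_congr rfl fun i' _ => ?_
    rw [Matrix.submatrix_apply, Matrix.submatrix_apply, merge_of_notMem]
    rfl
  · intro i' hi'
    rw [Matrix.submatrix_apply, merge_of_mem hi', id,
      (hσ.isBasis (b := b) (c := c)).tableau_basis, if_neg, zero_mul]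
    intro h
    exact i.2 (h ▸ hi')

variable {β : Row Kb σ → Col Kb}

lemma Extends.merge_tableau (hσ : Extends A Kb σ) (hβ : (reduced A b c Kb σ).IsBasis β)
    (i : Row Kb σ) (j : Col Kb) :
    (reduced A b c Kb σ).tableau β i j = (original A b c).tableau (merge β) i j := by
  have hm := hσ.merge_isBasis_iff.2 hβ
  refine congrFun (hβ.tableau_col_eq
    (u := fun i : Row Kb σ => (original A b c).tableau (merge β) i j) (funext fun i => ?_)) i
  rw [hσ.merge_mulVec β fun i => (original A b c).tableau (merge β) i j]
  have := hm.mulVec_tableau_col j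
  rw [show (original A b c).M = A from rfl] at this
  rw [this]
  rfl

lemma Extends.merge_redCost (hσ : Extends A Kb σ) (hβ : (reduced A b c Kb σ).IsBasis β)
    (j : Col Kb) :
    (reduced A b c Kb σ).redCost β j = (original A b c).redCost (merge β) j := by
  have hm := hσ.merge_isBasis_iff.2 hβ
  have h1 := (original A b c).sum_mul_ray (merge β) j (original A b c).cost
  have h2 := (reduced A b c Kb σ).sum_mul_ray β j (reduced A b c Kb σ).cost
  have h3 := hσ.value_eq_of_eq_zero (b := b) (c := c) (hm.mulVec_ray j)
  have h4 : (fun j' : Col Kb => (original A b c).ray (merge β) j j') =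
      (reduced A b c Kb σ).ray β j := by
    funext j'
    simp only [LP.ray, Subtype.ext_iff]
    congr 1
    rw [sum_row (Kb := Kb) (σ := σ)]
    · refine Finset.sum_congr rfl fun i _ => ?_
      rw [merge_of_notMem, hσ.merge_tableau hβ]
    · refine fun i hi => if_neg fun h => j'.2 ?_
      rw [merge_of_mem hi] at h
      rwa [← h]
  rw [h4] at h3
  rw [LP.redCost, LP.redCost, ← h1, ← h2]
  exact h3.symm

lemma Extends.optimalTableau_merge (hσ : Extends A Kb σ) (hβ : (reduced A b c Kb σ).IsBasis β)
    (h : (reduced A b c Kb σ).OptimalTableau β) : (original A b c).OptimalTableau (merge β) := by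
  intro j
  by_cases hj : j ∈ Kb
  · obtain ⟨i, rfl⟩ := hσ.2 j hj
    have := (hσ.merge_isBasis_iff.2 hβ).redCost_basis i
    rw [merge_of_mem hj] at this
    exact this.ge
  · rw [← hσ.merge_redCost hβ ⟨j, hj⟩]
    exact h ⟨j, hj⟩

/-- The part of `σ` outside of `Kb` is a basis of the reduced problem. -/
def restBasis (Kb : Finset (Fin n)) (σ : Fin m → Fin n) : Row Kb σ → Col Kb := fun i => ⟨σ i, i.2⟩

lemma merge_restBasis : merge (restBasis Kb σ) = σ := by
  funext i
  by_cases hi : σ i ∈ Kb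
  · exact merge_of_mem hi
  · exact merge_of_notMem (β := restBasis Kb σ) ⟨i, hi⟩

lemma Extends.restBasis_isBasis (hσ : Extends A Kb σ) :
    (reduced A b c Kb σ).IsBasis (restBasis Kb σ) := by
  rw [← hσ.merge_isBasis_iff, merge_restBasis]; exact hσ.1

lemma Extends.card_row (hσ : Extends A Kb σ) : Fintype.card (Row Kb σ) + Kb.card = m := by
  have hinj : Function.Injective σ := (hσ.isBasis (b := 0) (c := 0)).injective
  have h1 : Fintype.card {i : Fin m // σ i ∈ Kb} = Kb.card := by
    rw [← Fintype.card_coe]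
    refine Fintype.card_of_bijective (f := fun i : {i : Fin m // σ i ∈ Kb} => (⟨σ i, i.2⟩ : Kb))
      ⟨fun i i' h => Subtype.ext (hinj (congrArg Subtype.val h)), ?_⟩
    rintro ⟨j, hj⟩
    obtain ⟨i, rfl⟩ := hσ.2 j hj
    exact ⟨⟨i, hj⟩, rfl⟩
  have h2 := Fintype.card_subtype_compl fun i : Fin m => σ i ∈ Kb
  rw [Fintype.card_fin, h1] at h2
  have h3 : Kb.card ≤ m := by
    rw [← h1]
    exact (Fintype.card_subtype_le _).trans (Fintype.card_fin m).le
  have h4 : Fintype.card (Row Kb σ) = m - Kb.card := h2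
  omega

lemma card_col : Fintype.card (Col Kb) + Kb.card = n := by
  have h2 : Fintype.card (Col Kb) = n - Kb.card := by
    simp
  have h3 : Kb.card ≤ n := by simpa using Kb.card_le_univ
  omega

lemma Extends.reduced_isTotallyUnimodular (hσ : Extends A Kb σ) (hA : A.IsTotallyUnimodular) :
    (reduced A b c Kb σ).M.IsTotallyUnimodular :=
  ((hσ.isBasis (b := b) (c := c)).isTotallyUnimodular_tableau hA).submatrix
    (fun i : Row Kb σ => (i : Fin m)) fun j : Col Kb => (j : Fin n)

/-! ## The rounded problems of the algorithm -/

/-- What is known about the set `Kb` at the beginning of an iteration. -/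
structure GoodSet (A : Matrix (Fin m) (Fin n) ℝ) (b : Fin m → ℝ) (c : Fin n → ℝ)
    (Kb : Finset (Fin n)) : Prop where
  extends_ : ∃ τ, Extends A Kb τ
  pos : ∀ x, (original A b c).IsOptimal x → ∀ j ∈ Kb, 0 < x j
  bounded : Kb = ∅ ∨ ¬ (original A b c).Unbounded

lemma exists_isBasis (hr : A.rank = m) : ∃ τ, (original A b c).IsBasis τ := by
  have hinj : Function.Injective fun u => Matrix.vecMul u A := by
    rw [Matrix.vecMul_injective_iff, linearIndependent_iff_card_eq_finrank_span,
      Set.finrank, ← Matrix.rank_eq_finrank_span_row, hr, Fintype.card_fin]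
  have key : ∀ S : Finset (Fin m), ∃ β, (original A b c).withUnits.IsBasis β ∧
      ∀ i ∈ S, ∃ j, β i = Sum.inl j := by
    intro S
    induction S using Finset.induction_on with
    | empty => exact ⟨_, (original A b c).withUnits_isBasis_inr, by simp⟩
    | insert r S _ ih =>
      obtain ⟨β, hβ, hS⟩ := ih
      obtain ⟨s, hs⟩ : ∃ s, (original A b c).withUnits.tableau β r (Sum.inl s) ≠ 0 := by
        by_contra hcon
        push Not at hcon
        set B := (original A b c).withUnits.M.submatrix id β with hB
        have h1 : Matrix.vecMul (B⁻¹ r) A = Matrix.vecMul 0 A := by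
          rw [Matrix.zero_vecMul]
          funext s
          have := hcon s
          rw [LP.tableau, ← hB, Matrix.mul_apply] at this
          exact this
        have h2 : B⁻¹ r = 0 := hinj h1
        have h3 := congrFun (congrFun (Matrix.nonsing_inv_mul B hβ) r) r
        rw [Matrix.mul_apply] at h3
        simp [h2] at h3
      refine ⟨_, hβ.update hs, fun i hi => ?_⟩
      by_cases hir : i = r
      · subst hir; exact ⟨s, by simp⟩
      · rw [Function.update_of_ne hir]
        exact hS i ((Finset.mem_insert.1 hi).resolve_left hir)
  obtain ⟨β, hβ, hl⟩ := key Finset.univ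
  choose τ hτ using fun i => hl i (Finset.mem_univ i)
  refine ⟨τ, LP.withUnits_isBasis_inl.1 ?_⟩
  rwa [← show β = fun i => Sum.inl (τ i) from funext hτ]

lemma goodSet_empty (hA : Admissible A b c) : GoodSet A b c ∅ := by
  obtain ⟨τ, hτ⟩ := exists_isBasis (b := b) (c := c) hA.2.1
  exact ⟨⟨τ, hτ, by simp⟩, by simp, Or.inl rfl⟩

section
variable {ℓ : Row Kb σ → Col Kb} (hA : Admissible A b c) (hK : GoodSet A b c Kb)
  (hσ : Extends A Kb σ) (hℓ : (reduced A b c Kb σ).IsBasis ℓ)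

lemma GoodSet.dir_nonneg (hK : GoodSet A b c Kb) (hσ : Extends A Kb σ) {x : Fin n → ℝ}
    (hx : (original A b c).IsOptimal x) {h : Col Kb → ℝ}
    (hh : (reduced A b c Kb σ).M.mulVec h = 0) (h0 : ∀ j : Col Kb, x j = 0 → 0 ≤ h j) :
    0 ≤ (reduced A b c Kb σ).value h := by
  obtain ⟨y, hy, hyh, hv⟩ := hσ.exists_kernel (b := b) (c := c) hh
  rw [← hv]
  refine hx.value_nonneg hy fun j hj => ?_
  by_cases hjK : j ∈ Kb
  · exact absurd hj (hK.pos x hx j hjK).ne'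
  · rw [hyh ⟨j, hjK⟩]; exact h0 ⟨j, hjK⟩ hj

lemma GoodSet.dir_eq_zero (hA : Admissible A b c) (hK : GoodSet A b c Kb) (hσ : Extends A Kb σ)
    {x : Fin n → ℝ} (hx : (original A b c).IsOptimal x) {h : Col Kb → ℝ}
    (hh : (reduced A b c Kb σ).M.mulVec h = 0) (h0 : ∀ j : Col Kb, x j = 0 → 0 ≤ h j)
    (hv : (reduced A b c Kb σ).value h ≤ 0) : h = 0 := by
  obtain ⟨y, hy, hyh, hyv⟩ := hσ.exists_kernel (b := b) (c := c) hh
  have := hx.eq_zero_of_value_nonpos (fun z hz => hA.2.2 z x hz hx) hy (fun j hj => by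
    by_cases hjK : j ∈ Kb
    · exact absurd hj (hK.pos x hx j hjK).ne'
    · rw [hyh ⟨j, hjK⟩]; exact h0 ⟨j, hjK⟩ hj) (hyv ▸ hv)
  funext j
  rw [← hyh j, this]; rfl

lemma candidate_eq_basicSol (hr : (reduced A b c Kb σ).rhs = 0) :
    (fun j => ∑ i, if σ i = j ∧ σ i ∈ Kb then (Hmat A σ).mulVec b i else 0) =
      (original A b c).basicSol σ := by
  funext j
  rw [LP.basicSol]
  refine Finset.sum_congr rfl fun i _ => ?_
  by_cases hij : σ i = j
  · by_cases hi : σ i ∈ Kb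
    · rw [if_pos ⟨hij, hi⟩, if_pos hij]; rfl
    · rw [if_neg fun h => hi h.2, if_pos hij]
      exact (congrFun hr ⟨i, hi⟩).symm
  · rw [if_neg fun h => hij h.1, if_neg hij]

include hA hK hσ hℓ

lemma correct_zeroRhs (h0 : (reduced A b c Kb σ).basicVal ℓ = 0) :
    Correct A b c (.zeroRhs fun j =>
      ∑ i, if σ i = j ∧ σ i ∈ Kb then (Hmat A σ).mulVec b i else 0) := by
  have hr : (reduced A b c Kb σ).rhs = 0 := by
    rw [← hℓ.mulVec_basicVal, h0, Matrix.mulVec_zero]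
  have hb := hσ.isBasis (b := b) (c := c)
  rw [Correct, candidate_eq_basicSol hr]
  set x := (original A b c).basicSol σ with hx
  have hxb : A.mulVec x = b := hb.mulVec_basicSol
  have hxK : ∀ j : Col Kb, x j = 0 := fun j => by
    by_cases hj : ∃ i, σ i = j
    · obtain ⟨i, hi⟩ := hj
      rw [← hi, hx, hb.basicSol_apply]
      exact congrFun hr ⟨i, hi ▸ j.2⟩
    · push Not at hj
      exact LP.basicSol_of_notMem _ hj
  by_cases hopt : ∃ y, (original A b c).IsOptimal y
  · obtain ⟨y, hy⟩ := hopt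
    have hker : (reduced A b c Kb σ).M.mulVec (fun j : Col Kb => y j) = 0 := by
      rw [hσ.mulVec_restrict (c := c) (b := b) hy.1.1, hr]
    have hker' : (reduced A b c Kb σ).M.mulVec (-fun j : Col Kb => y j) = 0 := by
      rw [Matrix.mulVec_neg, hker, neg_zero]
    have h1 := hK.dir_nonneg hσ hy hker' fun j hj => by simp [hj]
    have h2 : (reduced A b c Kb σ).value (-fun j : Col Kb => y j) =
        -(reduced A b c Kb σ).value (fun j : Col Kb => y j) := by simp [LP.value]
    have h3 := hK.dir_eq_zero hA hσ hy hker (fun j hj => hj.ge) (by linarith)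
    have h4 : y = x := by
      refine hb.eq_basicSol hy.1.1 fun j hj => ?_
      by_cases hjK : j ∈ Kb
      · obtain ⟨i, hi⟩ := hσ.2 j hjK
        exact absurd hi (hj i)
      · exact congrFun h3 ⟨j, hjK⟩
    exact Or.inl ⟨h4 ▸ hy.1.2, h4 ▸ hy⟩
  · push Not at hopt
    rcases LP.infeasible_or_unbounded hopt with hinf | hunb
    · exact Or.inr (Or.inl ⟨fun hnn => hinf x ⟨hxb, hnn⟩, hinf⟩)
    · refine Or.inr (Or.inr ?_)
      obtain rfl := hK.bounded.resolve_right (not_not.2 hunb)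
      have hx0 : x = 0 := funext fun j => hxK ⟨j, by simp⟩
      refine ⟨?_, hx0, hunb⟩
      rw [← hxb, hx0, Matrix.mulVec_zero]

variable (h0 : (reduced A b c Kb σ).basicVal ℓ ≠ 0)
include h0

omit hA hK in
lemma infeasible_of_rounded (hinf : (rounded A b c Kb σ ℓ).Infeasible) :
    (original A b c).Infeasible := fun x hx => by
  obtain ⟨y, hy⟩ := LP.roundedOf_feasible hℓ h0 (hσ.feasible_restrict hx)
  exact hinf y hy

omit hA h0 in
lemma not_optimal_of_rounded_unbounded (hβ : (rounded A b c Kb σ ℓ).IsBasis β)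
    (hu : (rounded A b c Kb σ ℓ).UnboundedTableau β) (x : Fin n → ℝ) :
    ¬ (original A b c).IsOptimal x := fun hx => by
  obtain ⟨d, hd, hM, hv⟩ := hu.exists_ray hβ
  exact absurd (hK.dir_nonneg hσ hx (hℓ.mulVec_eq_zero hM) fun j _ => hd j) (not_le.2 hv)

omit hA hK h0 in
lemma optimalTableau_of_rounded (hβ : (rounded A b c Kb σ ℓ).IsBasis β)
    (ho : (rounded A b c Kb σ ℓ).OptimalTableau β) :
    (original A b c).IsBasis (merge β) ∧ (original A b c).OptimalTableau (merge β) := by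
  have hβ' := hℓ.roundedOf_isBasis_iff.1 hβ
  exact ⟨hσ.merge_isBasis_iff.2 hβ', hσ.optimalTableau_merge hβ' fun j => by
    rw [← hℓ.roundedOf_redCost]; exact ho j⟩

variable (hβ : (rounded A b c Kb σ ℓ).IsFeasibleBasis β)
  (ho : (rounded A b c Kb σ ℓ).OptimalTableau β)
include hβ ho

omit hK ho hA in
lemma mem_range_of_mem_largeSet {j : Fin n} (hj : j ∈ Kb ∪ largeSet A b c Kb σ ℓ β) :
    ∃ i, merge β i = j := by
  rcases Finset.mem_union.1 hj with hj | hj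
  · obtain ⟨i, rfl⟩ := hσ.2 j hj
    exact ⟨i, merge_of_mem hj⟩
  · rw [largeSet, Finset.mem_filter] at hj
    obtain ⟨-, hjK, hle⟩ := hj
    have hpos : (1 : ℝ) ≤ Fintype.card (Col Kb) := by
      have : Nonempty (Col Kb) := ⟨⟨j, hjK⟩⟩
      exact_mod_cast Fintype.card_pos
    by_contra hcon
    push Not at hcon
    rw [LP.basicSol_of_notMem] at hle
    · linarith
    · intro i hi
      exact hcon i (by rw [merge_of_notMem i, hi])

lemma GoodSet.union_largeSet : GoodSet A b c (Kb ∪ largeSet A b c Kb σ ℓ β) := by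
  have ht := optimalTableau_of_rounded hσ hℓ hβ.1 ho
  refine ⟨⟨merge β, ht.1, fun j hj => mem_range_of_mem_largeSet hσ hℓ h0 hβ hj⟩, ?_,
    Or.inr ht.2.not_unbounded⟩
  intro x hx j hj
  by_cases hjK : j ∈ Kb
  · exact hK.pos x hx j hjK
  have hj' := (Finset.mem_union.1 hj).resolve_left hjK
  rw [largeSet, Finset.mem_filter] at hj'
  obtain ⟨-, hjK, hle⟩ := hj'
  refine lt_of_le_of_ne (hx.1.2 j) fun hxj => ?_
  obtain ⟨h, hne, hM, hs, hv⟩ := LP.exists_kernel_of_large hℓ h0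
    (hσ.reduced_isTotallyUnimodular hA.1) (ho.isOptimal hβ.1 hβ.2) (hσ.feasible_restrict hx.1)
    hle hxj.symm
  exact hne (hK.dir_eq_zero hA hσ hx hM hs hv)

omit hA hK ho hσ in
lemma card_lt_card_union_largeSet : Kb.card < (Kb ∪ largeSet A b c Kb σ ℓ β).card := by
  have hfe := hβ.1.feasible hβ.2
  obtain ⟨j, hj⟩ := LP.exists_large hℓ h0 hfe
  have hmem : (j : Fin n) ∈ largeSet A b c Kb σ ℓ β := by
    rw [largeSet, Finset.mem_filter]
    exact ⟨Finset.mem_univ _, j.2, hj⟩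
  refine Finset.card_lt_card ((Finset.ssubset_iff_of_subset Finset.subset_union_left).2 ?_)
  exact ⟨(j : Fin n), Finset.mem_union_right _ hmem, j.2⟩

lemma infeasible_of_exhausted (hnot : ¬ IsOptimalBasis A b c (merge β))
    (hcard : (Kb ∪ largeSet A b c Kb σ ℓ β).card = m) : (original A b c).Infeasible := by
  have ht := optimalTableau_of_rounded hσ hℓ hβ.1 ho
  by_cases hopt : ∃ x, (original A b c).IsOptimal x
  · exfalso
    obtain ⟨x, hx⟩ := hopt
    have hG := GoodSet.union_largeSet hA hK hσ hℓ h0 hβ ho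
    set K' := Kb ∪ largeSet A b c Kb σ ℓ β with hK'
    have hpos : ∀ i, 0 < x (merge β i) := fun i => by
      apply hG.pos x hx
      have h1 : K' ⊆ Finset.univ.image (merge β) := fun j hj => by
        obtain ⟨i, rfl⟩ := mem_range_of_mem_largeSet hσ hℓ h0 hβ hj
        exact Finset.mem_image_of_mem _ (Finset.mem_univ i)
      have h2 : K' = Finset.univ.image (merge β) := Finset.eq_of_subset_of_card_le h1 (by
        rw [hcard]
        exact Finset.card_image_le.trans (by simp))
      rw [h2]
      exact Finset.mem_image_of_mem _ (Finset.mem_univ i)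
    set y := (original A b c).basicSol (merge β) with hy
    have hyx : (original A b c).M.mulVec (y - x) = 0 := by
      rw [Matrix.mulVec_sub, ht.1.mulVec_basicSol, hx.1.1, sub_self]
    have hv := ht.2.value_le hx.1
    have := hx.eq_zero_of_value_nonpos (fun z hz => hA.2.2 z x hz hx) hyx (fun j hj => by
      have : y j = 0 := by
        refine LP.basicSol_of_notMem _ fun i hi => ?_
        have := hpos i
        rw [hi, hj] at this
        exact lt_irrefl _ this
      simp [this, hj]) (by rw [LP.value_sub]; linarith)
    refine hnot ⟨ht.1, ?_⟩
    rw [← hy, sub_eq_zero.1 this]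
    exact hx
  · push Not at hopt
    exact (LP.infeasible_or_unbounded hopt).resolve_right ht.2.not_unbounded

omit hA hK h0 hβ in
lemma isOptimalBasis_iff (hβ : (rounded A b c Kb σ ℓ).IsBasis β) :
    IsOptimalBasis A b c (merge β) ↔ 0 ≤ (original A b c).basicVal (merge β) := by
  have ht := optimalTableau_of_rounded hσ hℓ hβ ho
  exact ⟨fun h => ht.1.nonneg_of_basicSol h.2.1.2, fun h => ⟨ht.1, ht.2.isOptimal ht.1 h⟩⟩

end

end

end PrimalTardos

namespace PrimalTardos

namespace LP

section
variable {ρ κ : Type} [Fintype ρ] [DecidableEq ρ] [Fintype κ] [DecidableEq κ] {P : LP ρ κ}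

/-- The ratio that bounds the number of pivots in an integral problem with a totally unimodular
matrix with `m` rows and a right-hand side bounded by `G`. -/
noncomputable def spread (m G : ℕ) : ℝ := if m = 1 then 1 else (m : ℝ) ^ 2 * G

lemma PivotPath.le_of_integral [Nonempty ρ] {β₀ β : ρ → κ} {T G : ℕ} (h : P.PivotPath β₀ T β)
    (h0 : P.IsFeasibleBasis β₀) (hM : P.M.IsTotallyUnimodular) (hnd : P.Nondegenerate)
    (hint : ∀ k, ∃ z : ℤ, P.rhs k = z) (hG : ∀ k, |P.rhs k| ≤ G) :
    T ≤ (Fintype.card κ - Fintype.card ρ) * stageLength (spread (Fintype.card ρ) G) := by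
  by_cases h1 : Fintype.card ρ = 1
  · obtain ⟨i₀, hi₀⟩ := Fintype.card_eq_one_iff.1 h1
    have hval : ∀ β, P.IsFeasibleBasis β → ∀ i, P.basicVal β i = |P.rhs i₀| := by
      intro β hβ i
      have h2 := congrFun hβ.1.mulVec_basicVal i₀
      have h3 : P.M i₀ (β i₀) * P.basicVal β i₀ = P.rhs i₀ := by
        rw [← h2, Matrix.mulVec, dotProduct, Finset.sum_eq_single i₀]
        · rfl
        · exact fun i _ hi => absurd (hi₀ i) hi
        · simp
      rw [hi₀ i]
      obtain ⟨a, ha⟩ := hM.apply i₀ (β i₀)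
      have hpos := hnd β hβ.1 hβ.2 i₀
      rw [← h3, abs_mul, abs_of_pos hpos, ← ha]
      have hdet := hβ.1
      rw [← ha] at h3
      cases a
      · exfalso
        simp only [SignType.zero_eq_zero, SignType.coe_zero, zero_mul] at h3 ha
        have : P.M.submatrix id β = 0 := by
          ext i j
          rw [hi₀ i, hi₀ j, Matrix.submatrix_apply, id, ← ha]; rfl
        rw [IsBasis, this, Matrix.det_zero] at hdet
        exact not_isUnit_zero hdet
      · simp
      · simp
    have hpos : 0 < |P.rhs i₀| := by
      rw [← hval _ h0 i₀]; exact hnd _ h0.1 h0.2 i₀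
    have := h.le_of_bounds h0 hpos fun β hβ i => ⟨(hval β hβ i).ge, (hval β hβ i).le⟩
    rwa [spread, if_pos h1, ← show (Fintype.card ρ : ℝ) * |P.rhs i₀| / |P.rhs i₀| = 1 by
      rw [h1, Nat.cast_one, one_mul, div_self hpos.ne']]
  · have := h.le_of_bounds (δ := 1) (γ := Fintype.card ρ * G) h0 one_pos fun β hβ i => by
      have hpos := hnd β hβ.1 hβ.2 i
      constructor
      · obtain ⟨z, hz⟩ := hβ.1.exists_int_basicVal hM hint i
        rw [hz] at hpos ⊢
        exact_mod_cast hpos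
      · refine (le_abs_self _).trans ((hβ.1.abs_basicVal_le hM i).trans ?_)
        calc ∑ k, |P.rhs k| ≤ ∑ _k : ρ, (G : ℝ) := Finset.sum_le_sum fun k _ => hG k
          _ = Fintype.card ρ * G := by simp
    rwa [spread, if_neg h1, sq, mul_assoc, ← div_one ((Fintype.card ρ : ℝ) * _)]

end

end LP

/-- The expression in the bound for the number of basic solutions. -/
def boundArg (m n : ℕ) : ℕ := m ^ 4 * n + m ^ 3 * n ^ 3 + m ^ 2

noncomputable def boundLog (m n : ℕ) : ℕ := ⌈(boundArg m n : ℝ) * Real.log (boundArg m n)⌉₊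

lemma three_le_boundArg {m n : ℕ} (hm : 1 ≤ m) (hn : 1 ≤ n) : 3 ≤ boundArg m n := by
  have h1 : 1 ≤ m ^ 4 * n := Nat.mul_pos (pow_pos hm 4) hn
  have h2 : 1 ≤ m ^ 3 * n ^ 3 := Nat.mul_pos (pow_pos hm 3) (pow_pos hn 3)
  have h3 : 1 ≤ m ^ 2 := Nat.one_le_pow _ _ hm
  unfold boundArg
  omega

lemma two_le_boundLog {m n : ℕ} (hm : 1 ≤ m) (hn : 1 ≤ n) : 2 ≤ boundLog m n := by
  have h3 : (3 : ℝ) ≤ boundArg m n := by exact_mod_cast three_le_boundArg hm hn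
  have h4 : 1 ≤ Real.log (boundArg m n) := by
    rw [Real.le_log_iff_exp_le (by linarith)]
    exact (Real.exp_one_lt_d9.le.trans (by norm_num)).trans h3
  have h5 : (2 : ℝ) ≤ boundLog m n := by
    refine le_trans ?_ (Nat.le_ceil _)
    nlinarith
  exact_mod_cast h5

lemma boundLog_le (m n : ℕ) : boundLog m n ≤ boundArg m n ^ 2 := by
  rw [boundLog, Nat.ceil_le]
  push_cast
  rw [sq]
  exact mul_le_mul_of_nonneg_left (Real.log_le_self (Nat.cast_nonneg _)) (Nat.cast_nonneg _)

lemma stageLength_spread_le {m n m' n' : ℕ} (hm' : 1 ≤ m') (hmn : m' ≤ n') (hm : m' ≤ m)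
    (hn : n' ≤ n) :
    LP.stageLength (LP.spread m' (n' * (m' + n' ^ 2))) ≤ boundLog m n := by
  have hm1 : 1 ≤ m := hm'.trans hm
  have hn1 : 1 ≤ n := (hm'.trans hmn).trans hn
  have h3 : (3 : ℝ) ≤ boundArg m n := by exact_mod_cast three_le_boundArg hm1 hn1
  have key : 1 ≤ LP.spread m' (n' * (m' + n' ^ 2)) ∧
      2 * LP.spread m' (n' * (m' + n' ^ 2)) + 1 ≤ boundArg m n := by
    rw [LP.spread]
    split_ifs with h1
    · exact ⟨le_rfl, by linarith⟩
    · have h2 : 2 ≤ m' := by omega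
      constructor
      · have : 1 ≤ m' ^ 2 * (n' * (m' + n' ^ 2)) :=
          Nat.mul_pos (by positivity) (Nat.mul_pos (by omega) (by positivity))
        exact_mod_cast this
      · have : 2 * (m' ^ 2 * (n' * (m' + n' ^ 2))) + 1 ≤ boundArg m n := by
          have h4 : m' ^ 2 * (n' * (m' + n' ^ 2)) ≤ m ^ 2 * (n * (m + n ^ 2)) := by gcongr
          have h5 : 2 * (m ^ 2 * (n * (m + n ^ 2))) ≤ m * (m ^ 2 * (n * (m + n ^ 2))) :=
            Nat.mul_le_mul_right _ (h2.trans hm)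
          have h6 : boundArg m n = m * (m ^ 2 * (n * (m + n ^ 2))) + m ^ 2 := by
            unfold boundArg; ring
          have h7 : 1 ≤ m ^ 2 := Nat.one_le_pow _ _ hm1
          omega
        exact_mod_cast this
  rw [LP.stageLength, boundLog]
  refine Nat.ceil_le_ceil ?_
  have h8 : Real.log (2 * LP.spread m' (n' * (m' + n' ^ 2)) + 1) ≤ Real.log (boundArg m n) :=
    Real.log_le_log (by linarith [key.1]) key.2
  exact mul_le_mul (by linarith [key.1, key.2]) h8 (Real.log_nonneg (by linarith [key.1]))
    (Nat.cast_nonneg _)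

/-! ## Runs of the algorithm -/

section
variable {m n : ℕ} {A : Matrix (Fin m) (Fin n) ℝ} {b : Fin m → ℝ} {c : Fin n → ℝ}

/-- What is known when a rounded problem is solved. -/
structure Context (A : Matrix (Fin m) (Fin n) ℝ) (b : Fin m → ℝ) (c : Fin n → ℝ)
    (Kb : Finset (Fin n)) (σ : Fin m → Fin n) (ℓ : Row Kb σ → Col Kb) : Prop where
  good : GoodSet A b c Kb
  ext : Extends A Kb σ
  basis : (reduced A b c Kb σ).IsBasis ℓ
  ne_zero : (reduced A b c Kb σ).basicVal ℓ ≠ 0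
  nondeg₁ : (rounded A b c Kb σ ℓ).phaseOne.Nondegenerate
  nondeg₂ : (rounded A b c Kb σ ℓ).Nondegenerate

section
variable {Kb : Finset (Fin n)} {σ : Fin m → Fin n} {ℓ : Row Kb σ → Col Kb}

lemma Context.one_le_card_row (h : Context A b c Kb σ ℓ) : 1 ≤ Fintype.card (Row Kb σ) :=
  LP.card_rows_pos h.basis h.ne_zero

lemma Context.card_row_le (h : Context A b c Kb σ ℓ) :
    Fintype.card (Row Kb σ) ≤ Fintype.card (Col Kb) :=
  LP.card_rows_le_card_cols h.basis h.ne_zero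

lemma Context.card_lt (h : Context A b c Kb σ ℓ) : Kb.card < m := by
  have := h.one_le_card_row
  have := h.ext.card_row
  omega

lemma Context.isTotallyUnimodular (hA : Admissible A b c) (h : Context A b c Kb σ ℓ) :
    (rounded A b c Kb σ ℓ).M.IsTotallyUnimodular :=
  h.basis.roundedOf_isTotallyUnimodular (h.ext.reduced_isTotallyUnimodular hA.1)

lemma Context.abs_rhs_le (hA : Admissible A b c) (h : Context A b c Kb σ ℓ) (k : Row Kb σ) :
    |(rounded A b c Kb σ ℓ).rhs k| ≤ ((Fintype.card (Col Kb) *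
      (Fintype.card (Row Kb σ) + Fintype.card (Col Kb) ^ 2) : ℕ) : ℝ) := by
  have := LP.abs_rounded_rhs_le h.basis h.ne_zero (h.ext.reduced_isTotallyUnimodular hA.1) k
  change |((⌈(reduced A b c Kb σ).basicVal ℓ k / scale (reduced A b c Kb σ)⌉ : ℤ) : ℝ)| ≤ _
  exact_mod_cast this

lemma Context.stageLength_le (h : Context A b c Kb σ ℓ) :
    LP.stageLength (LP.spread (Fintype.card (Row Kb σ)) (Fintype.card (Col Kb) *
      (Fintype.card (Row Kb σ) + Fintype.card (Col Kb) ^ 2))) ≤ boundLog m n := by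
  have h1 := h.ext.card_row
  have h2 : Fintype.card (Col Kb) + Kb.card = n := card_col
  exact stageLength_spread_le h.one_le_card_row h.card_row_le (by omega) (by omega)

lemma Context.phaseOne_length (hA : Admissible A b c) (h : Context A b c Kb σ ℓ) {T : ℕ}
    {β : Row Kb σ → Col Kb ⊕ Row Kb σ}
    (hp : (rounded A b c Kb σ ℓ).phaseOne.PivotPath Sum.inr T β) : T ≤ n * boundLog m n := by
  have hne := LP.nonempty_rows h.basis h.ne_zero
  have h1 := hp.le_of_integral (LP.phaseOne_isFeasibleBasis _)
    (LP.phaseOne_isTotallyUnimodular (h.isTotallyUnimodular hA)) h.nondeg₁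
    (fun k => ⟨|⌈(reduced A b c Kb σ).basicVal ℓ k / scale (reduced A b c Kb σ)⌉|, by
      rw [Int.cast_abs]; rfl⟩)
    (fun k => (abs_abs _).le.trans (h.abs_rhs_le hA k))
  have h2 : Fintype.card (Col Kb) + Kb.card = n := card_col
  rw [Fintype.card_sum, Nat.add_sub_cancel] at h1
  exact h1.trans (Nat.mul_le_mul (by omega) h.stageLength_le)

lemma Context.phaseTwo_length (hA : Admissible A b c) (h : Context A b c Kb σ ℓ) {T : ℕ}
    {β₀ β : Row Kb σ → Col Kb} (h0 : (rounded A b c Kb σ ℓ).IsFeasibleBasis β₀)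
    (hp : (rounded A b c Kb σ ℓ).PivotPath β₀ T β) : T ≤ (n - 1) * boundLog m n := by
  have hne := LP.nonempty_rows h.basis h.ne_zero
  have h1 := hp.le_of_integral h0 (h.isTotallyUnimodular hA) h.nondeg₂
    (fun k => ⟨⌈(reduced A b c Kb σ).basicVal ℓ k / scale (reduced A b c Kb σ)⌉, rfl⟩)
    (h.abs_rhs_le hA)
  have h2 : Fintype.card (Col Kb) + Kb.card = n := card_col
  have h3 := h.one_le_card_row
  exact h1.trans (Nat.mul_le_mul (by omega) h.stageLength_le)

lemma Context.two_le_boundLog (h : Context A b c Kb σ ℓ) : 2 ≤ boundLog m n ∧ 1 ≤ n := by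
  have h1 := h.one_le_card_row
  have h2 := h.card_row_le
  have h3 : Fintype.card (Col Kb) + Kb.card = n := card_col
  have h4 := h.card_lt
  exact ⟨PrimalTardos.two_le_boundLog (by omega) (by omega), by omega⟩

/-- The number of basic solutions for one rounded problem. -/
lemma Context.total_length (hA : Admissible A b c) (h : Context A b c Kb σ ℓ) {T : ℕ}
    {β₀ β : Row Kb σ → Col Kb} (h0 : (rounded A b c Kb σ ℓ).IsFeasibleBasis β₀)
    (hp : (rounded A b c Kb σ ℓ).PivotPath β₀ T β) :
    n * boundLog m n + 1 + T + 1 ≤ 2 * n * boundLog m n := by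
  have h1 := h.phaseTwo_length hA h0 hp
  obtain ⟨h2, h3⟩ := h.two_le_boundLog
  obtain ⟨n', rfl⟩ : ∃ n', n = n' + 1 := ⟨n - 1, by omega⟩
  rw [Nat.add_sub_cancel] at h1
  nlinarith

end

lemma GoodSet.card_le {Kb : Finset (Fin n)} (h : GoodSet A b c Kb) : Kb.card ≤ m ∧ m ≤ n := by
  obtain ⟨τ, hτ⟩ := h.extends_
  have h1 := hτ.card_row
  have h2 := Fintype.card_le_of_injective _ (hτ.isBasis (b := b) (c := c)).injective
  simp only [Fintype.card_fin] at h2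
  exact ⟨by omega, h2⟩

lemma GoodSet.card_compl_eq_iff {Kb : Finset (Fin n)} (h : GoodSet A b c Kb) :
    Kbᶜ.card = n - m ↔ Kb.card = m := by
  have h1 := h.card_le
  have h2 : Kb.card ≤ n := by simpa using Kb.card_le_univ
  rw [Finset.card_compl, Fintype.card_fin]
  omega

/-- The invariant of a run with `R` rounded problems, `B` basic solutions and `N` configurations,
by the last configuration. -/
def RunInv (A : Matrix (Fin m) (Fin n) ℝ) (b : Fin m → ℝ) (c : Fin n → ℝ) (R B N : ℕ) :
    Config ℝ m n → Prop
  | .start Kb => GoodSet A b c Kb ∧ R ≤ Kb.card ∧ B ≤ R * (2 * n * boundLog m n) ∧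
      N = B + 2 * R + 1
  | .roundedProblem Kb σ ℓ => Context A b c Kb σ ℓ ∧ ∃ r ≤ Kb.card, R = r + 1 ∧
      B ≤ r * (2 * n * boundLog m n) ∧ N = B + 2 * R
  | .phaseOne Kb σ ℓ β => Context A b c Kb σ ℓ ∧ ∃ r ≤ Kb.card, R = r + 1 ∧ N = B + 2 * R ∧
      ∃ T, (rounded A b c Kb σ ℓ).phaseOne.PivotPath Sum.inr T β ∧
        B ≤ r * (2 * n * boundLog m n) + T + 1
  | .phaseTwo Kb σ ℓ β => Context A b c Kb σ ℓ ∧ ∃ r ≤ Kb.card, R = r + 1 ∧ N = B + 2 * R ∧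
      ∃ T β₀, (rounded A b c Kb σ ℓ).IsFeasibleBasis β₀ ∧
        (rounded A b c Kb σ ℓ).PivotPath β₀ T β ∧
        B ≤ r * (2 * n * boundLog m n) + (n * boundLog m n + 1) + T + 1
  | .halt o => Correct A b c o ∧ R ≤ m ∧ B ≤ R * (2 * n * boundLog m n) ∧ N ≤ B + 2 * R + 2

/-- The invariant is preserved. -/
lemma RunInv.step (hA : Admissible A b c) {R B N : ℕ} {s s' : Config ℝ m n}
    (h : RunInv A b c R B N s) (hs : Step A b c s s')
    (hnd : ∀ Kb σ ℓ, s' = .roundedProblem Kb σ ℓ →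
      (rounded A b c Kb σ ℓ).phaseOne.Nondegenerate ∧ (rounded A b c Kb σ ℓ).Nondegenerate) :
    RunInv A b c (R + if s'.isRounded then 1 else 0) (B + if s'.isBasicSolution then 1 else 0)
      (N + 1) s' := by
  cases hs with
  | zeroRhs Kb σ ℓ hσ hℓ h0 =>
    obtain ⟨hK, hR, hB, hN⟩ := h
    have := hK.card_le
    refine ⟨correct_zeroRhs hA hK hσ hℓ h0, ?_, ?_, ?_⟩ <;>
      simp only [Config.isRounded, Config.isBasicSolution] <;> simp <;> omega
  | round Kb σ ℓ hσ hℓ h0 =>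
    obtain ⟨hK, hR, hB, hN⟩ := h
    obtain ⟨h1, h2⟩ := hnd Kb σ ℓ rfl
    refine ⟨⟨hK, hσ, hℓ, h0, h1, h2⟩, R, hR, ?_, ?_, ?_⟩ <;>
      simp only [Config.isRounded, Config.isBasicSolution] <;> simp <;> omega
  | phaseOneInit Kb σ ℓ =>
    obtain ⟨hC, r, hr, hR, hB, hN⟩ := h
    refine ⟨hC, r, hr, ?_, ?_, 0, .refl, ?_⟩ <;>
      simp only [Config.isRounded, Config.isBasicSolution] <;> simp <;> omega
  | phaseOnePivot Kb σ ℓ β β' hp =>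
    obtain ⟨hC, r, hr, hR, hN, T, hT, hB⟩ := h
    refine ⟨hC, r, hr, ?_, ?_, T + 1, hT.snoc hp, ?_⟩ <;>
      simp only [Config.isRounded, Config.isBasicSolution] <;> simp <;> omega
  | infeasible Kb σ ℓ β ho hpos =>
    obtain ⟨hC, r, hr, hR, hN, T, hT, hB⟩ := h
    have h1 := hC.card_lt
    have h2 := hC.phaseOne_length hA hT
    obtain ⟨h3, h4⟩ := hC.two_le_boundLog
    have h5 : n * boundLog m n + 1 ≤ 2 * n * boundLog m n := by nlinarith
    have h6 : (r + 1) * (2 * n * boundLog m n) =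
      r * (2 * n * boundLog m n) + 2 * n * boundLog m n := by ring
    refine ⟨infeasible_of_rounded hC.ext hC.basis hC.ne_zero (LP.infeasible_of_phaseOne ho hpos),
      ?_, ?_, ?_⟩ <;>
      simp only [Config.isRounded, Config.isBasicSolution] <;> simp <;> subst hR <;> omega
  | phaseTwoInit Kb σ ℓ β ho =>
    obtain ⟨hC, r, hr, hR, hN, T, hT, hB⟩ := h
    have h2 := hC.phaseOne_length hA hT
    refine ⟨hC, r, hr, ?_, ?_, 0, β, LP.isFeasibleBasis_of_phaseOne
      (hT.isFeasibleBasis (LP.phaseOne_isFeasibleBasis _)), .refl, ?_⟩ <;>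
      simp only [Config.isRounded, Config.isBasicSolution] <;> simp <;> omega
  | phaseTwoPivot Kb σ ℓ β β' hp =>
    obtain ⟨hC, r, hr, hR, hN, T, β₀, h0, hT, hB⟩ := h
    refine ⟨hC, r, hr, ?_, ?_, T + 1, β₀, h0, hT.snoc hp, ?_⟩ <;>
      simp only [Config.isRounded, Config.isBasicSolution] <;> simp <;> omega
  | unbounded Kb σ ℓ β hu =>
    obtain ⟨hC, r, hr, hR, hN, T, β₀, h0, hT, hB⟩ := h
    have h1 := hC.card_lt
    have h2 := hC.total_length hA h0 hT
    have h6 : (r + 1) * (2 * n * boundLog m n) =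
      r * (2 * n * boundLog m n) + 2 * n * boundLog m n := by ring
    refine ⟨LP.infeasible_or_unbounded (not_optimal_of_rounded_unbounded hC.good hC.ext hC.basis
      (hT.isFeasibleBasis h0).1 hu), ?_, ?_, ?_⟩ <;>
      simp only [Config.isRounded, Config.isBasicSolution] <;> simp <;> subst hR <;> omega
  | optimal Kb σ ℓ β ho hopt =>
    obtain ⟨hC, r, hr, hR, hN, T, β₀, h0, hT, hB⟩ := h
    have h1 := hC.card_lt
    have h2 := hC.total_length hA h0 hT
    have h6 : (r + 1) * (2 * n * boundLog m n) =
      r * (2 * n * boundLog m n) + 2 * n * boundLog m n := by ring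
    refine ⟨hopt.2, ?_, ?_, ?_⟩ <;>
      simp only [Config.isRounded, Config.isBasicSolution] <;> simp <;> subst hR <;> omega
  | exhausted Kb σ ℓ β ho hopt hcard =>
    obtain ⟨hC, r, hr, hR, hN, T, β₀, h0, hT, hB⟩ := h
    have h1 := hC.card_lt
    have h2 := hC.total_length hA h0 hT
    have h6 : (r + 1) * (2 * n * boundLog m n) =
      r * (2 * n * boundLog m n) + 2 * n * boundLog m n := by ring
    have hβ := hT.isFeasibleBasis h0
    have hG := hC.good.union_largeSet hA hC.ext hC.basis hC.ne_zero hβ ho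
    refine ⟨infeasible_of_exhausted hA hC.good hC.ext hC.basis hC.ne_zero hβ ho hopt
      (hG.card_compl_eq_iff.1 hcard), ?_, ?_, ?_⟩ <;>
      simp only [Config.isRounded, Config.isBasicSolution] <;> simp <;> subst hR <;> omega
  | iterate Kb σ ℓ β ho hopt hcard =>
    obtain ⟨hC, r, hr, hR, hN, T, β₀, h0, hT, hB⟩ := h
    have h1 := hC.card_lt
    have h2 := hC.total_length hA h0 hT
    have h6 : (r + 1) * (2 * n * boundLog m n) =
      r * (2 * n * boundLog m n) + 2 * n * boundLog m n := by ring
    have hβ := hT.isFeasibleBasis h0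
    have h7 := card_lt_card_union_largeSet hC.basis hC.ne_zero hβ
    refine ⟨hC.good.union_largeSet hA hC.ext hC.basis hC.ne_zero hβ ho, ?_, ?_, ?_⟩ <;>
      simp only [Config.isRounded, Config.isBasicSolution] <;> simp <;> subst hR <;> omega

/-- The algorithm never gets stuck. -/
lemma RunInv.exists_step {R B N : ℕ} {s : Config ℝ m n}
    (h : RunInv A b c R B N s) : (∃ o, s = .halt o) ∨ ∃ s', Step A b c s s' := by
  cases s with
  | halt o => exact Or.inl ⟨o, rfl⟩
  | start Kb =>
    obtain ⟨σ, hσ⟩ := h.1.extends_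
    by_cases h0 : (reduced A b c Kb σ).basicVal (restBasis Kb σ) = 0
    · exact Or.inr ⟨_, .zeroRhs Kb σ _ hσ hσ.restBasis_isBasis h0⟩
    · exact Or.inr ⟨_, .round Kb σ _ hσ hσ.restBasis_isBasis h0⟩
  | roundedProblem Kb σ ℓ => exact Or.inr ⟨_, .phaseOneInit Kb σ ℓ⟩
  | phaseOne Kb σ ℓ β =>
    obtain ⟨hC, r, hr, hR, hN, T, hT, hB⟩ := h
    have hβ := hT.isFeasibleBasis (LP.phaseOne_isFeasibleBasis _)
    rcases (rounded A b c Kb σ ℓ).phaseOne.optimal_or_unbounded_or_pivot β with ho | hu | ⟨β', hp⟩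
    · rcases lt_or_ge 0 ((rounded A b c Kb σ ℓ).phaseOne.value
        ((rounded A b c Kb σ ℓ).phaseOne.basicSol β)) with hpos | hle
      · exact Or.inr ⟨_, .infeasible Kb σ ℓ β ho hpos⟩
      · have hl := LP.isLeft_of_phaseOne_value hβ hC.nondeg₁ hle
        obtain ⟨β', rfl⟩ : ∃ β', β = Sum.inl ∘ β' := ⟨fun i => (β i).getLeft (hl i), by
          funext i; simp⟩
        exact Or.inr ⟨_, .phaseTwoInit Kb σ ℓ β' ho⟩
    · exact absurd hu (LP.phaseOne_not_unboundedTableau hβ.1)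
    · exact Or.inr ⟨_, .phaseOnePivot Kb σ ℓ β β' hp⟩
  | phaseTwo Kb σ ℓ β =>
    rcases (rounded A b c Kb σ ℓ).optimal_or_unbounded_or_pivot β with ho | hu | ⟨β', hp⟩
    · by_cases hopt : IsOptimalBasis A b c (merge β)
      · exact Or.inr ⟨_, .optimal Kb σ ℓ β ho hopt⟩
      · by_cases hcard : ((Kb ∪ largeSet A b c Kb σ ℓ β)ᶜ).card = n - m
        · exact Or.inr ⟨_, .exhausted Kb σ ℓ β ho hopt hcard⟩
        · exact Or.inr ⟨_, .iterate Kb σ ℓ β ho hopt hcard⟩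
    · exact Or.inr ⟨_, .unbounded Kb σ ℓ β hu⟩
    · exact Or.inr ⟨_, .phaseTwoPivot Kb σ ℓ β β' hp⟩

lemma RunInv.bounds (hA : Admissible A b c) {R B N : ℕ} {s : Config ℝ m n}
    (h : RunInv A b c R B N s) :
    R ≤ m ∧ B ≤ R * (2 * n * boundLog m n) ∧ N ≤ B + 2 * R + 2 := by
  cases s with
  | halt o => exact h.2
  | start Kb =>
    obtain ⟨hK, hR, hB, hN⟩ := h
    have := hK.card_le
    exact ⟨by omega, hB, by omega⟩
  | roundedProblem Kb σ ℓ =>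
    obtain ⟨hC, r, hr, rfl, hB, hN⟩ := h
    have := hC.card_lt
    exact ⟨by omega, hB.trans (Nat.mul_le_mul_right _ (by omega)), by omega⟩
  | phaseOne Kb σ ℓ β =>
    obtain ⟨hC, r, hr, rfl, hN, T, hT, hB⟩ := h
    have := hC.card_lt
    have h2 := hC.phaseOne_length hA hT
    obtain ⟨h3, h4⟩ := hC.two_le_boundLog
    have h5 : n * boundLog m n + 1 ≤ 2 * n * boundLog m n := by nlinarith
    have h6 : (r + 1) * (2 * n * boundLog m n) =
      r * (2 * n * boundLog m n) + 2 * n * boundLog m n := by ring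
    exact ⟨by omega, by omega, by omega⟩
  | phaseTwo Kb σ ℓ β =>
    obtain ⟨hC, r, hr, rfl, hN, T, β₀, h0, hT, hB⟩ := h
    have := hC.card_lt
    have h2 := hC.total_length hA h0 hT
    have h6 : (r + 1) * (2 * n * boundLog m n) =
      r * (2 * n * boundLog m n) + 2 * n * boundLog m n := by ring
    exact ⟨by omega, by omega, by omega⟩

lemma IsRun.inv (hA : Admissible A b c) (run : List (Config ℝ m n)) (hrun : IsRun A b c run)
    (hnd : AuxNondegenerate A b c run) :
    ∃ s, run.getLast? = some s ∧ RunInv A b c (run.countP Config.isRounded)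
      (run.countP Config.isBasicSolution) run.length s ∧
      ∀ o, Config.halt o ∈ run → Correct A b c o := by
  induction run using List.reverseRecOn with
  | nil => simp [IsRun] at hrun
  | append_singleton l s ih =>
    refine ⟨s, by simp, ?_⟩
    rcases List.eq_nil_or_concat l with rfl | ⟨l', s₀, rfl⟩
    · have hs : s = .start ∅ := by simpa [IsRun] using hrun.1
      subst hs
      refine ⟨⟨goodSet_empty hA, ?_, ?_, ?_⟩, ?_⟩ <;> simp [Config.isRounded, Config.isBasicSolution]
    · simp only [List.concat_eq_append] at *
      have hch := List.isChain_append.1 hrun.2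
      obtain ⟨s₁, hs₁, hinv, hcor⟩ := ih ⟨by
        have := hrun.1
        rw [List.head?_append_of_ne_nil _ (by simp)] at this
        exact this, hch.1⟩
        fun Kb σ ℓ h => hnd Kb σ ℓ (List.mem_append_left _ h)
      have hstep : Step A b c s₁ s := hch.2.2 s₁ hs₁ s (by simp)
      have hinv' := hinv.step hA hstep fun Kb σ ℓ h => hnd Kb σ ℓ (by simp [h])
      have hinv'' : RunInv A b c ((l' ++ [s₀] ++ [s]).countP Config.isRounded)
          ((l' ++ [s₀] ++ [s]).countP Config.isBasicSolution)
          (l' ++ [s₀] ++ [s]).length s := by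
        rw [List.countP_append (l₁ := l' ++ [s₀]), List.countP_append (l₁ := l' ++ [s₀]),
          List.length_append (as := l' ++ [s₀]),
          List.countP_singleton, List.countP_singleton, List.length_singleton]
        exact hinv'
      refine ⟨hinv'', fun o ho => ?_⟩
      rcases List.mem_append.1 ho with ho | ho
      · exact hcor o ho
      · obtain rfl : Config.halt o = s := by simpa using ho
        exact hinv'.1

lemma boundArg_cast (m n : ℕ) : (boundArg m n : ℝ) =
    (m : ℝ) ^ 4 * n + (m : ℝ) ^ 3 * (n : ℝ) ^ 3 + (m : ℝ) ^ 2 := by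
  simp [boundArg]

lemma boundLog_cast (m n : ℕ) : (boundLog m n : ℝ) =
    (⌈((m : ℝ) ^ 4 * n + (m : ℝ) ^ 3 * (n : ℝ) ^ 3 + (m : ℝ) ^ 2) *
      Real.log ((m : ℝ) ^ 4 * n + (m : ℝ) ^ 3 * (n : ℝ) ^ 3 + (m : ℝ) ^ 2)⌉ : ℝ) := by
  rw [← boundArg_cast, boundLog]
  exact natCast_ceil_eq_intCast_ceil
    (mul_nonneg (Nat.cast_nonneg _) (Real.log_natCast_nonneg _))

theorem run_bounds (hA : Admissible A b c) (run : List (Config ℝ m n)) (hrun : IsRun A b c run)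
    (hnd : AuxNondegenerate A b c run) :
    run.countP Config.isRounded ≤ m ∧
    (run.countP Config.isBasicSolution : ℝ) ≤
      2 * m * n * ⌈((m : ℝ) ^ 4 * n + (m : ℝ) ^ 3 * (n : ℝ) ^ 3 + (m : ℝ) ^ 2) *
        Real.log ((m : ℝ) ^ 4 * n + (m : ℝ) ^ 3 * (n : ℝ) ^ 3 + (m : ℝ) ^ 2)⌉ ∧
    run.length ≤ run.countP Config.isBasicSolution + 2 * m + 2 ∧
    (∀ s, run.getLast? = some s → (∃ o, s = .halt o) ∨ ∃ s', Step A b c s s') ∧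
    (∀ o, Config.halt o ∈ run → Correct A b c o) := by
  obtain ⟨s, hs, hinv, hcor⟩ := hrun.inv hA run hnd
  obtain ⟨h1, h2, h3⟩ := hinv.bounds hA
  refine ⟨h1, ?_, by omega, fun s' hs' => ?_, hcor⟩
  · rw [← boundLog_cast]
    have : run.countP Config.isBasicSolution ≤ m * (2 * n * boundLog m n) :=
      h2.trans (Nat.mul_le_mul_right _ h1)
    calc (run.countP Config.isBasicSolution : ℝ) ≤ ((m * (2 * n * boundLog m n) : ℕ) : ℝ) := by
          exact_mod_cast this
      _ = 2 * m * n * boundLog m n := by push_cast; ring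
  · obtain rfl : s = s' := by rw [hs] at hs'; exact Option.some.inj hs'
    exact hinv.exists_step

theorem run_order (hA : Admissible A b c) (hn : 2 ≤ n) (run : List (Config ℝ m n))
    (hrun : IsRun A b c run) (hnd : AuxNondegenerate A b c run) :
    (run.countP Config.isBasicSolution : ℝ) ≤ 52 * ((m : ℝ) ^ 4 * (n : ℝ) ^ 4 * Real.log n) := by
  have h1 := (run_bounds hA run hrun hnd).2.1
  rw [← boundLog_cast] at h1
  rcases Nat.eq_zero_or_pos m with rfl | hm
  · simpa using h1
  refine h1.trans ?_
  have hmn : m ≤ n := (goodSet_empty hA).card_le.2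
  have hX : boundArg m n ≤ 3 * (m ^ 3 * n ^ 3) := by
    have e1 : m ^ 4 * n ≤ m ^ 3 * n ^ 3 := by
      calc m ^ 4 * n = m ^ 3 * (m * n) := by ring
        _ ≤ m ^ 3 * (n ^ 2 * n) := by gcongr; nlinarith
        _ = m ^ 3 * n ^ 3 := by ring
    have e2 : m ^ 2 ≤ m ^ 3 * n ^ 3 := by
      calc m ^ 2 = m ^ 2 * 1 := by ring
        _ ≤ m ^ 3 * n ^ 3 := Nat.mul_le_mul (Nat.pow_le_pow_right hm (by norm_num))
            (Nat.one_le_pow _ _ (by omega))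
    unfold boundArg
    omega
  have hX' : boundArg m n ≤ n ^ 8 := by
    calc boundArg m n ≤ 3 * (m ^ 3 * n ^ 3) := hX
      _ ≤ n ^ 2 * (n ^ 3 * n ^ 3) := by gcongr; nlinarith
      _ = n ^ 8 := by ring
  have hX1 : 1 ≤ boundArg m n := by
    have := three_le_boundArg hm (by omega : 1 ≤ n); omega
  have hlogX : Real.log (boundArg m n) ≤ 8 * Real.log n := by
    have h8 : (8 : ℝ) * Real.log n = Real.log ((n : ℝ) ^ 8) := by rw [Real.log_pow]; norm_num
    rw [h8]
    exact Real.log_le_log (by exact_mod_cast hX1) (by exact_mod_cast hX')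
  have hlog0 : 0 ≤ Real.log (boundArg m n) := Real.log_natCast_nonneg _
  have hlogn : (1 : ℝ) / 2 ≤ Real.log n := by
    have h2 : Real.log 2 ≤ Real.log n := Real.log_le_log (by norm_num) (by exact_mod_cast hn)
    have := Real.log_two_gt_d9
    linarith
  have hmn1 : (1 : ℝ) ≤ (m : ℝ) ^ 3 * (n : ℝ) ^ 3 := by
    have : 1 ≤ m ^ 3 * n ^ 3 := Nat.mul_pos (pow_pos hm 3) (pow_pos (by omega) 3)
    exact_mod_cast this
  have hL : (boundLog m n : ℝ) ≤ 26 * ((m : ℝ) ^ 3 * (n : ℝ) ^ 3) * Real.log n := by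
    have e1 : (boundLog m n : ℝ) < boundArg m n * Real.log (boundArg m n) + 1 :=
      Nat.ceil_lt_add_one (mul_nonneg (Nat.cast_nonneg _) hlog0)
    have e2 : (boundArg m n : ℝ) ≤ 3 * ((m : ℝ) ^ 3 * (n : ℝ) ^ 3) := by exact_mod_cast hX
    have e3 : (boundArg m n : ℝ) * Real.log (boundArg m n) ≤
        3 * ((m : ℝ) ^ 3 * (n : ℝ) ^ 3) * (8 * Real.log n) :=
      mul_le_mul e2 hlogX hlog0 (by positivity)
    nlinarith
  calc 2 * (m : ℝ) * n * boundLog m n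
      ≤ 2 * m * n * (26 * ((m : ℝ) ^ 3 * (n : ℝ) ^ 3) * Real.log n) :=
        mul_le_mul_of_nonneg_left hL (by positivity)
    _ = 52 * ((m : ℝ) ^ 4 * (n : ℝ) ^ 4 * Real.log n) := by ring

end

end PrimalTardos

namespace PrimalTardos

namespace Prog

/-! ## Costs and sizes of programs -/

section
variable {α β : Type}

lemma result_bind (p : Prog ℝ α) (f : α → Prog ℝ β) :
    (p >>= f).result = (f p.result).result := by
  change (p.bind f).result = _
  induction p with
  | ret a => rfl
  | load z k ih => exact ih _
  | arith o x y k ih => exact ih _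
  | lt x y k ih => exact ih _

lemma cost_bind (p : Prog ℝ α) (f : α → Prog ℝ β) :
    (p >>= f).cost = p.cost + (f p.result).cost := by
  change (p.bind f).cost = _
  induction p with
  | ret a => simp [bind, cost, result]
  | load z k ih => simp only [bind, cost, result, ih]; omega
  | arith o x y k ih => simp only [bind, cost, result, ih]; omega
  | lt x y k ih => simp only [bind, cost, result, ih]; omega

lemma values_bind (p : Prog ℝ α) (f : α → Prog ℝ β) :
    (p >>= f).values = p.values ++ (f p.result).values := by
  change (p.bind f).values = _
  induction p with
  | ret a => simp [bind, values, result]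
  | load z k ih => simp only [bind, values, result, ih, List.cons_append]
  | arith o x y k ih => simp only [bind, values, result, ih, List.cons_append]
  | lt x y k ih => simp only [bind, values, result, ih]

/-- The program takes at most `c` operations, produces only numbers in `V`, and its result
satisfies `Q`. -/
structure Spec (V : ℝ → Prop) (c : ℕ) (p : Prog ℝ α) (Q : α → Prop) : Prop where
  cost_le : p.cost ≤ c
  values : ∀ v ∈ p.values, V v
  post : Q p.result

variable {V : ℝ → Prop} {c d : ℕ} {p : Prog ℝ α} {f : α → Prog ℝ β} {Q Q' : α → Prop}
  {R : β → Prop}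

lemma Spec.mono (h : Spec V c p Q) (hc : c ≤ d) (hQ : ∀ a, Q a → Q' a) : Spec V d p Q' :=
  ⟨h.1.trans hc, h.2, hQ _ h.3⟩

lemma Spec.ret {a : α} (h : Q a) : Spec V c (ret a) Q :=
  ⟨by simp [cost], by simp [Prog.values], h⟩

lemma Spec.pure {a : α} (h : Q a) : Spec V c (Pure.pure a) Q := Spec.ret h

lemma Spec.bind (hp : Spec V c p Q) (hf : ∀ a, Q a → Spec V d (f a) R) :
    Spec V (c + d) (p >>= f) R := by
  have h := hf _ hp.3
  refine ⟨?_, fun v hv => ?_, ?_⟩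
  · rw [cost_bind]; exact Nat.add_le_add hp.1 h.1
  · rw [values_bind] at hv
    exact (List.mem_append.1 hv).elim (hp.2 v) (h.2 v)
  · rw [result_bind]; exact h.3

lemma Spec.tabFin : ∀ {k : ℕ} {f : Fin k → Prog ℝ α} {Q : Fin k → α → Prop},
    (∀ i, Spec V c (f i) (Q i)) → Spec V (k * c) (tabFin k f) fun g => ∀ i, Q i (g i)
  | 0, _, _, _ => Spec.pure fun i => i.elim0
  | k + 1, f, Q, h => by
    have e : c + (k * c + 0) ≤ (k + 1) * c := by rw [Nat.succ_mul]; omega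
    refine (Spec.bind (h 0) fun a ha => Spec.bind (Spec.tabFin fun i => h i.succ)
      fun r hr => Spec.pure fun i => ?_).mono e fun _ h => h
    refine Fin.cases ?_ (fun i => ?_) i
    · simpa using ha
    · simpa using hr i

lemma Spec.tab {ι : Type} [FinEnum ι] {f : ι → Prog ℝ α} {Q : ι → α → Prop}
    (h : ∀ i, Spec V c (f i) (Q i)) :
    Spec V (FinEnum.card ι * c) (tab f) fun g => ∀ i, Q i (g i) := by
  rw [← Nat.add_zero (_ * c)]
  refine Spec.bind (Spec.tabFin fun i => h (FinEnum.equiv.symm i)) fun g hg =>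
    Spec.pure fun i => ?_
  simpa using hg (FinEnum.equiv i)

lemma Spec.sumList {ι : Type} {f : ι → Prog ℝ ℝ} {g : ι → ℝ} : ∀ {l : List ι} {acc : ℝ},
    (∀ i ∈ l, Spec V c (f i) (· = g i)) →
    (∀ l', l' <+: l → V (acc + (l'.map g).sum)) →
    Spec V (l.length * (c + 1)) (sumList f l acc) (· = acc + (l.map g).sum)
  | [], acc, _, _ => Spec.pure (by simp)
  | i :: l, acc, h, hV => by
    rw [List.length_cons, Nat.succ_mul, Nat.add_comm, Nat.add_assoc]
    refine Spec.bind (h i (by simp)) fun a ha => ?_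
    subst ha
    refine Spec.bind (Q := (· = acc + g i)) ⟨by simp [add, cost], ?_, rfl⟩ fun a ha => ?_
    · have := hV [i] (by simp [List.prefix_cons_iff])
      simpa [add, Prog.values, evalArith] using this
    · subst ha
      refine (Spec.sumList (fun i hi => h i (by simp [hi])) fun l' hl' => ?_).mono le_rfl ?_
      · have := hV (i :: l') (by simpa [List.prefix_cons_iff] using hl')
        simpa [add_assoc] using this
      · rintro a rfl; simp [add_assoc]

end

/-- A family of bounds on the sizes of numbers that is compatible with the elementary
operations. -/
structure Levels (N : ℕ) (V : ℕ → ℝ → Prop) : Prop where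
  two_le : 2 ≤ N
  mono : ∀ {j k v}, j ≤ k → V j v → V k v
  int : ∀ {k} {z : ℤ}, |z| ≤ 2 ^ N ^ (k + 1) → V k z
  arith : ∀ {k x y} (o : Arith), V k x → V k y → V (k + 1) (evalArith o x y)
  list_sum : ∀ {ι : Type} {k} {l : List ι} {f : ι → ℝ}, l.length ≤ N → (∀ i ∈ l, V k (f i)) →
    V (k + 1) (l.map f).sum

/-- A bound that is polynomial in `N`. -/
abbrev PolySpec {α : Type} (N : ℕ) (V : ℕ → ℝ → Prop) (k : ℕ) (p : Prog ℝ α) (Q : α → Prop) :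
    Prop := Spec (V k) (N ^ k) p Q

variable {N : ℕ} {V : ℕ → ℝ → Prop}

namespace Levels

variable (hL : Levels N V)
include hL

lemma one_le : 1 ≤ N := le_trans (by norm_num) hL.two_le

lemma pow_le {j k : ℕ} (h : j ≤ k) : N ^ j ≤ N ^ k := Nat.pow_le_pow_right hL.one_le h

lemma one_le_pow (k : ℕ) : 1 ≤ N ^ k := Nat.one_le_pow _ _ hL.one_le

lemma add_le_pow {a b k : ℕ} (ha : a ≤ N ^ k) (hb : b ≤ N ^ k) : a + b ≤ N ^ (k + 1) := by
  have := hL.two_le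
  have h : 2 * N ^ k ≤ N * N ^ k := Nat.mul_le_mul_right _ this
  rw [pow_succ']
  omega

lemma mul_le_pow {a b j k : ℕ} (ha : a ≤ N ^ j) (hb : b ≤ N ^ k) : a * b ≤ N ^ (j + k) := by
  rw [pow_add]
  exact Nat.mul_le_mul ha hb

lemma mul_le_pow_succ {a b k : ℕ} (ha : a ≤ N) (hb : b ≤ N ^ k) : a * b ≤ N ^ (k + 1) := by
  rw [pow_succ']
  exact Nat.mul_le_mul ha hb

lemma int_of_abs_le_one {k : ℕ} {z : ℤ} (h : |z| ≤ 1) : V k z :=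
  hL.int (h.trans (one_le_pow₀ (by norm_num)))

lemma zero {k : ℕ} : V k 0 := by simpa using hL.int_of_abs_le_one (k := k) (z := 0) (by simp)

lemma one {k : ℕ} : V k 1 := by simpa using hL.int_of_abs_le_one (k := k) (z := 1) (by simp)

lemma sign {k : ℕ} {x : ℝ} (h : x ∈ Set.range (SignType.cast : SignType → ℝ)) : V k x := by
  obtain ⟨z, rfl, hz⟩ := sign_int h
  exact hL.int_of_abs_le_one hz

lemma sub {k : ℕ} {x y : ℝ} (hx : V k x) (hy : V k y) : V (k + 1) (x - y) := hL.arith .sub hx hy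
lemma mul {k : ℕ} {x y : ℝ} (hx : V k x) (hy : V k y) : V (k + 1) (x * y) := hL.arith .mul hx hy
lemma div {k : ℕ} {x y : ℝ} (hx : V k x) (hy : V k y) : V (k + 1) (x / y) := hL.arith .div hx hy

lemma sum {ι : Type} [Fintype ι] {k : ℕ} {f : ι → ℝ} (hι : Fintype.card ι ≤ N)
    (h : ∀ i, V k (f i)) : V (k + 1) (∑ i, f i) := by
  rw [← Finset.sum_map_toList]
  exact hL.list_sum (by simpa using hι) fun i _ => h i

lemma mono_spec {α : Type} {j k : ℕ} {p : Prog ℝ α} {Q Q' : α → Prop} (h : PolySpec N V j p Q)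
    (hjk : j ≤ k) (hQ : ∀ a, Q a → Q' a) : PolySpec N V k p Q' :=
  ⟨h.1.trans (hL.pow_le hjk), fun v hv => hL.mono hjk (h.2 v hv), hQ _ h.3⟩

lemma raise {α : Type} {j k c d : ℕ} {p : Prog ℝ α} {Q : α → Prop} (h : Spec (V j) c p Q)
    (hjk : j ≤ k) (hc : c ≤ d) : Spec (V k) d p Q :=
  ⟨h.1.trans hc, fun v hv => hL.mono hjk (h.2 v hv), h.3⟩

lemma bind {α β : Type} {j k : ℕ} {p : Prog ℝ α} {f : α → Prog ℝ β} {Q : α → Prop}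
    {R : β → Prop} (hp : PolySpec N V j p Q) (hjk : j ≤ k)
    (hf : ∀ a, Q a → PolySpec N V k (f a) R) : PolySpec N V (k + 1) (p >>= f) R := by
  have h := Spec.bind (hL.mono_spec hp hjk fun _ h => h) hf
  exact ⟨h.1.trans (hL.add_le_pow le_rfl le_rfl), fun v hv => hL.mono k.le_succ (h.2 v hv), h.3⟩

lemma spec_int {k : ℕ} {z : ℤ} (h : V k z) : PolySpec N V k (Prog.int z) (· = (z : ℝ)) :=
  ⟨by simpa [Prog.int, cost] using hL.one_le_pow k, by simpa [Prog.int, values] using h, rfl⟩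

lemma spec_zero {k : ℕ} : PolySpec N V k (Prog.int 0) (· = 0) := by
  simpa using hL.spec_int (k := k) (z := 0) (by simpa using hL.zero)

lemma spec_one {k : ℕ} : PolySpec N V k (Prog.int 1) (· = 1) := by
  simpa using hL.spec_int (k := k) (z := 1) (by simpa using hL.one)

lemma spec_sub {k : ℕ} {x y : ℝ} (h : V k (x - y)) : PolySpec N V k (Prog.sub x y) (· = x - y) :=
  ⟨by simpa [Prog.sub, cost] using hL.one_le_pow k,
    by simpa [Prog.sub, values, evalArith] using h, rfl⟩

lemma spec_mul {k : ℕ} {x y : ℝ} (h : V k (x * y)) : PolySpec N V k (Prog.mul x y) (· = x * y) :=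
  ⟨by simpa [Prog.mul, cost] using hL.one_le_pow k,
    by simpa [Prog.mul, values, evalArith] using h, rfl⟩

lemma spec_div {k : ℕ} {x y : ℝ} (h : V k (x / y)) : PolySpec N V k (Prog.div x y) (· = x / y) :=
  ⟨by simpa [Prog.div, cost] using hL.one_le_pow k,
    by simpa [Prog.div, values, evalArith] using h, rfl⟩

lemma spec_less {k : ℕ} {x y : ℝ} : PolySpec N V k (less x y) (· = decide (x < y)) :=
  ⟨by simpa [less, cost] using hL.one_le_pow k, by simp [less, values], rfl⟩

lemma spec_isZero {x : ℝ} : PolySpec N V 3 (isZero x) (· = decide (x = 0)) := by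
  refine hL.bind hL.spec_zero le_rfl ?_
  rintro _ rfl
  refine hL.bind hL.spec_less le_rfl ?_
  rintro _ rfl
  refine hL.bind hL.spec_less le_rfl ?_
  rintro _ rfl
  refine Spec.pure ?_
  rcases lt_trichotomy x 0 with h | h | h
  · simp [h, h.ne]
  · simp [h]
  · simp [h, h.ne', h.le]

lemma spec_tab {ι α : Type} [FinEnum ι] {k : ℕ} {f : ι → Prog ℝ α} {Q : ι → α → Prop}
    (hι : FinEnum.card ι ≤ N) (h : ∀ i, PolySpec N V k (f i) (Q i)) :
    PolySpec N V (k + 1) (tab f) fun g => ∀ i, Q i (g i) := by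
  have h' := Spec.tab h
  exact ⟨h'.1.trans (hL.mul_le_pow_succ hι le_rfl), fun v hv => hL.mono k.le_succ (h'.2 v hv), h'.3⟩

/-- Tabulation of a function with known values. -/
lemma spec_tab_eq {ι α : Type} [FinEnum ι] {k : ℕ} {f : ι → Prog ℝ α} {g : ι → α}
    (hι : FinEnum.card ι ≤ N) (h : ∀ i, PolySpec N V k (f i) (· = g i)) :
    PolySpec N V (k + 1) (tab f) (· = g) :=
  hL.mono_spec (hL.spec_tab hι h) le_rfl fun _ h => funext h

omit hL in
lemma sum_toList {ι : Type} [FinEnum ι] [Fintype ι] (g : ι → ℝ) :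
    ((FinEnum.toList ι).map g).sum = ∑ i, g i := by
  classical
  have h : (FinEnum.toList ι).toFinset = Finset.univ := by
    ext i; simp
  rw [← h, List.sum_toFinset _ FinEnum.nodup_toList]

omit hL in
lemma length_toList {ι : Type} [FinEnum ι] : (FinEnum.toList ι).length = FinEnum.card ι := by
  simp [FinEnum.toList]

lemma spec_sum {ι : Type} [FinEnum ι] [Fintype ι] {k : ℕ} {f : ι → Prog ℝ ℝ} {g : ι → ℝ}
    (hι : FinEnum.card ι ≤ N) (h : ∀ i, PolySpec N V k (f i) (· = g i)) (hg : ∀ i, V k (g i)) :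
    PolySpec N V (k + 3) (Prog.sum f) (· = ∑ i, g i) := by
  refine hL.bind (k := k + 2) hL.spec_zero le_rfl ?_
  rintro _ rfl
  have hs : Spec (V (k + 2)) (FinEnum.card ι * (N ^ k + 1)) (Prog.sumList f (FinEnum.toList ι) 0)
      (· = 0 + ((FinEnum.toList ι).map g).sum) := by
    rw [← length_toList]
    refine Spec.sumList (fun i _ => ⟨(h i).1, fun v hv => hL.mono (by omega) ((h i).2 v hv),
      (h i).3⟩) fun l' hl' => ?_
    rw [zero_add]
    refine hL.mono (j := k + 1) (by omega) (hL.list_sum ?_ fun i _ => hg i)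
    exact hl'.length_le.trans (by rw [length_toList]; exact hι)
  refine hs.mono ?_ ?_
  · exact hL.mul_le_pow_succ hι (hL.add_le_pow le_rfl (hL.one_le_pow k))
  · rintro _ rfl
    rw [zero_add, sum_toList]

omit hL in
lemma spec_firstNonzero_aux (hL : Levels N V) {ι : Type} (f : ι → ℝ) : ∀ l : List ι,
    Spec (V 3) (l.length * N ^ 3) (firstNonzero f l) fun o =>
      (o = none ∧ ∀ i ∈ l, f i = 0) ∨ ∃ i ∈ l, o = some i ∧ f i ≠ 0
  | [] => Spec.pure (by simp)
  | i :: l => by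
    rw [List.length_cons, Nat.succ_mul, Nat.add_comm]
    refine Spec.bind hL.spec_isZero ?_
    rintro _ rfl
    by_cases h : f i = 0
    · rw [if_pos (by simpa using h)]
      refine (spec_firstNonzero_aux hL f l).mono le_rfl fun o ho => ?_
      rcases ho with ⟨ho, h0⟩ | ⟨j, hj, ho⟩
      · exact Or.inl ⟨ho, by simpa [h] using h0⟩
      · exact Or.inr ⟨j, by simp [hj], ho⟩
    · rw [if_neg (by simpa using h)]
      exact Spec.pure (Or.inr ⟨i, by simp, rfl, h⟩)

lemma spec_firstNonzero {ι : Type} (f : ι → ℝ) {l : List ι} (hl : l.length ≤ N) :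
    PolySpec N V 4 (firstNonzero f l) fun o =>
      (o = none ∧ ∀ i ∈ l, f i = 0) ∨ ∃ i ∈ l, o = some i ∧ f i ≠ 0 := by
  have h := spec_firstNonzero_aux hL f l
  exact ⟨h.1.trans (hL.mul_le_pow_succ hl le_rfl), fun v hv => hL.mono (by omega) (h.2 v hv), h.3⟩

omit hL in
lemma spec_argminFrom (hL : Levels N V) {ι : Type} (f : ι → ℝ) : ∀ (l : List ι) (s : ι),
    Spec (V 0) l.length (argminFrom f l s) fun t => f t ≤ f s ∧ ∀ i ∈ l, f t ≤ f i
  | [], s => Spec.pure (by simp)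
  | i :: l, s => by
    rw [List.length_cons, Nat.add_comm]
    refine Spec.bind (c := 1) ((hL.spec_less (k := 0)).mono (by simp) fun _ h => h) ?_
    rintro _ rfl
    refine (spec_argminFrom hL f l _).mono le_rfl fun t ht => ?_
    by_cases h : f i < f s
    · simp only [h, decide_true, if_true] at ht
      exact ⟨ht.1.trans h.le, by simpa using ht⟩
    · simp only [h, decide_false] at ht
      simp only [Bool.false_eq_true, if_false] at ht
      exact ⟨ht.1, by simpa using ⟨ht.1.trans (not_lt.1 h), ht.2⟩⟩

lemma spec_argmin {ι : Type} (f : ι → ℝ) {l : List ι} (hl : l.length ≤ N) :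
    PolySpec N V 2 (argmin f l) fun o =>
      (o = none ∧ l = []) ∨ ∃ s, o = some s ∧ ∀ i ∈ l, f s ≤ f i := by
  cases l with
  | nil => exact Spec.pure (by simp)
  | cons i l =>
    have h := spec_argminFrom hL f l i
    have h' : PolySpec N V 1 (argminFrom f l i) fun t => f t ≤ f i ∧ ∀ j ∈ l, f t ≤ f j :=
      ⟨h.1.trans (by rw [pow_one]; exact (Nat.le_succ _).trans hl),
        fun v hv => hL.mono (by omega) (h.2 v hv), h.3⟩
    exact hL.bind h' le_rfl fun t ht => Spec.pure (Or.inr ⟨t, rfl, by simpa using ht⟩)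

end Levels

end Prog

end PrimalTardos

namespace PrimalTardos

open LP

/-! ## Pivoting and elimination by programs -/

/-- The tableau of a basis as a data structure of the programs. -/
noncomputable def LP.tab {ρ κ : Type} [Fintype ρ] [DecidableEq ρ] (P : LP ρ κ) (β : ρ → κ) :
    Prog.Tab ℝ ρ κ := (P.tableau β, P.basicVal β)

namespace Prog.Levels

variable {N : ℕ} {V : ℕ → ℝ → Prop} (hL : Levels N V)
include hL

section
variable {ρ κ : Type} [FinEnum ρ] [FinEnum κ] [Fintype ρ] [hρ' : DecidableEq ρ]

lemma pivotVec {k : ℕ} {r : ρ} {t u : ρ → ℝ} (ht : ∀ i, V k (t i)) (hu : ∀ i, V k (u i)) (i : ρ) :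
    V (k + 3) (LP.pivotVec r t u i) := by
  unfold LP.pivotVec
  split_ifs
  · exact hL.mono (by omega) (hL.div (hu r) (ht r))
  · exact hL.sub (hL.mono (by omega) (hu i))
      (hL.mul (hL.mono (by omega) (ht i)) (hL.div (hu r) (ht r)))

lemma spec_pivot (hρ : FinEnum.card ρ ≤ N) (hκ : FinEnum.card κ ≤ N) {k : ℕ} {T : Tab ℝ ρ κ}
    (h₁ : ∀ i j, V k (T.1 i j)) (h₂ : ∀ i, V k (T.2 i)) (r : ρ) (s : κ) :
    PolySpec N V (k + 10) (pivot T r s)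
      (· = (fun i j => LP.pivotVec r (fun i => T.1 i s) (fun i => T.1 i j) i,
        LP.pivotVec r (fun i => T.1 i s) T.2)) := by
  obtain rfl : hρ' = FinEnum.decEq := Subsingleton.elim _ _
  have hV : ∀ {l v}, k + 3 ≤ l → V (k + 3) v → V l v := fun hl hv => hL.mono hl hv
  refine hL.bind (k := k + 9) (hL.spec_tab_eq (k := k + 3) hκ fun j =>
    hL.spec_div (hL.mono (by omega) (hL.div (h₁ r j) (h₁ r s)))) (by omega) ?_
  rintro _ rfl
  refine hL.bind (k := k + 8) (hL.spec_div (k := k + 8)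
    (hL.mono (by omega) (hL.div (h₂ r) (h₁ r s)))) le_rfl ?_
  rintro _ rfl
  have hM : ∀ i, PolySpec N V (k + 6) (if i = r then Pure.pure fun j => T.1 r j / T.1 r s else
      Prog.tab fun j => Prog.mul (T.1 i s) (T.1 r j / T.1 r s) >>= fun t => Prog.sub (T.1 i j) t)
      (· = fun j => LP.pivotVec r (fun i => T.1 i s) (fun i => T.1 i j) i) := by
    intro i
    by_cases hi : i = r
    · rw [if_pos hi]
      refine Spec.pure (funext fun j => ?_)
      simp [LP.pivotVec, hi]
    · rw [if_neg hi]
      refine hL.spec_tab_eq hκ fun j => ?_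
      have e : LP.pivotVec r (fun i => T.1 i s) (fun i => T.1 i j) i =
          T.1 i j - T.1 i s * (T.1 r j / T.1 r s) := by simp [LP.pivotVec, hi]
      refine hL.bind (k := k + 4) (hL.spec_mul (k := k + 4) (hL.mono (by omega)
        (hL.mul (hL.mono (Nat.le_succ k) (h₁ i s)) (hL.div (h₁ r j) (h₁ r s))))) le_rfl ?_
      rintro _ rfl
      refine hL.mono_spec (hL.spec_sub (k := k + 4) ?_) (by omega) fun a ha => ha.trans e.symm
      rw [← e]
      exact hV (by omega) (hL.pivotVec (fun i => h₁ i s) (fun i => h₁ i j) i)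
  refine hL.bind (k := k + 7) (hL.spec_tab_eq (k := k + 6) hρ hM) le_rfl ?_
  rintro _ rfl
  have hw : ∀ i, PolySpec N V (k + 5) (if i = r then Pure.pure (T.2 r / T.1 r s) else
      Prog.mul (T.1 i s) (T.2 r / T.1 r s) >>= fun t => Prog.sub (T.2 i) t)
      (· = LP.pivotVec r (fun i => T.1 i s) T.2 i) := by
    intro i
    by_cases hi : i = r
    · rw [if_pos hi]
      exact Spec.pure (by simp [LP.pivotVec, hi])
    · rw [if_neg hi]
      have e : LP.pivotVec r (fun i => T.1 i s) T.2 i =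
          T.2 i - T.1 i s * (T.2 r / T.1 r s) := by simp [LP.pivotVec, hi]
      refine hL.bind (k := k + 4) (hL.spec_mul (k := k + 4) (hL.mono (by omega)
        (hL.mul (hL.mono (Nat.le_succ k) (h₁ i s)) (hL.div (h₂ r) (h₁ r s))))) le_rfl ?_
      rintro _ rfl
      refine hL.mono_spec (hL.spec_sub (k := k + 4) ?_) (by omega) fun a ha => ha.trans e.symm
      rw [← e]
      exact hV (by omega) (hL.pivotVec (fun i => h₁ i s) h₂ i)
  refine hL.bind (k := k + 6) (hL.spec_tab_eq (k := k + 5) hρ hw) (by omega) ?_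
  rintro _ rfl
  exact Spec.pure rfl

end

section
variable {ρ κ : Type} [FinEnum ρ] [FinEnum κ] [Fintype ρ] [DecidableEq ρ] [Fintype κ]
  [DecidableEq κ]

/-- Pivoting in the tableau of a basis gives the tableau of the new basis. -/
lemma spec_pivot_tab {P : LP ρ κ} {β : ρ → κ} (hβ : P.IsBasis β) (hρ : FinEnum.card ρ ≤ N)
    (hκ : FinEnum.card κ ≤ N) {k : ℕ} (h₁ : ∀ i j, V k (P.tableau β i j))
    (h₂ : ∀ i, V k (P.basicVal β i)) {r : ρ} {s : κ} (hrs : P.tableau β r s ≠ 0) :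
    PolySpec N V (k + 10) (pivot (P.tab β) r s) (· = P.tab (Function.update β r s)) := by
  refine hL.mono_spec (hL.spec_pivot hρ hκ h₁ h₂ r s) le_rfl ?_
  rintro _ rfl
  refine Prod.ext (funext fun i => funext fun j => ?_) ?_
  · exact (congrFun (hβ.tableau_update hrs j) i).symm
  · exact (hβ.basicVal_update hrs).symm

end

end Prog.Levels

end PrimalTardos

namespace PrimalTardos

open LP

section
variable {ρ κ : Type} [Fintype ρ] [DecidableEq ρ]

/-- The basis of `P.withUnits` in which row `i` has the basic column `σ i`, or the unit column. -/
def LP.unitBasis (σ : ρ → Option κ) : ρ → κ ⊕ ρ := fun i => (σ i).elim (Sum.inr i) Sum.inl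

lemma LP.unitBasis_update (σ : ρ → Option κ) (i : ρ) (s : κ) :
    unitBasis (Function.update σ i (some s)) = Function.update (unitBasis σ) i (Sum.inl s) := by
  funext j
  by_cases h : j = i
  · subst h; simp [unitBasis]
  · simp [unitBasis, h]

/-- The columns of `P` in a tableau of `P.withUnits`. -/
noncomputable def LP.unitTab [Fintype κ] [DecidableEq κ] (P : LP ρ κ) (γ : ρ → κ ⊕ ρ) :
    Prog.Tab ℝ ρ κ :=
  (fun i j => P.withUnits.tableau γ i (Sum.inl j), P.withUnits.basicVal γ)

variable [Fintype κ] [DecidableEq κ] {P : LP ρ κ}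

lemma LP.IsBasis.exists_tableau_ne_zero {γ : ρ → κ ⊕ ρ} (hγ : P.withUnits.IsBasis γ) {β : ρ → κ}
    (hβ : P.IsBasis β) (i : ρ) : ∃ k, P.withUnits.tableau γ i (Sum.inl (β k)) ≠ 0 := by
  by_contra! h
  have h' : (P.withUnits.M.submatrix id γ)⁻¹ * P.M.submatrix id β =
      (P.withUnits.tableau γ).submatrix id fun k => Sum.inl (β k) := by
    rw [← withUnits_submatrix_inl]; rfl
  have hdet : ((P.withUnits.M.submatrix id γ)⁻¹ * P.M.submatrix id β).det = 0 := by
    rw [h']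
    exact Matrix.det_eq_zero_of_row_eq_zero i fun k => h k
  rw [Matrix.det_mul] at hdet
  have h1 : IsUnit ((P.withUnits.M.submatrix id γ)⁻¹).det :=
    Matrix.isUnit_nonsing_inv_det _ hγ
  exact (h1.mul hβ).ne_zero hdet

end

namespace Prog.Levels

variable {N : ℕ} {V : ℕ → ℝ → Prop} (hL : Levels N V)
include hL

variable {ρ κ : Type} [FinEnum ρ] [FinEnum κ] [Fintype ρ] [hρ' : DecidableEq ρ] [Fintype κ]
  [DecidableEq κ] {P : LP ρ κ}

lemma spec_gaussLoop {β₀ : ρ → κ} (hβ₀ : P.IsBasis β₀) {allowed : List κ}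
    (hall : ∀ i, β₀ i ∈ allowed) (hlen : allowed.length ≤ N)
    (hρ : FinEnum.card ρ ≤ N) (hκ : FinEnum.card κ ≤ N) {k : ℕ}
    (h₁ : ∀ γ, P.withUnits.IsBasis γ → ∀ i j, V k (P.withUnits.tableau γ i j))
    (h₂ : ∀ γ, P.withUnits.IsBasis γ → ∀ i, V k (P.withUnits.basicVal γ i)) :
    ∀ (l : List ρ) (σ : ρ → Option κ), P.withUnits.IsBasis (unitBasis σ) →
      (∀ i s, σ i = some s → s ∈ allowed) →
      Spec (V (k + 11)) (l.length * N ^ (k + 11)) (gaussLoop allowed l (P.unitTab (unitBasis σ)) σ)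
        fun R => ∃ σ', R = some (P.unitTab (unitBasis σ'), σ') ∧
          P.withUnits.IsBasis (unitBasis σ') ∧ (∀ i s, σ' i = some s → s ∈ allowed) ∧
          (∀ i, (σ i).isSome → (σ' i).isSome) ∧ ∀ i ∈ l, (σ' i).isSome := by
  obtain rfl : hρ' = FinEnum.decEq := Subsingleton.elim _ _
  intro l
  induction l with
  | nil =>
    intro σ hσ hσ'
    exact Spec.pure ⟨σ, rfl, hσ, hσ', fun _ h => h, by simp⟩
  | cons i l ih =>
    intro σ hσ hσ'
    have e : N ^ 4 + (N ^ (k + 10) + l.length * N ^ (k + 11)) ≤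
        (i :: l).length * N ^ (k + 11) := by
      rw [List.length_cons, Nat.succ_mul]
      have := hL.add_le_pow (hL.pow_le (show 4 ≤ k + 10 by omega)) (le_refl (N ^ (k + 10)))
      rw [show k + 10 + 1 = k + 11 from rfl] at this
      omega
    refine Spec.mono ?_ e fun _ h => h
    refine Spec.bind (hL.raise (hL.spec_firstNonzero _ hlen) (by omega) le_rfl) ?_
    rintro o (⟨rfl, h0⟩ | ⟨s, hs, rfl, hne⟩)
    · obtain ⟨k', hk'⟩ := hσ.exists_tableau_ne_zero hβ₀ i
      exact absurd (h0 _ (hall k')) hk'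
    · have hp := hL.spec_pivot (T := P.unitTab (unitBasis σ)) hρ hκ
        (fun i j => h₁ _ hσ i (Sum.inl j)) (h₂ _ hσ) i s
      refine Spec.bind (hL.raise hp (by omega) le_rfl) ?_
      rintro _ rfl
      have hT : (fun i' j => LP.pivotVec i (fun i => (P.unitTab (unitBasis σ)).1 i s)
          (fun i => (P.unitTab (unitBasis σ)).1 i j) i',
          LP.pivotVec i (fun i => (P.unitTab (unitBasis σ)).1 i s) (P.unitTab (unitBasis σ)).2) =
          P.unitTab (unitBasis (Function.update σ i (some s))) := by
        rw [unitBasis_update]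
        refine Prod.ext (funext fun i' => funext fun j => ?_) ?_
        · exact (congrFun (hσ.tableau_update hne (Sum.inl j)) i').symm
        · exact (hσ.basicVal_update hne).symm
      rw [hT]
      refine (ih (Function.update σ i (some s)) ?_ ?_).mono le_rfl ?_
      · rw [unitBasis_update]
        exact hσ.update hne
      · intro i' s' h'
        by_cases hi : i' = i
        · subst hi
          simp only [Function.update_self, Option.some.injEq] at h'
          exact h' ▸ hs
        · rw [Function.update_of_ne hi] at h'
          exact hσ' i' s' h'
      · rintro R ⟨σ', rfl, h3, h4, h5, h6⟩
        have hmono : ∀ i', (Function.update σ i (some s) i').isSome → (σ' i').isSome := h5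
        refine ⟨σ', rfl, h3, h4, fun i' hi' => hmono i' ?_, fun i' hi' => ?_⟩
        · by_cases hi : i' = i
          · subst hi; simp
          · rwa [Function.update_of_ne hi]
        · rcases List.mem_cons.1 hi' with rfl | hi'
          · exact hmono i' (by simp)
          · exact h6 i' hi'

/-- Gauss-Jordan elimination finds a basis among the allowed columns, if there is one. -/
lemma spec_gauss {β₀ : ρ → κ} (hβ₀ : P.IsBasis β₀) {allowed : List κ}
    (hall : ∀ i, β₀ i ∈ allowed) (hlen : allowed.length ≤ N)
    (hρ : FinEnum.card ρ ≤ N) (hκ : FinEnum.card κ ≤ N) {k : ℕ}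
    (h₁ : ∀ γ, P.withUnits.IsBasis γ → ∀ i j, V k (P.withUnits.tableau γ i j))
    (h₂ : ∀ γ, P.withUnits.IsBasis γ → ∀ i, V k (P.withUnits.basicVal γ i)) :
    PolySpec N V (k + 13) (gauss allowed (P.M, P.rhs)) fun R =>
      ∃ σ, R = some (P.tab σ, σ) ∧ P.IsBasis σ ∧ ∀ i, σ i ∈ allowed := by
  have hinit : P.unitTab (unitBasis fun _ => none) = (P.M, P.rhs) := by
    refine Prod.ext (funext fun i => funext fun j => ?_) ?_
    · exact withUnits_tableau_init P i j
    · exact withUnits_basicVal_init P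
  have h := hL.spec_gaussLoop hβ₀ hall hlen hρ hκ h₁ h₂ (FinEnum.toList ρ) (fun _ => none)
    (withUnits_isBasis_inr P) (by simp)
  rw [hinit, length_toList] at h
  have h' := hL.mono_spec (k := k + 12) (Q' := fun R => ∃ σ' : ρ → Option κ,
      R = some (P.unitTab (unitBasis σ'), σ') ∧ P.withUnits.IsBasis (unitBasis σ') ∧
      (∀ i s, σ' i = some s → s ∈ allowed) ∧ ∀ i, (σ' i).isSome)
    (j := k + 12) (hL.raise h (Nat.le_succ _) (hL.mul_le_pow_succ hρ le_rfl)) le_rfl ?_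
  rotate_left
  · rintro R ⟨σ', h3, h4, h5, -, h6⟩
    exact ⟨σ', h3, h4, h5, fun i => h6 i (by simp)⟩
  refine hL.bind h' le_rfl ?_
  rintro _ ⟨σ', rfl, h4, h5, h6⟩
  simp only [h6, implies_true, dite_true]
  have e : unitBasis σ' = fun i => Sum.inl ((σ' i).get (h6 i)) := by
    funext i
    obtain ⟨s, hs⟩ := Option.isSome_iff_exists.1 (h6 i)
    simp [unitBasis, hs]
  refine Spec.pure ⟨fun i => (σ' i).get (h6 i), ?_, ?_, fun i => h5 i _ (by simp)⟩
  · have : P.unitTab (unitBasis σ') = P.tab fun i => (σ' i).get (h6 i) := by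
      rw [e]
      refine Prod.ext (funext fun i => funext fun j => ?_) ?_
      · exact withUnits_tableau_inl P _ i j
      · exact withUnits_basicVal_inl P _
    rw [this]
  · rw [e] at h4
    exact withUnits_isBasis_inl.1 h4

end Prog.Levels

end PrimalTardos

namespace PrimalTardos

open LP

/-! ## The simplex method as a program -/

/-- `best` is the row selected by the ratio test among the rows in `S`. -/
def Prog.RatioInv {ρ κ : Type} (T : Prog.Tab ℝ ρ κ) (s : κ) (S : ρ → Prop) :
    Option (ρ × ℝ) → Prop
  | none => ∀ i, S i → T.1 i s ≤ 0
  | some (r, q) => 0 < T.1 r s ∧ q = T.2 r / T.1 r s ∧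
      ∀ i, S i → 0 < T.1 i s → q ≤ T.2 i / T.1 i s

/-- The result of the simplex method that starts from the basis `β`. -/
structure LP.SimplexPost {ρ κ : Type} [Fintype ρ] [DecidableEq ρ]
    (P : LP ρ κ) (β : ρ → κ) (R : Prog.SimplexResult ℝ ρ κ) : Prop where
  tab : R.tab = P.tab R.basis
  feasible : P.IsFeasibleBasis R.basis
  head : R.visited.head? = some β
  chain : R.visited.IsChain P.DantzigPivot
  last : R.visited.getLast? = some R.basis
  status : R.status = .optimal ∧ P.OptimalTableau R.basis ∨
    R.status = .unbounded ∧ P.UnboundedTableau R.basis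

lemma LP.SimplexPost.visit {ρ κ : Type} [Fintype ρ] [DecidableEq ρ]
    {P : LP ρ κ} {β β' : ρ → κ} {R : Prog.SimplexResult ℝ ρ κ} (h : P.SimplexPost β' R)
    (hβ : P.DantzigPivot β β') : P.SimplexPost β (R.visit β) where
  tab := h.tab
  feasible := h.feasible
  head := rfl
  chain := by
    change (β :: R.visited).IsChain _
    rw [List.isChain_cons]
    refine ⟨fun y hy => ?_, h.chain⟩
    rw [h.head, Option.mem_some_iff] at hy
    exact hy ▸ hβ
  last := by
    change (β :: R.visited).getLast? = _
    rw [List.getLast?_cons, h.last]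
    rfl
  status := h.status

namespace Prog.Levels

variable {N : ℕ} {V : ℕ → ℝ → Prop}

lemma spec_ratioTest (hL : Levels N V) {ρ κ : Type} {k : ℕ} {T : Tab ℝ ρ κ} {s : κ}
    (h₁ : ∀ i, V k (T.1 i s)) (h₂ : ∀ i, V k (T.2 i)) :
    ∀ (l : List ρ) (best : Option (ρ × ℝ)) (S : ρ → Prop), RatioInv T s S best →
      Spec (V (k + 1)) (l.length * 4) (ratioTest T s l best) (RatioInv T s fun i => S i ∨ i ∈ l)
  | [], best, S, h => Spec.pure (by simpa using h)
  | i :: l, best, S, h => by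
    have e : 1 + (1 + (1 + (1 + l.length * 4))) ≤ (i :: l).length * 4 := by
      rw [List.length_cons]; omega
    have hS : ∀ j, (S j ∨ j ∈ i :: l) ↔ ((S j ∨ j = i) ∨ j ∈ l) := fun j => by
      rw [List.mem_cons, or_assoc]
    simp only [hS]
    have hdiv : V (k + 1) (T.2 i / T.1 i s) := hL.div (h₂ i) (h₁ i)
    refine Spec.mono ?_ e fun _ h => h
    refine Spec.bind (hL.raise (hL.spec_zero (k := 0)) (by omega) (by simp)) ?_
    rintro _ rfl
    refine Spec.bind (hL.raise (hL.spec_less (k := 0)) (by omega) (by simp)) ?_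
    rintro _ rfl
    by_cases hp : 0 < T.1 i s
    · rw [if_pos (by simpa using hp)]
      refine Spec.bind (Q := (· = T.2 i / T.1 i s)) ⟨by simp [Prog.div, cost],
        by simpa [Prog.div, Prog.values, evalArith] using hdiv, rfl⟩ ?_
      rintro _ rfl
      rcases best with - | ⟨r, q⟩
      · refine (spec_ratioTest hL h₁ h₂ l _ (fun j => S j ∨ j = i) ?_).mono (by omega)
          fun _ h => h
        refine ⟨hp, rfl, fun j hj hj0 => ?_⟩
        rcases hj with hj | rfl
        · exact absurd hj0 (not_lt.2 (h j hj))
        · exact le_rfl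
      · refine Spec.bind (hL.raise (hL.spec_less (k := 0)) (by omega) (by simp)) ?_
        rintro _ rfl
        obtain ⟨h3, h4, h5⟩ := h
        by_cases hq : T.2 i / T.1 i s < q
        · rw [if_pos (by simpa using hq)]
          refine spec_ratioTest hL h₁ h₂ l _ (fun j => S j ∨ j = i) ⟨hp, rfl, ?_⟩
          rintro j (hj | rfl) hj0
          · exact hq.le.trans (h5 j hj hj0)
          · exact le_rfl
        · rw [if_neg (by simpa using hq)]
          refine spec_ratioTest hL h₁ h₂ l _ (fun j => S j ∨ j = i) ⟨h3, h4, ?_⟩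
          rintro j (hj | rfl) hj0
          · exact h5 j hj hj0
          · exact not_lt.1 hq
    · rw [if_neg (by simpa using hp)]
      refine (spec_ratioTest hL h₁ h₂ l best (fun j => S j ∨ j = i) ?_).mono (by omega)
        fun _ h => h
      rcases best with - | ⟨r, q⟩
      · rintro j (hj | rfl)
        · exact h j hj
        · exact not_lt.1 hp
      · refine ⟨h.1, h.2.1, ?_⟩
        rintro j (hj | rfl) hj0
        · exact h.2.2 j hj hj0
        · exact absurd hj0 hp

variable (hL : Levels N V)
include hL

variable {ρ κ : Type} [FinEnum ρ] [FinEnum κ] [Fintype ρ] [hρ' : DecidableEq ρ] [Fintype κ]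
  [DecidableEq κ] {P : LP ρ κ}

lemma spec_redCost (hρ : FinEnum.card ρ ≤ N) (hκ : FinEnum.card κ ≤ N) {k : ℕ} {β : ρ → κ}
    (h₁ : ∀ i j, V k (P.tableau β i j)) (h₃ : ∀ j, V k (P.cost j)) :
    PolySpec N V (k + 6) (Prog.tab fun j => do
      let z ← Prog.sum fun i => Prog.mul (P.cost (β i)) ((P.tab β).1 i j)
      Prog.sub (P.cost j) z) (· = P.redCost β) := by
  refine hL.spec_tab_eq hκ fun j => ?_
  have hm : ∀ i, V (k + 1) (P.cost (β i) * P.tableau β i j) := fun i => hL.mul (h₃ _) (h₁ i j)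
  have hs := hL.sum (by rw [← FinEnum.card_eq_fintypeCard]; exact hρ) hm
  refine hL.bind (k := k + 4) (hL.spec_sum hρ (fun i => hL.spec_mul (hm i)) hm) le_rfl ?_
  rintro _ rfl
  exact hL.spec_sub (hL.mono (by omega) (hL.sub (hL.mono (by omega) (h₃ j)) hs))

lemma spec_simplexLoop (hρ : FinEnum.card ρ ≤ N) (hκ : FinEnum.card κ ≤ N) {k : ℕ}
    (h₁ : ∀ β, P.IsBasis β → ∀ i j, V k (P.tableau β i j))
    (h₂ : ∀ β, P.IsBasis β → ∀ i, V k (P.basicVal β i)) (h₃ : ∀ j, V k (P.cost j)) :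
    ∀ (fuel K : ℕ) (β : ρ → κ), P.IsFeasibleBasis β →
      (∀ T γ, P.PivotPath β T γ → T < fuel ∧ T < K) →
      Spec (V (k + 14)) (K * N ^ (k + 14)) (simplexLoop P.cost fuel (P.tab β) β)
        (P.SimplexPost β) := by
  obtain rfl : hρ' = FinEnum.decEq := Subsingleton.elim _ _
  intro fuel
  induction fuel with
  | zero => exact fun K β _ h => absurd (h 0 β .refl).1 (by simp)
  | succ fuel ih =>
    intro K β hβ hK
    obtain ⟨K, rfl⟩ : ∃ K', K = K' + 1 := ⟨K - 1, by have := (hK 0 β .refl).2; omega⟩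
    have e : N ^ (k + 6) + (N ^ 2 + (1 + (1 + (N ^ 3 + (N ^ (k + 10) + (K * N ^ (k + 14) + 0)))))) ≤
        (K + 1) * N ^ (k + 14) := by
      have e1 := hL.pow_le (show k + 6 ≤ k + 10 by omega)
      have e2 := hL.pow_le (show 2 ≤ k + 10 by omega)
      have e3 := hL.pow_le (show 3 ≤ k + 10 by omega)
      have e4 := hL.one_le_pow (k + 10)
      have e5 := hL.add_le_pow (hL.add_le_pow (hL.add_le_pow e4 e4) (hL.add_le_pow e4 e4))
        (hL.add_le_pow (hL.add_le_pow e4 e4) (hL.add_le_pow e4 e4))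
      have e6 := hL.add_le_pow (hL.add_le_pow (hL.add_le_pow e1 e2) (hL.add_le_pow e4 e4))
        (hL.add_le_pow (hL.add_le_pow e3 (le_refl (N ^ (k + 10)))) (hL.add_le_pow e4 e4))
      rw [show k + 10 + 1 + 1 + 1 = k + 13 from rfl] at e6
      have e7 := hL.pow_le (show k + 13 ≤ k + 14 by omega)
      rw [Nat.succ_mul]
      omega
    have leaf : ∀ st, (st = Status.optimal ∧ P.OptimalTableau β ∨
        st = Status.unbounded ∧ P.UnboundedTableau β) →
        P.SimplexPost β ⟨st, P.tab β, β, [β]⟩ := fun st h => ⟨rfl, hβ, rfl, by simp, rfl, h⟩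
    refine Spec.mono ?_ e fun _ h => h
    refine Spec.bind (hL.raise (hL.spec_redCost hρ hκ (h₁ β hβ.1) h₃) (by omega) le_rfl) ?_
    rintro _ rfl
    refine Spec.bind (hL.raise (hL.spec_argmin (P.redCost β) (by rw [length_toList]; exact hκ))
      (by omega) le_rfl) ?_
    rintro o (⟨rfl, hnil⟩ | ⟨s, rfl, hs⟩)
    · refine Spec.pure (leaf _ (Or.inl ⟨rfl, fun j => ?_⟩))
      have : j ∈ FinEnum.toList κ := by simp
      simp [hnil] at this
    · have hs' : ∀ j, P.redCost β s ≤ P.redCost β j := fun j => hs j (by simp)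
      refine Spec.bind (hL.raise (hL.spec_zero (k := 0)) (by omega) (by simp)) ?_
      rintro _ rfl
      refine Spec.bind (hL.raise (hL.spec_less (k := 0)) (by omega) (by simp)) ?_
      rintro _ rfl
      by_cases hneg : P.redCost β s < 0
      · rw [if_pos (by simpa using hneg)]
        refine Spec.bind (hL.raise (hL.spec_ratioTest (k := k) (T := P.tab β)
          (fun i => h₁ β hβ.1 i s) (h₂ β hβ.1) (FinEnum.toList ρ) none (fun _ => False)
          (by simp [RatioInv])) (by omega) ?_) ?_
        · rw [length_toList]
          have := hL.two_le
          have h4 : 4 ≤ N ^ 2 := by nlinarith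
          calc FinEnum.card ρ * 4 ≤ N * N ^ 2 := Nat.mul_le_mul hρ h4
            _ = N ^ 3 := by ring
        · rintro (- | ⟨r, q⟩) hq
          · refine Spec.pure (leaf _ (Or.inr ⟨rfl, s, ⟨hneg, hs'⟩, fun i => hq i ?_⟩))
            simp
          · obtain ⟨hr, rfl, hmin⟩ := hq
            have hpiv : P.DantzigPivot β (Function.update β r s) :=
              ⟨s, r, ⟨hneg, hs'⟩, hr, fun i hi => hmin i (by simp) hi, rfl⟩
            refine Spec.bind (hL.raise (hL.spec_pivot_tab hβ.1 hρ hκ (h₁ β hβ.1) (h₂ β hβ.1)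
              (r := r) (s := s) (ne_of_gt hr)) (by omega) le_rfl) ?_
            rintro _ rfl
            refine Spec.bind (ih K _ (hpiv.isFeasibleBasis hβ) fun T γ hp => ?_) fun R hR =>
              Spec.pure (hR.visit hpiv)
            have := hK _ _ (hp.cons hpiv)
            omega
      · rw [if_neg (by simpa using hneg)]
        exact Spec.pure (leaf _ (Or.inl ⟨rfl, fun j => (not_lt.1 hneg).trans (hs' j)⟩))

/-- The simplex method for a non-degenerate problem, if `K` bounds the number of iterations. -/
lemma spec_simplex (hρ : FinEnum.card ρ ≤ N) (hκ : FinEnum.card κ ≤ N) {k e : ℕ}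
    (h₁ : ∀ β, P.IsBasis β → ∀ i j, V k (P.tableau β i j))
    (h₂ : ∀ β, P.IsBasis β → ∀ i, V k (P.basicVal β i)) (h₃ : ∀ j, V k (P.cost j))
    (hnd : P.Nondegenerate) {β : ρ → κ} (hβ : P.IsFeasibleBasis β)
    (hK : ∀ T γ, P.PivotPath β T γ → T < N ^ e) :
    PolySpec N V (k + e + 14) (simplex P.cost (P.tab β) β) (P.SimplexPost β) := by
  refine hL.raise (hL.spec_simplexLoop hρ hκ h₁ h₂ h₃ _ (N ^ e) β hβ fun T γ h =>
    ⟨?_, hK T γ h⟩) (by omega) ?_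
  · rw [FinEnum.card_eq_fintypeCard, FinEnum.card_eq_fintypeCard]
    exact h.lt_card hβ hnd
  · rw [← pow_add]
    exact hL.pow_le (by omega)

end Prog.Levels

end PrimalTardos

namespace PrimalTardos

open LP

/-! ## Sizes of the entries of tableaux, scaling and rounding -/

/-- The linear system of the Gram matrix of the rows. -/
noncomputable def LP.gram {ρ κ : Type} [Fintype κ] (P : LP ρ κ) : LP ρ ρ where
  M := P.M * P.M.transpose
  rhs := P.rhs
  cost := 0

lemma LP.IsBasis.gram_isBasis_id {ρ κ : Type} [Fintype ρ] [DecidableEq ρ] [Fintype κ]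
    [DecidableEq κ] {P : LP ρ κ} {ℓ : ρ → κ} (hℓ : P.IsBasis ℓ) : P.gram.IsBasis id := by
  rw [IsBasis, Matrix.submatrix_id_id]
  exact hℓ.isUnit_gram

lemma LP.gram_value {ρ κ : Type} [Fintype ρ] [DecidableEq ρ] [Fintype κ]
    [DecidableEq κ] {P : LP ρ κ} {ℓ : ρ → κ} (hℓ : P.IsBasis ℓ) {π : ρ → ρ}
    (hπ : P.gram.IsBasis π) :
    ∑ i, P.rhs (π i) * P.gram.basicVal π i = dotProduct P.minNormSol P.minNormSol := by
  rw [← sum_mul_basicSol P.gram π P.rhs]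
  set z := P.gram.basicSol π with hz
  have h1 : (P.M * P.M.transpose).mulVec z = P.rhs := hπ.mulVec_basicSol
  have h2 : P.minNormSol = P.M.transpose.mulVec z := by
    rw [minNormSol, ← h1, Matrix.mulVec_mulVec, Matrix.mul_assoc,
      Matrix.nonsing_inv_mul _ hℓ.isUnit_gram, Matrix.mul_one]
  rw [h2]
  conv_rhs => rw [Matrix.mulVec_transpose, ← Matrix.dotProduct_mulVec, ← Matrix.mulVec_transpose,
    Matrix.mulVec_mulVec, h1]
  rw [dotProduct_comm]
  rfl

namespace Prog

lemma mul_abs_lt_iff (x y : ℝ) : x * |x| < y * |y| ↔ x < y := by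
  have key : ∀ {a b : ℝ}, a < b → a * |a| < b * |b| := by
    intro a b h
    rcases le_total 0 a with ha | ha
    · rw [abs_of_nonneg ha, abs_of_nonneg (ha.trans h.le)]
      nlinarith
    · rw [abs_of_nonpos ha]
      rcases le_total 0 b with hb | hb
      · rw [abs_of_nonneg hb]
        rcases eq_or_lt_of_le ha with rfl | ha
        · nlinarith
        · nlinarith
      · rw [abs_of_nonpos hb]
        nlinarith
  refine ⟨fun h => ?_, key⟩
  by_contra hn
  rcases eq_or_lt_of_le (not_lt.1 hn) with rfl | hn
  · exact lt_irrefl _ h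
  · exact lt_asymm h (key hn)

namespace Levels

variable {N : ℕ} {V : ℕ → ℝ → Prop} (hL : Levels N V)
include hL

section
variable {ρ κ : Type} [Fintype ρ] [DecidableEq ρ] [Fintype κ] [DecidableEq κ] {P : LP ρ κ}

lemma tableau (hM : P.M.IsTotallyUnimodular) {β : ρ → κ} (hβ : P.IsBasis β) {k : ℕ} (i : ρ)
    (j : κ) : V k (P.tableau β i j) :=
  hL.sign ((hβ.isTotallyUnimodular_tableau hM).apply i j)

lemma basicVal (hρ : Fintype.card ρ ≤ N) {β : ρ → κ} {k : ℕ}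
    (hinv : ∀ i l, V k ((P.M.submatrix id β)⁻¹ i l)) (hr : ∀ l, V k (P.rhs l)) (i : ρ) :
    V (k + 2) (P.basicVal β i) :=
  hL.sum (k := k + 1) hρ fun l => hL.mul (hinv i l) (hr l)

lemma basicVal_unimodular (hM : P.M.IsTotallyUnimodular) (hρ : Fintype.card ρ ≤ N) {β : ρ → κ}
    (hβ : P.IsBasis β) {k : ℕ} (hr : ∀ l, V k (P.rhs l)) (i : ρ) : V (k + 2) (P.basicVal β i) :=
  hL.basicVal hρ (fun i l => hL.sign (hβ.inv_mem_sign hM i l)) hr i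

lemma int_det {B : Matrix ρ ρ ℤ} (hρ : Fintype.card ρ ≤ N) (hB : ∀ i j, |B i j| ≤ N) :
    V 2 (B.det : ℝ) := by
  refine hL.int ?_
  have h := Matrix.det_le (abv := AbsoluteValue.abs) (x := (N : ℤ)) hB
  refine h.trans ?_
  rw [nsmul_eq_mul]
  have h2 : N ≤ 2 ^ N := Nat.lt_two_pow_self.le
  have h1 : (Fintype.card ρ).factorial * N ^ Fintype.card ρ ≤ 2 ^ N ^ 3 := by
    calc (Fintype.card ρ).factorial * N ^ Fintype.card ρ
        ≤ N ^ N * N ^ N := by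
          refine Nat.mul_le_mul ?_ (hL.pow_le hρ)
          exact (Nat.factorial_le_pow _).trans ((Nat.pow_le_pow_left hρ _).trans (hL.pow_le hρ))
      _ = N ^ (2 * N) := by rw [two_mul, pow_add]
      _ ≤ (2 ^ N) ^ (2 * N) := Nat.pow_le_pow_left h2 _
      _ = 2 ^ (2 * (N * N)) := by rw [← pow_mul]; congr 1; ring
      _ ≤ 2 ^ N ^ 3 := by
          refine Nat.pow_le_pow_right (by norm_num) ?_
          calc 2 * (N * N) ≤ N * (N * N) := Nat.mul_le_mul_right _ hL.two_le
            _ = N ^ 3 := by ring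
  exact_mod_cast h1

/-- Cramer's rule bounds the entries of the inverse of an integral matrix. -/
lemma int_inv {B : Matrix ρ ρ ℤ} (hρ : Fintype.card ρ ≤ N) (hB : ∀ i j, |B i j| ≤ N) (i j : ρ) :
    V 3 ((B.map (Int.cast : ℤ → ℝ))⁻¹ i j) := by
  have h1 : (B.map (Int.cast : ℤ → ℝ)).det = (B.det : ℝ) := (Int.cast_det B).symm
  have h2 : (B.map (Int.cast : ℤ → ℝ)).adjugate = B.adjugate.map (Int.cast : ℤ → ℝ) :=
    ((Int.castRingHom ℝ).map_adjugate B).symm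
  have h3 : (B.map (Int.cast : ℤ → ℝ))⁻¹ i j = (B.adjugate i j : ℝ) / (B.det : ℝ) := by
    rw [Matrix.inv_def, h1, h2, Matrix.smul_apply, Matrix.map_apply, Ring.inverse_eq_inv',
      smul_eq_mul, div_eq_inv_mul]
  rw [h3]
  refine hL.div ?_ (hL.int_det hρ hB)
  rw [Matrix.adjugate_apply]
  refine hL.int_det hρ fun i' j' => ?_
  by_cases h : i' = j
  · subst h
    rw [Matrix.updateRow_self, Pi.single_apply]
    have := hL.one_le
    split_ifs
    · simp; omega
    · simp
  · rw [Matrix.updateRow_ne h]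
    exact hB i' j'

lemma int_withUnits_inv {M : Matrix ρ κ ℤ} (hM : ∀ i j, P.M i j = M i j)
    (hρ : Fintype.card ρ ≤ N) (hB : ∀ i j, |M i j| ≤ N) (γ : ρ → κ ⊕ ρ) (i j : ρ) :
    V 3 ((P.withUnits.M.submatrix id γ)⁻¹ i j) := by
  have h : P.withUnits.M.submatrix id γ =
      (((Matrix.fromCols M 1).submatrix id γ).map (Int.cast : ℤ → ℝ)) := by
    ext i j
    simp only [Matrix.submatrix_apply, id, Matrix.map_apply]
    rcases hγ : γ j with k | k
    · exact hM i k
    · change (1 : Matrix ρ ρ ℝ) i k = (((1 : Matrix ρ ρ ℤ) i k : ℤ) : ℝ)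
      simp only [Matrix.one_apply]
      split_ifs <;> simp
  rw [h]
  refine hL.int_inv hρ (fun i j => ?_) i j
  have := hL.one_le
  simp only [Matrix.submatrix_apply, id]
  rcases hγ : γ j with k | k
  · exact hB i k
  · change |(1 : Matrix ρ ρ ℤ) i k| ≤ N
    simp only [Matrix.one_apply]
    split_ifs
    · simp; omega
    · simp

lemma int_withUnits_tableau {M : Matrix ρ κ ℤ} (hM : ∀ i j, P.M i j = M i j)
    (hρ : Fintype.card ρ ≤ N) (hB : ∀ i j, |M i j| ≤ N) (γ : ρ → κ ⊕ ρ) (i : ρ) (j : κ ⊕ ρ) :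
    V 5 (P.withUnits.tableau γ i j) := by
  refine hL.sum (k := 4) hρ fun l => hL.mul (hL.int_withUnits_inv hM hρ hB γ i l) ?_
  have h1 := hL.one_le
  have h2 : ∀ z : ℤ, |z| ≤ N → V 3 (z : ℝ) := fun z hz => hL.int <| hz.trans <| by
    have : N ≤ 2 ^ N ^ (3 + 1) := Nat.lt_two_pow_self.le.trans
      (Nat.pow_le_pow_right (by norm_num) (Nat.le_self_pow (by norm_num) _))
    exact_mod_cast this
  rcases j with j | j
  · change V 3 (P.M l j)
    rw [hM]
    exact h2 _ (hB l j)
  · change V 3 ((1 : Matrix ρ ρ ℝ) l j)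
    rw [Matrix.one_apply]
    split_ifs
    · exact hL.one
    · exact hL.zero

end

section
variable {ρ κ : Type} [FinEnum ρ] [FinEnum κ] [Fintype ρ] [DecidableEq ρ] [Fintype κ]
  [DecidableEq κ] {P : LP ρ κ}

lemma spec_minNormSq (hM : P.M.IsTotallyUnimodular) {ℓ : ρ → κ} (hℓ : P.IsBasis ℓ)
    (hρ : FinEnum.card ρ ≤ N) (hκ : FinEnum.card κ ≤ N) {k : ℕ} (hr : ∀ i, V k (P.rhs i)) :
    PolySpec N V (k + 20) (minNormSq (P.M, P.rhs))
      fun s => s = dotProduct P.minNormSol P.minNormSol ∧ V (k + 7) s := by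
  have hρ' : Fintype.card ρ ≤ N := by rwa [← FinEnum.card_eq_fintypeCard]
  have hκ' : Fintype.card κ ≤ N := by rwa [← FinEnum.card_eq_fintypeCard]
  have hS : PolySpec N V 5 (Prog.tab fun i => Prog.tab fun i' => Prog.sum fun j =>
      Prog.mul (P.M i j) (P.M i' j)) (· = P.gram.M) := by
    refine hL.spec_tab_eq hρ fun i => hL.spec_tab_eq hρ fun i' => ?_
    have hs : ∀ j, V 0 (P.M i j * P.M i' j) := fun j => hL.sign (sign_mul (hM.apply i j)
      (hM.apply i' j))
    exact hL.spec_sum hκ (fun j => hL.spec_mul (hs j)) hs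
  choose Z hZ hZ1 using fun i i' j => sign_int (sign_mul (hM.apply i j) (hM.apply i' j))
  have hint : ∀ i i', P.gram.M i i' = ((fun i i' => ∑ j, Z i i' j : Matrix ρ ρ ℤ) i i' : ℤ) := by
    intro i i'
    change ∑ j, P.M i j * P.M i' j = _
    push_cast
    exact Finset.sum_congr rfl fun j _ => hZ i i' j
  have hbd : ∀ i i', |(fun i i' => ∑ j, Z i i' j : Matrix ρ ρ ℤ) i i'| ≤ N := by
    intro i i'
    refine (Finset.abs_sum_le_sum_abs _ _).trans
      ((Finset.sum_le_card_nsmul _ _ 1 fun j _ => hZ1 i i' j).trans ?_)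
    simpa using hκ'
  have h₂ : ∀ γ, P.gram.withUnits.IsBasis γ → ∀ i, V (k + 5) (P.gram.withUnits.basicVal γ i) :=
    fun γ _ i => hL.basicVal (k := k + 3) hρ'
      (fun i l => hL.mono (by omega) (hL.int_withUnits_inv hint hρ' hbd γ i l))
      (fun l => hL.mono (by omega) (hr l)) i
  refine hL.bind (k := k + 19) hS (by omega) ?_
  rintro _ rfl
  refine hL.bind (k := k + 18) (hL.spec_gauss (P := P.gram) hℓ.gram_isBasis_id (fun i => by simp)
    (by rw [length_toList]; exact hρ) hρ hρ
    (fun γ _ i j => hL.mono (show 5 ≤ k + 5 by omega) (hL.int_withUnits_tableau hint hρ' hbd γ i j))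
    h₂) (by omega) ?_
  rintro _ ⟨π, rfl, hπ, -⟩
  have hv : ∀ i, V (k + 6) (P.rhs (π i) * P.gram.basicVal π i) := fun i => by
    refine hL.mul (hL.mono (by omega) (hr _)) ?_
    rw [← withUnits_basicVal_inl]
    exact h₂ _ (withUnits_isBasis_inl.2 hπ) i
  refine hL.mono_spec (hL.spec_sum (k := k + 6) hρ (fun i => hL.spec_mul (hv i)) hv) (by omega) ?_
  rintro _ rfl
  exact ⟨gram_value hℓ hπ, hL.sum (k := k + 6) hρ' hv⟩

end

lemma spec_countBelow {B : ℕ} {s u x : ℝ} {k : ℕ}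
    (hlt : ∀ z : ℤ, (((z * |z| : ℤ) : ℝ) * s < u ↔ (z : ℝ) < x))
    (hB : |⌈x⌉| ≤ B) (hV : ∀ z : ℤ, |z| ≤ B → V k ((z * |z| : ℤ) : ℝ)) (hs : V k s) :
    ∀ n : ℕ, n ≤ 2 * B → Spec (V (k + 1)) (3 * n) (countBelow B s u n)
      fun a => (a : ℤ) = min (n : ℤ) (⌈x⌉ + B)
  | 0, _ => Spec.pure (by
      have := neg_abs_le ⌈x⌉
      simp; omega)
  | n + 1, hn => by
    have e : 3 * n + (1 + (1 + (1 + 0))) ≤ 3 * (n + 1) := by omega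
    refine Spec.mono ?_ e fun _ h => h
    refine Spec.bind (spec_countBelow hlt hB hV hs n (by omega)) fun a ha => ?_
    have hz : |(n : ℤ) - B| ≤ B := abs_le.2 ⟨by omega, by omega⟩
    refine Spec.bind (Q := (· = ((((n : ℤ) - B) * |(n : ℤ) - B| : ℤ) : ℝ)))
      ⟨by simp [Prog.int, cost], ?_, rfl⟩ ?_
    · simpa [Prog.int, Prog.values] using hL.mono (Nat.le_succ k) (hV _ hz)
    rintro _ rfl
    refine Spec.bind (Q := (· = ((((n : ℤ) - B) * |(n : ℤ) - B| : ℤ) : ℝ) * s))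
      ⟨by simp [Prog.mul, cost], ?_, rfl⟩ ?_
    · simpa [Prog.mul, Prog.values, evalArith] using hL.mul (hV _ hz) hs
    rintro _ rfl
    refine Spec.bind (hL.raise (hL.spec_less (k := 0)) (by omega) (by simp)) ?_
    rintro _ rfl
    refine Spec.pure ?_
    have hiff := (hlt ((n : ℤ) - B)).trans Int.lt_ceil.symm
    by_cases h : ((((n : ℤ) - B) * |(n : ℤ) - B| : ℤ) : ℝ) * s < u
    · have h' := hiff.1 h
      rw [if_pos (by simpa using h)]
      push_cast
      omega
    · have h' := mt hiff.2 h
      rw [if_neg (by simpa using h)]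
      push_cast
      omega

/-- Rounding without square roots. -/
lemma spec_ceilScaled {B μ : ℕ} {s v : ℝ} (hs0 : 0 < s) (hB : |⌈v * μ / √s⌉| ≤ B) {e k : ℕ}
    (hBN : B ≤ N ^ e) (hμ : μ ≤ N ^ e) (hs : V (k + 2 * e) s) (hv : V (k + 2 * e) v) :
    PolySpec N V (k + 2 * e + 10) (ceilScaled B μ s v) (· = ⌈v * μ / √s⌉) := by
  have hpow : ∀ {a l : ℕ}, a ≤ N ^ l → ∀ {z : ℤ}, |z| ≤ a → V l (z : ℝ) := by
    intro a l ha z hz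
    refine hL.int (hz.trans ?_)
    have : a ≤ 2 ^ N ^ (l + 1) := ha.trans ((hL.pow_le (Nat.le_succ l)).trans
      Nat.lt_two_pow_self.le)
    exact_mod_cast this
  have hw : V (k + 2 * e + 1) (v * μ) :=
    hL.mul hv (hL.mono (show e ≤ k + 2 * e by omega)
      (by simpa using hpow hμ (z := (μ : ℤ)) (by simp)))
  refine hL.bind (k := k + 2 * e + 9) (hL.spec_int (k := k + 2 * e + 9) (z := (μ : ℤ))
    (hL.mono (show e ≤ k + 2 * e + 9 by omega) (hpow hμ (by simp)))) le_rfl ?_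
  rintro _ rfl
  simp only [Int.cast_natCast]
  refine hL.bind (k := k + 2 * e + 8) (hL.spec_mul (k := k + 2 * e + 8)
    (hL.mono (by omega) hw)) le_rfl ?_
  rintro _ rfl
  have hq : V (k + 2 * e + 2) ((v * μ) * (v * μ)) := hL.mul hw hw
  refine hL.bind (k := k + 2 * e + 7) (hL.spec_mul (k := k + 2 * e + 7)
    (hL.mono (by omega) hq)) le_rfl ?_
  rintro _ rfl
  refine hL.bind (k := k + 2 * e + 6) hL.spec_zero le_rfl ?_
  rintro _ rfl
  refine hL.bind (k := k + 2 * e + 5) hL.spec_less le_rfl ?_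
  rintro _ rfl
  have hsq : 0 < √s := Real.sqrt_pos.2 hs0
  have hlt : ∀ z : ℤ, (((z * |z| : ℤ) : ℝ) * s < (v * μ) * |v * μ| ↔ (z : ℝ) < v * μ / √s) := by
    intro z
    rw [lt_div_iff₀ hsq, ← mul_abs_lt_iff ((z : ℝ) * √s), abs_mul (z : ℝ), abs_of_pos hsq]
    push_cast
    rw [show (z : ℝ) * √s * (|(z : ℝ)| * √s) = z * |(z : ℝ)| * (√s * √s) by ring,
      Real.mul_self_sqrt hs0.le]
  have hzz : ∀ z : ℤ, |z| ≤ B → V (k + 2 * e) ((z * |z| : ℤ) : ℝ) := by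
    intro z hz
    refine hL.mono (show e + e ≤ k + 2 * e by omega) (hpow (hL.mul_le_pow hBN hBN) ?_)
    rw [abs_mul, abs_abs]
    push_cast
    exact mul_le_mul hz hz (abs_nonneg _) (by positivity)
  have hcount := hL.spec_countBelow hlt hB hzz hs (2 * B) le_rfl
  have hcost : 3 * (2 * B) ≤ N ^ (k + 2 * e + 3) := by
    have h1 : B ≤ N ^ (k + 2 * e) := hBN.trans (hL.pow_le (by omega))
    have h2 := hL.add_le_pow (hL.add_le_pow (hL.add_le_pow h1 h1) (hL.add_le_pow h1 h1))
      (hL.add_le_pow (hL.add_le_pow h1 h1) (hL.add_le_pow h1 h1))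
    rw [show k + 2 * e + 1 + 1 + 1 = k + 2 * e + 3 from rfl] at h2
    omega
  have hfin : PolySpec N V (k + 2 * e + 4) (countBelow B s (v * μ * |v * μ|) (2 * B) >>=
      fun a => Pure.pure ((a : ℤ) - B)) (· = ⌈v * μ / √s⌉) := by
    refine hL.bind (k := k + 2 * e + 3) (hL.raise hcount (by omega) hcost) le_rfl ?_
    intro a ha
    refine Spec.pure ?_
    rw [ha]
    have := le_abs_self ⌈v * μ / √s⌉
    push_cast
    omega
  by_cases h : v * μ < 0
  · rw [if_pos (by simpa using h)]
    refine hL.bind (k := k + 2 * e + 4) (hL.spec_sub (k := k + 2 * e + 4)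
      (hL.mono (by omega) (hL.sub hL.zero hq))) le_rfl ?_
    rintro _ rfl
    rw [abs_of_neg h] at hfin
    rwa [zero_sub, ← mul_neg]
  · rw [if_neg (by simpa using h)]
    rw [abs_of_nonneg (not_lt.1 h)] at hfin
    refine hL.bind (k := k + 2 * e + 4) (Q := (· = v * μ * (v * μ))) (Spec.pure rfl)
      (le_refl (k + 2 * e + 4)) ?_
    rintro _ rfl
    exact hfin

end Levels

end Prog

end PrimalTardos

namespace PrimalTardos

open LP

/-! ## The two-phase simplex method as a program -/

/-- The result of the two-phase simplex method. -/
structure LP.TwoPhasePost {ρ κ : Type} [Fintype ρ] [DecidableEq ρ] [Fintype κ] [DecidableEq κ]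
    (P : LP ρ κ) (R : List (ρ → κ ⊕ ρ) × Prog.Status × Option (Prog.SimplexResult ℝ ρ κ))
    (β₁ : ρ → κ ⊕ ρ) : Prop where
  head : R.1.head? = some Sum.inr
  chain : R.1.IsChain P.phaseOne.DantzigPivot
  last : R.1.getLast? = some β₁
  optimal : P.phaseOne.OptimalTableau β₁
  status : R.2.1 = .optimal
  result : (R.2.2 = none ∧ 0 < P.phaseOne.value (P.phaseOne.basicSol β₁)) ∨
    ∃ β R', β₁ = Sum.inl ∘ β ∧ P.IsFeasibleBasis β ∧ R.2.2 = some R' ∧ P.SimplexPost β R'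

namespace Prog.Levels

variable {N : ℕ} {V : ℕ → ℝ → Prop} (hL : Levels N V)
include hL

lemma spec_twoPhase {ρ κ : Type} [FinEnum ρ] [FinEnum κ] [Fintype ρ] [hρ' : DecidableEq ρ]
    [Fintype κ] [DecidableEq κ] {P : LP ρ κ} {g : ρ → ℤ} (hg : P.rhs = fun i => (g i : ℝ))
    (hM : P.M.IsTotallyUnimodular) (hcard : FinEnum.card κ + FinEnum.card ρ ≤ N) {k e : ℕ}
    (hr : ∀ i, |g i| ≤ 2 ^ N ^ (k + 1)) (hc : ∀ j, V (k + 2) (P.cost j))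
    (hnd₁ : P.phaseOne.Nondegenerate) (hnd : P.Nondegenerate)
    (hK₁ : ∀ T γ, P.phaseOne.PivotPath Sum.inr T γ → T < N ^ e)
    (hK : ∀ β, P.IsFeasibleBasis β → ∀ T γ, P.PivotPath β T γ → T < N ^ e) :
    PolySpec N V (k + e + 24) (twoPhase P.M g P.cost) fun R => ∃ β₁, P.TwoPhasePost R β₁ := by
  obtain rfl : hρ' = FinEnum.decEq := Subsingleton.elim _ _
  have hρN : FinEnum.card ρ ≤ N := by omega
  have hκN : FinEnum.card κ ≤ N := by omega
  have hsN : FinEnum.card (κ ⊕ ρ) ≤ N := by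
    rwa [FinEnum.card_eq_fintypeCard, Fintype.card_sum, ← FinEnum.card_eq_fintypeCard,
      ← FinEnum.card_eq_fintypeCard]
  have hρF : Fintype.card ρ ≤ N := by rwa [← FinEnum.card_eq_fintypeCard]
  have hrV : ∀ i, V k (P.rhs i) := fun i => by rw [hg]; exact hL.int (hr i)
  have hrV₁ : ∀ i, V k (P.phaseOne.rhs i) := fun i => by
    change V k |P.rhs i|
    rw [hg]
    have := hL.int (k := k) (z := |g i|) (by rw [abs_abs]; exact hr i)
    simpa using this
  have hM₁ := phaseOne_isTotallyUnimodular hM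
  have ht₁ : ∀ β, P.phaseOne.IsBasis β → ∀ i j, V (k + 2) (P.phaseOne.tableau β i j) :=
    fun β hβ i j => hL.tableau hM₁ hβ i j
  have hb₁ : ∀ β, P.phaseOne.IsBasis β → ∀ i, V (k + 2) (P.phaseOne.basicVal β i) :=
    fun β hβ i => hL.basicVal_unimodular hM₁ hρF hβ hrV₁ i
  refine hL.bind (k := k + e + 23) hL.spec_zero le_rfl ?_
  rintro _ rfl
  refine hL.bind (k := k + e + 22) hL.spec_one le_rfl ?_
  rintro _ rfl
  have hMt : PolySpec N V 2 (Prog.tab fun i => Prog.tab fun j =>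
      if g i < 0 then Prog.sub 0 (P.M i j) else Pure.pure (P.M i j))
      (· = fun i j => P.phaseOne.M i (Sum.inl j)) := by
    refine hL.spec_tab_eq hρN fun i => hL.spec_tab_eq hκN fun j => ?_
    have hval : P.phaseOne.M i (Sum.inl j) = if g i < 0 then -P.M i j else P.M i j := by
      change (if P.rhs i < 0 then -P.M i j else P.M i j) = _
      simp only [hg, Int.cast_lt_zero]
    have hV : V 0 (P.phaseOne.M i (Sum.inl j)) := hL.sign (hM₁.apply i _)
    rw [hval] at hV ⊢
    by_cases hgi : g i < 0
    · rw [if_pos hgi, if_pos hgi, ← zero_sub]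
      rw [if_pos hgi, ← zero_sub] at hV
      exact hL.spec_sub hV
    · rw [if_neg hgi, if_neg hgi]
      exact Spec.pure rfl
  refine hL.bind (k := k + e + 21) hMt (by omega) ?_
  rintro _ rfl
  have hw : PolySpec N V (k + 1) (Prog.tab fun i => Prog.int |g i|) (· = P.phaseOne.rhs) := by
    refine hL.spec_tab_eq hρN fun i => ?_
    have e1 : P.phaseOne.rhs i = ((|g i| : ℤ) : ℝ) := by
      change |P.rhs i| = _
      simp [hg]
    have := hrV₁ i
    rw [e1] at this ⊢
    exact hL.spec_int this
  refine hL.bind (k := k + e + 20) hw (by omega) ?_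
  rintro _ rfl
  have hT : ((fun i => Sum.elim (fun j => P.phaseOne.M i (Sum.inl j))
      fun i' => if i = i' then (1 : ℝ) else 0, P.phaseOne.rhs) : Tab ℝ ρ (κ ⊕ ρ)) =
      P.phaseOne.tab Sum.inr := by
    refine Prod.ext (funext fun i => funext fun j => ?_) ?_
    · change _ = P.phaseOne.tableau Sum.inr i j
      rw [phaseOne_tableau_inr]
      rcases j with j | j
      · rfl
      · rfl
    · exact (phaseOne_basicVal_inr P).symm
  simp only [hT]
  have hcost₁ : ∀ j, V (k + 2) (P.phaseOne.cost j) := by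
    rintro (j | j)
    · exact hL.zero
    · exact hL.one
  refine hL.bind (k := k + e + 19) (hL.spec_simplex (P := P.phaseOne) hρN hsN ht₁ hb₁ hcost₁ hnd₁
    (phaseOne_isFeasibleBasis P) hK₁) (by omega) ?_
  intro R hR
  have hval : PolySpec N V (k + 5) (Prog.sum fun i =>
      if (R.basis i).isRight = true then Pure.pure (R.tab.2 i) else Prog.int 0)
      (· = P.phaseOne.value (P.phaseOne.basicSol R.basis)) := by
    have hsum : P.phaseOne.value (P.phaseOne.basicSol R.basis) =
        ∑ i, if (R.basis i).isRight = true then P.phaseOne.basicVal R.basis i else 0 := by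
      rw [value_basicSol]
      refine Finset.sum_congr rfl fun i _ => ?_
      rcases R.basis i with j | j
      · change 0 * _ = _; simp
      · change 1 * _ = _; simp
    rw [hsum, hR.tab]
    have hv : ∀ i, V (k + 2)
        (if (R.basis i).isRight = true then P.phaseOne.basicVal R.basis i else 0) := by
      intro i
      split_ifs
      · exact hb₁ _ hR.feasible.1 i
      · exact hL.zero
    refine hL.spec_sum (k := k + 2) hρN (fun i => ?_) hv
    by_cases hi : (R.basis i).isRight = true
    · rw [if_pos hi, if_pos hi]
      exact Spec.pure rfl
    · rw [if_neg hi, if_neg hi]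
      exact hL.spec_zero
  have hopt : R.status = .optimal ∧ P.phaseOne.OptimalTableau R.basis := by
    rcases hR.status with h | h
    · exact h
    · exact absurd h.2 (phaseOne_not_unboundedTableau hR.feasible.1)
  refine hL.bind (k := k + e + 18) hval (by omega) ?_
  rintro _ rfl
  refine hL.bind (k := k + e + 17) (hL.spec_less (k := k + e + 17)) le_rfl ?_
  rintro _ rfl
  by_cases hpos : 0 < P.phaseOne.value (P.phaseOne.basicSol R.basis)
  · rw [if_pos (by simpa using hpos)]
    exact Spec.pure ⟨R.basis, hR.head, hR.chain, hR.last, hopt.2, hopt.1, Or.inl ⟨rfl, hpos⟩⟩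
  · rw [if_neg (by simpa using hpos)]
    have hleft : ∀ i, (R.basis i).isLeft :=
      isLeft_of_phaseOne_value hR.feasible hnd₁ (not_lt.1 hpos)
    rw [dif_pos hleft]
    set β : ρ → κ := fun i => (R.basis i).getLeft (hleft i) with hβ
    have hRβ : R.basis = Sum.inl ∘ β := by
      funext i
      simp [hβ]
    have hfeas := hR.feasible
    rw [hRβ] at hfeas
    have hβf := isFeasibleBasis_of_phaseOne hfeas
    have hT2 : ((fun i j => R.tab.1 i (Sum.inl j), R.tab.2) : Tab ℝ ρ κ) = P.tab β := by
      rw [hR.tab, hRβ]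
      refine Prod.ext (funext fun i => funext fun j => ?_) ?_
      · exact hβf.1.phaseOne_tableau_inl i j
      · exact hβf.1.phaseOne_basicVal_inl
    rw [hT2]
    refine hL.bind (k := k + e + 16) (hL.spec_simplex (k := k + 2) hρN hκN
      (fun β hβ i j => hL.tableau hM hβ i j)
      (fun β hβ i => hL.basicVal_unimodular hM hρF hβ hrV i) hc hnd hβf (hK β hβf))
      (by omega) fun R' hR' => Spec.pure ?_
    exact ⟨R.basis, hR.head, hR.chain, hR.last, hopt.2, hopt.1,
      Or.inr ⟨β, R', hRβ, hβf, rfl, hR'⟩⟩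

end Prog.Levels

end PrimalTardos

namespace PrimalTardos

open LP

/-! ## The main loop -/

namespace Prog

section
variable {m n : ℕ} (A : Fin m → Fin n → ℝ) (b : Fin m → ℝ) (c : Fin n → ℝ) (fuel : ℕ)

/-- The part of the main loop after an optimal basis of the rounded problem has been found. -/
noncomputable def afterOptimal (Kb : Finset (Fin n)) (σ : Fin m → Fin n)
    (pre : List (Config ℝ m n)) (R : SimplexResult ℝ (Row Kb σ) (Col Kb)) :
    Prog ℝ (List (Config ℝ m n)) := do
  let G' ← gauss ((List.finRange n).filter fun j => ∃ i, merge R.basis i = j) (A, b)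
  match G' with
  | none => return pre
  | some ((_, x), τ') => do
    let zero ← int 0
    let bad ← tab fun i => less (x i) zero
    if ∀ i, bad i = false then do
      let y ← scatter τ' (fun _ => true) x
      return pre ++ [.halt (.optimalBasis y)]
    else do
      let big ← int (FinEnum.card (Col Kb))
      let small ← tab fun i => less (R.tab.2 i) big
      let Kb' := Kb ∪ Finset.univ.filter fun j =>
        ∃ i, (R.basis i : Fin n) = j ∧ small i = false
      if (Kb'ᶜ).card = n - m then return pre ++ [.halt .exhausted]
      else do
        let rest ← mainLoop A b c fuel Kb'
          ((List.finRange n).filter fun j => ∃ i, merge R.basis i = j)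
        return pre ++ rest

/-- The part of the main loop after the rounded problem has been solved. -/
noncomputable def afterTwoPhase (Kb : Finset (Fin n)) (σ : Fin m → Fin n) (ℓ : Row Kb σ → Col Kb)
    (Q : List (Row Kb σ → Col Kb ⊕ Row Kb σ) × Status ×
      Option (SimplexResult ℝ (Row Kb σ) (Col Kb))) :
    Prog ℝ (List (Config ℝ m n)) :=
  let pre : List (Config ℝ m n) :=
    [.start Kb, .roundedProblem Kb σ ℓ] ++ Q.1.map (.phaseOne Kb σ ℓ)
  match Q.2 with
  | (.optimal, none) => return pre ++ [.halt .roundedInfeasible]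
  | (.optimal, some R) =>
    match R.status with
    | .timeout => return pre ++ R.visited.map (.phaseTwo Kb σ ℓ)
    | .unbounded => return (pre ++ R.visited.map (.phaseTwo Kb σ ℓ)) ++ [.halt .roundedUnbounded]
    | .optimal => afterOptimal A b c fuel Kb σ (pre ++ R.visited.map (.phaseTwo Kb σ ℓ)) R
  | _ => return pre

/-- The part of the main loop that solves the rounded problem. -/
noncomputable def solveRounded (Kb : Finset (Fin n)) (σ : Fin m → Fin n) (ℓ : Row Kb σ → Col Kb)
    (E : Row Kb σ → Col Kb → ℝ) (v : Row Kb σ → ℝ) (c' : Col Kb → ℝ) :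
    Prog ℝ (List (Config ℝ m n)) := do
  let s ← minNormSq (E, v)
  let g ← tab fun i => ceilScaled (FinEnum.card (Col Kb) *
    (FinEnum.card (Row Kb σ) + FinEnum.card (Col Kb) ^ 2))
    (FinEnum.card (Row Kb σ) + FinEnum.card (Col Kb) ^ 2) s (v i)
  let Q ← twoPhase E g c'
  afterTwoPhase A b c fuel Kb σ ℓ Q

lemma mainLoop_succ (Kb : Finset (Fin n)) (allowed : List (Fin n)) :
    mainLoop A b c (fuel + 1) Kb allowed = (do
      let G ← gauss allowed (A, b)
      match G with
      | none => return [.start Kb]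
      | some ((T, w), σ) => do
        let c' : Col Kb → ℝ ← tab fun j => do
          let z ← sum fun i : {i : Fin m // σ i ∈ Kb} => mul (T i j) (c (σ i))
          sub (c j) z
        let nz ← firstNonzero (fun i : Row Kb σ => w i) (FinEnum.toList (Row Kb σ))
        match nz with
        | none => do
          let x ← scatter σ (fun i => decide (σ i ∈ Kb)) w
          return [.start Kb, .halt (.zeroRhs x)]
        | some _ =>
          solveRounded A b c fuel Kb σ (restBasis Kb σ) (fun i j => T i j)
            (fun i => w i) c') := by
  refine congrArg (gauss allowed (A, b) >>= ·) (funext fun G => ?_)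
  rcases G with - | ⟨⟨T, w⟩, σ⟩
  · rfl
  refine congrArg (_ >>= ·) (funext fun c' => ?_)
  refine congrArg (_ >>= ·) (funext fun nz => ?_)
  rcases nz with - | i
  · rfl
  refine congrArg (_ >>= ·) (funext fun s => ?_)
  refine congrArg (_ >>= ·) (funext fun g => ?_)
  refine congrArg (_ >>= ·) (funext fun Q => ?_)
  rcases Q with ⟨l, _ | _ | _, _ | R⟩
  · rfl
  · rcases R with ⟨_ | _ | _, T, β, l'⟩
    · refine congrArg (_ >>= ·) (funext fun G' => ?_)
      rcases G' with - | ⟨⟨T', x⟩, τ'⟩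
      · rfl
      · rfl
    · rfl
    · rfl
  all_goals rfl

end

end Prog

end PrimalTardos

namespace PrimalTardos

open LP

section
variable {m n : ℕ} {A : Matrix (Fin m) (Fin n) ℝ} {b : Fin m → ℝ} {c : Fin n → ℝ}

/-- The algorithm goes from `s` to `t` through the configurations in `l`. -/
structure Trace (A : Matrix (Fin m) (Fin n) ℝ) (b : Fin m → ℝ) (c : Fin n → ℝ)
    (l : List (Config ℝ m n)) (s t : Config ℝ m n) : Prop where
  head : l.head? = some s
  chain : l.IsChain (Step A b c)
  last : l.getLast? = some t

lemma Trace.singleton (s : Config ℝ m n) : Trace A b c [s] s s := ⟨rfl, by simp, rfl⟩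

lemma Trace.append {l l' : List (Config ℝ m n)} {s t s' t' : Config ℝ m n} (h : Trace A b c l s t)
    (hs : Step A b c t s') (h' : Trace A b c l' s' t') : Trace A b c (l ++ l') s t' where
  head := by rw [List.head?_append, h.head]; rfl
  chain := by
    rw [List.isChain_append]
    refine ⟨h.chain, h'.chain, fun x hx y hy => ?_⟩
    rw [h.last, Option.mem_some_iff] at hx
    rw [h'.head, Option.mem_some_iff] at hy
    subst hx; subst hy
    exact hs
  last := by rw [List.getLast?_append, h'.last]; rfl

lemma Trace.map {α : Type} {R : α → α → Prop} {f : α → Config ℝ m n} {l : List α} {x y : α}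
    (hf : ∀ x y, R x y → Step A b c (f x) (f y)) (hx : l.head? = some x) (hl : l.IsChain R)
    (hy : l.getLast? = some y) : Trace A b c (l.map f) (f x) (f y) where
  head := by rw [List.head?_map, hx]; rfl
  chain := by
    rw [List.isChain_map]
    exact hl.imp fun _ _ h => hf _ _ h
  last := by rw [List.getLast?_map, hy]; rfl

lemma AuxNondegenerate.of_subset {l l' : List (Config ℝ m n)} (h : AuxNondegenerate A b c l)
    (hl : ∀ s ∈ l', s ∈ l) : AuxNondegenerate A b c l' :=
  fun Kb σ ℓ hm => h Kb σ ℓ (hl _ hm)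

lemma rounded_restBasis {Kb : Finset (Fin n)} {σ : Fin m → Fin n} (hσ : Extends A Kb σ) :
    (reduced A b c Kb σ).basicVal (restBasis Kb σ) = (reduced A b c Kb σ).rhs ∧
    (rounded A b c Kb σ (restBasis Kb σ)).M = (reduced A b c Kb σ).M := by
  have h1 : (reduced A b c Kb σ).M.submatrix id (restBasis Kb σ) = 1 := by
    ext i i'
    rw [Matrix.submatrix_apply, id, reduced_M]
    change (original A b c).tableau σ i (σ i') = _
    rw [hσ.isBasis.tableau_basis, Matrix.one_apply]
    simp [Subtype.ext_iff]
  constructor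
  · rw [basicVal, h1, inv_one, Matrix.one_mulVec]
  · change (reduced A b c Kb σ).tableau (restBasis Kb σ) = _
    rw [tableau, h1, inv_one, Matrix.one_mul]

/-- If the basis `τ'` uses only columns of the basis `τ`, then it has the same columns. -/
lemma exists_eq_of_forall_exists {τ τ' : Fin m → Fin n} (hτ' : Function.Injective τ')
    (h : ∀ i, ∃ i', τ i' = τ' i) (i : Fin m) : ∃ i', τ' i' = τ i := by
  have h1 : Finset.univ.image τ' ⊆ Finset.univ.image τ := fun j hj => by
    obtain ⟨i, -, rfl⟩ := Finset.mem_image.1 hj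
    obtain ⟨i', hi'⟩ := h i
    exact Finset.mem_image.2 ⟨i', Finset.mem_univ _, hi'⟩
  have h2 := Finset.eq_of_subset_of_card_le h1 (by
    rw [Finset.card_image_of_injective _ hτ']
    exact Finset.card_image_le)
  have h3 : τ i ∈ Finset.univ.image τ' := by
    rw [h2]; exact Finset.mem_image_of_mem _ (Finset.mem_univ i)
  obtain ⟨i', -, hi'⟩ := Finset.mem_image.1 h3
  exact ⟨i', hi'⟩

lemma basicSol_eq_of_forall_exists {τ τ' : Fin m → Fin n} (hτ : (original A b c).IsBasis τ)
    (hτ' : (original A b c).IsBasis τ') (h : ∀ i, ∃ i', τ i' = τ' i) :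
    (original A b c).basicSol τ' = (original A b c).basicSol τ :=
  hτ.eq_basicSol hτ'.mulVec_basicSol fun j hj => LP.basicSol_of_notMem _ fun i hi => by
    obtain ⟨i', hi'⟩ := h i
    exact hj i' (hi'.trans hi)

end

namespace Prog

section
variable {m n : ℕ} {A : Matrix (Fin m) (Fin n) ℝ} {b : Fin m → ℝ} {c : Fin n → ℝ}

lemma mem_result_bind {α β : Type} {p : Prog ℝ α} {f : α → Prog ℝ (List β)} {s : β}
    (h : ∀ a, s ∈ (f a).result) : s ∈ (p >>= f).result := by
  rw [result_bind]; exact h _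

lemma mem_afterOptimal {fuel : ℕ} {Kb : Finset (Fin n)} {σ : Fin m → Fin n}
    {pre : List (Config ℝ m n)} {R : SimplexResult ℝ (Row Kb σ) (Col Kb)} {s : Config ℝ m n}
    (hs : s ∈ pre) : s ∈ (afterOptimal A b c fuel Kb σ pre R).result := by
  refine mem_result_bind fun G => ?_
  rcases G with - | ⟨⟨T, x⟩, τ⟩
  · exact hs
  refine mem_result_bind fun zero => mem_result_bind fun bad => ?_
  split_ifs
  · exact mem_result_bind fun y => List.mem_append_left _ hs
  · refine mem_result_bind fun big => mem_result_bind fun small => ?_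
    dsimp only
    split_ifs
    · exact List.mem_append_left _ hs
    · exact mem_result_bind fun rest => List.mem_append_left _ hs

lemma mem_solveRounded {fuel : ℕ} {Kb : Finset (Fin n)} {σ : Fin m → Fin n}
    {ℓ : Row Kb σ → Col Kb} {E : Row Kb σ → Col Kb → ℝ} {v : Row Kb σ → ℝ} {c' : Col Kb → ℝ} :
    .roundedProblem Kb σ ℓ ∈ (solveRounded A b c fuel Kb σ ℓ E v c').result := by
  refine mem_result_bind fun s => mem_result_bind fun g => mem_result_bind fun Q => ?_
  have h0 : Config.roundedProblem Kb σ ℓ ∈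
      ([.start Kb, .roundedProblem Kb σ ℓ] ++ Q.1.map (.phaseOne Kb σ ℓ) :
        List (Config ℝ m n)) := by simp
  rcases Q with ⟨l, _ | _ | _, _ | R⟩
  · exact List.mem_append_left _ h0
  · rcases R with ⟨_ | _ | _, T, β, l'⟩
    · exact mem_afterOptimal (List.mem_append_left _ h0)
    · exact List.mem_append_left _ (List.mem_append_left _ h0)
    · exact List.mem_append_left _ h0
  all_goals exact h0

namespace Levels

variable {N : ℕ} {V : ℕ → ℝ → Prop} (hL : Levels N V)
include hL

/-- Sequential composition, where `r` operations are reserved for a recursive call, and a property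
`D` of the result is known. -/
lemma bind_add {α β : Type} {j k l r : ℕ} {p : Prog ℝ α} {f : α → Prog ℝ β} {Q : α → Prop}
    {R D : β → Prop} (hp : PolySpec N V j p Q) (hjk : j ≤ k) (hjl : j ≤ l)
    (hD : D (p >>= f).result)
    (hf : ∀ a, Q a → D (f a).result → Spec (V l) (N ^ k + r) (f a) R) :
    Spec (V l) (N ^ (k + 1) + r) (p >>= f) R := by
  rw [result_bind] at hD
  have h := Spec.bind (Q := fun a => Q a ∧ D (f a).result)
    (⟨(hL.raise hp hjl le_rfl).1, (hL.raise hp hjl le_rfl).2, hp.3, hD⟩ : Spec (V l) (N ^ j) p _)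
    (fun a ha => hf a ha.1 ha.2)
  refine h.mono ?_ fun _ h => h
  have := hL.add_le_pow (hL.pow_le hjk) (le_refl (N ^ k))
  omega

lemma spec_scatter (hN : m + n + 2 ≤ N) (σ : Fin m → Fin n) (keep : Fin m → Bool) {w : Fin m → ℝ}
    {k : ℕ} (hw : ∀ i, V k (w i)) :
    PolySpec N V (k + 4) (scatter σ keep w)
      (· = fun j => ∑ i, if σ i = j ∧ keep i = true then w i else 0) := by
  have hm : FinEnum.card (Fin m) ≤ N := by
    rw [FinEnum.card_eq_fintypeCard, Fintype.card_fin]; omega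
  have hn : FinEnum.card (Fin n) ≤ N := by
    rw [FinEnum.card_eq_fintypeCard, Fintype.card_fin]; omega
  refine hL.spec_tab_eq (k := k + 3) hn fun j => hL.spec_sum hm (fun i => ?_) fun i => ?_
  · by_cases h : σ i = j ∧ keep i = true
    · rw [if_pos h, if_pos h]; exact Spec.pure rfl
    · rw [if_neg h, if_neg h]; exact hL.spec_zero
  · split_ifs
    · exact hw i
    · exact hL.zero

lemma basicVal_original (hA : Admissible A b c) (hN : m + n + 2 ≤ N) (hb : ∀ i, V 0 (b i))
    {τ : Fin m → Fin n} (hτ : (original A b c).IsBasis τ) (i : Fin m) :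
    V 2 ((original A b c).basicVal τ i) :=
  hL.basicVal_unimodular (P := original A b c) hA.1 (by simp; omega) hτ hb i

lemma spec_gauss_original (hA : Admissible A b c) (hN : m + n + 2 ≤ N) (hb : ∀ i, V 0 (b i))
    {β₀ : Fin m → Fin n} (hβ₀ : (original A b c).IsBasis β₀) {allowed : List (Fin n)}
    (hall : ∀ i, β₀ i ∈ allowed) (hlen : allowed.length ≤ n) :
    PolySpec N V 15 (gauss allowed ((A, b) : Tab ℝ (Fin m) (Fin n))) fun R =>
      ∃ σ, R = some ((original A b c).tab σ, σ) ∧ (original A b c).IsBasis σ ∧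
        ∀ i, σ i ∈ allowed := by
  have hTU : (original A b c).withUnits.M.IsTotallyUnimodular :=
    withUnits_isTotallyUnimodular hA.1
  exact hL.spec_gauss (P := original A b c) (k := 2) hβ₀ hall (by omega)
    (by rw [FinEnum.card_eq_fintypeCard, Fintype.card_fin]; omega)
    (by rw [FinEnum.card_eq_fintypeCard, Fintype.card_fin]; omega)
    (fun γ hγ i j => hL.tableau hTU hγ i j)
    (fun γ hγ i => hL.basicVal_unimodular hTU (by simp; omega) hγ hb i)

end Levels

end

end Prog

end PrimalTardos

namespace PrimalTardos

open LP

section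
variable {m n : ℕ} {A : Matrix (Fin m) (Fin n) ℝ} {b : Fin m → ℝ} {c : Fin n → ℝ}

/-- The invariant of the main loop. -/
structure LoopInv (A : Matrix (Fin m) (Fin n) ℝ) (b : Fin m → ℝ) (c : Fin n → ℝ)
    (Kb : Finset (Fin n)) (allowed : List (Fin n)) : Prop where
  good : GoodSet A b c Kb
  basis : ∃ τ, (original A b c).IsBasis τ ∧ ∀ i, τ i ∈ allowed
  ext : ∀ τ, (original A b c).IsBasis τ → (∀ i, τ i ∈ allowed) → Extends A Kb τ
  length_le : allowed.length ≤ n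

lemma LoopInv.init (hA : Admissible A b c) : LoopInv A b c ∅ (List.finRange n) where
  good := goodSet_empty hA
  basis := by
    obtain ⟨τ, hτ⟩ := exists_isBasis (b := b) (c := c) hA.2.1
    exact ⟨τ, hτ, by simp⟩
  ext := fun τ hτ _ => ⟨hτ, by simp⟩
  length_le := by simp

/-- The columns of a basis. -/
def columns (τ : Fin m → Fin n) : List (Fin n) := (List.finRange n).filter fun j => ∃ i, τ i = j

lemma mem_columns {τ : Fin m → Fin n} {j : Fin n} : j ∈ columns τ ↔ ∃ i, τ i = j := by
  simp [columns]

lemma length_columns_le (τ : Fin m → Fin n) : (columns τ).length ≤ n :=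
  (List.length_filter_le _ _).trans (by simp)

lemma LoopInv.of_columns {Kb : Finset (Fin n)} {τ : Fin m → Fin n} (hK : GoodSet A b c Kb)
    (hτ : (original A b c).IsBasis τ) (h : ∀ j ∈ Kb, ∃ i, τ i = j) :
    LoopInv A b c Kb (columns τ) where
  good := hK
  basis := ⟨τ, hτ, fun i => mem_columns.2 ⟨i, rfl⟩⟩
  ext := fun τ' hτ' h' => ⟨hτ', fun j hj => by
    obtain ⟨i, rfl⟩ := h j hj
    exact exists_eq_of_forall_exists hτ'.injective (fun i => mem_columns.1 (h' i)) i⟩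
  length_le := length_columns_le τ

lemma largeSet_eq {Kb : Finset (Fin n)} {σ : Fin m → Fin n} {ℓ β : Row Kb σ → Col Kb}
    (hβ : (rounded A b c Kb σ ℓ).IsBasis β) {small : Row Kb σ → Bool}
    (hs : ∀ i, small i = decide ((rounded A b c Kb σ ℓ).basicVal β i < Fintype.card (Col Kb))) :
    (Finset.univ.filter fun j => ∃ i, (β i : Fin n) = j ∧ small i = false) =
      largeSet A b c Kb σ ℓ β := by
  ext j
  simp only [largeSet, Finset.mem_filter, Finset.mem_univ, true_and]
  constructor
  · rintro ⟨i, rfl, hi⟩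
    refine ⟨(β i).2, ?_⟩
    rw [hs, decide_eq_false_iff_not, not_lt] at hi
    change _ ≤ (rounded A b c Kb σ ℓ).basicSol β (β i)
    rwa [hβ.basicSol_apply]
  · rintro ⟨h, hle⟩
    by_cases hj : ∃ i, β i = ⟨j, h⟩
    · obtain ⟨i, hi⟩ := hj
      refine ⟨i, by rw [hi], ?_⟩
      rw [← hi, hβ.basicSol_apply] at hle
      rw [hs, decide_eq_false_iff_not, not_lt]
      exact hle
    · push Not at hj
      rw [basicSol_of_notMem _ hj] at hle
      have : Nonempty (Col Kb) := ⟨⟨j, h⟩⟩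
      have h2 : (0 : ℝ) < Fintype.card (Col Kb) := by exact_mod_cast Fintype.card_pos
      exact absurd hle (not_le.2 h2)

namespace Prog.Levels

variable {N : ℕ} {V : ℕ → ℝ → Prop} (hL : Levels N V)
include hL

lemma spec_afterOptimal (hA : Admissible A b c) (hN : m + n + 2 ≤ N) (hb : ∀ i, V 0 (b i))
    {fuel : ℕ} (ih : ∀ Kb allowed, LoopInv A b c Kb allowed → n + 1 ≤ fuel + Kb.card →
      AuxNondegenerate A b c (mainLoop A b c fuel Kb allowed).result →
      Spec (V 60) (fuel * N ^ 60) (mainLoop A b c fuel Kb allowed)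
        fun l => ∃ o, Trace A b c l (.start Kb) (.halt o))
    {Kb : Finset (Fin n)} {σ : Fin m → Fin n} {ℓ β : Row Kb σ → Col Kb}
    (hC : Context A b c Kb σ ℓ) (hfuel : n + 1 ≤ fuel + 1 + Kb.card)
    {R : SimplexResult ℝ (Row Kb σ) (Col Kb)} (hR : (rounded A b c Kb σ ℓ).SimplexPost β R)
    (ho : (rounded A b c Kb σ ℓ).OptimalTableau R.basis) {pre : List (Config ℝ m n)}
    (hpre : Trace A b c pre (.start Kb) (.phaseTwo Kb σ ℓ R.basis))
    (hD : AuxNondegenerate A b c (afterOptimal A b c fuel Kb σ pre R).result) :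
    Spec (V 60) (N ^ 30 + fuel * N ^ 60) (afterOptimal A b c fuel Kb σ pre R)
      fun l => ∃ o, Trace A b c l (.start Kb) (.halt o) := by
  have hm : FinEnum.card (Fin m) ≤ N := by
    rw [FinEnum.card_eq_fintypeCard, Fintype.card_fin]; omega
  have hcol : Fintype.card (Col Kb) + Kb.card = n := card_col
  have hrow : Fintype.card (Row Kb σ) + Kb.card = m := hC.ext.card_row
  have hfe := hR.feasible
  obtain ⟨hb1, hb2⟩ := optimalTableau_of_rounded hC.ext hC.basis hfe.1 ho
  refine hL.bind_add (k := 29) (hL.spec_gauss_original hA hN hb hb1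
    (fun i => mem_columns.2 ⟨i, rfl⟩) (length_columns_le _)) (by norm_num) (by norm_num) hD ?_
  rintro _ ⟨τ', rfl, hτ', hτ'm⟩ hD
  have hmem : ∀ i, ∃ i', merge R.basis i' = τ' i := fun i => mem_columns.1 (hτ'm i)
  refine hL.bind_add (k := 28) hL.spec_zero le_rfl (by norm_num) hD ?_
  rintro _ rfl hD
  refine hL.bind_add (k := 27) (hL.spec_tab_eq (k := 26) hm fun i => hL.spec_less)
    le_rfl (by norm_num) hD ?_
  rintro _ rfl hD
  have hsol := basicSol_eq_of_forall_exists hb1 hτ' hmem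
  have hnonneg : (∀ i, decide ((original A b c).basicVal τ' i < 0) = false) ↔
      IsOptimalBasis A b c (merge R.basis) := by
    rw [isOptimalBasis_iff hC.ext hC.basis ho hfe.1]
    have h1 : (∀ i, decide ((original A b c).basicVal τ' i < 0) = false) ↔
        0 ≤ (original A b c).basicVal τ' := by
      simp only [decide_eq_false_iff_not, not_lt]
      rfl
    rw [h1]
    constructor
    · intro h
      exact hb1.nonneg_of_basicSol (hsol ▸ basicSol_nonneg _ h)
    · intro h
      exact hτ'.nonneg_of_basicSol (hsol ▸ basicSol_nonneg _ h)
  by_cases hopt : IsOptimalBasis A b c (merge R.basis)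
  · rw [if_pos (hnonneg.2 hopt)]
    refine Spec.mono (c := N ^ 27 + 0) (Spec.bind (hL.raise (hL.spec_scatter hN τ'
      (fun _ => true) (fun i => hL.basicVal_original hA hN hb hτ' i)) (by norm_num)
      (hL.pow_le (by norm_num))) ?_) (by omega) fun _ h => h
    rintro _ rfl
    refine Spec.pure ⟨_, hpre.append ?_ (Trace.singleton _)⟩
    have e : (fun j => ∑ i, if τ' i = j ∧ true = true then (original A b c).basicVal τ' i else 0) =
        (original A b c).basicSol (merge R.basis) := by
      rw [← hsol]
      simp only [and_true]
      rfl
    change Step A b c _ (.halt (.optimalBasis fun j =>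
      ∑ i, if τ' i = j ∧ true = true then (original A b c).basicVal τ' i else 0))
    rw [e]
    exact .optimal Kb σ ℓ R.basis ho hopt
  · rw [if_neg (mt hnonneg.1 hopt)] at hD ⊢
    have hn' : FinEnum.card (Col Kb) = Fintype.card (Col Kb) := FinEnum.card_eq_fintypeCard
    refine hL.bind_add (k := 26) (hL.spec_int (k := 1) (z := (FinEnum.card (Col Kb) : ℤ))
      (hL.int ?_)) (by norm_num) (by norm_num) hD ?_
    · have h1 : FinEnum.card (Col Kb) ≤ N ^ (1 + 1) := by
        rw [hn']
        exact (show Fintype.card (Col Kb) ≤ N by omega).trans (Nat.le_self_pow (by norm_num) _)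
      have h2 := h1.trans Nat.lt_two_pow_self.le
      rw [Nat.abs_cast]
      exact_mod_cast h2
    rintro _ rfl hD
    refine hL.bind_add (k := 25) (hL.spec_tab_eq (k := 24) (by
      rw [FinEnum.card_eq_fintypeCard]; omega) fun i => hL.spec_less)
      le_rfl (by norm_num) hD ?_
    rintro _ rfl hD
    have hset := largeSet_eq hfe.1 (small := fun i => decide (R.tab.2 i <
      ((FinEnum.card (Col Kb) : ℤ) : ℝ))) fun i => by
        rw [hR.tab, hn', Int.cast_natCast]; rfl
    dsimp only at hD ⊢
    rw [hset] at hD ⊢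
    have hcardlt := card_lt_card_union_largeSet hC.basis hC.ne_zero hfe
    by_cases hex : ((Kb ∪ largeSet A b c Kb σ ℓ R.basis)ᶜ).card = n - m
    · rw [if_pos hex]
      exact Spec.pure ⟨_, hpre.append (.exhausted Kb σ ℓ R.basis ho hopt hex) (Trace.singleton _)⟩
    · rw [if_neg hex] at hD ⊢
      have hgood := hC.good.union_largeSet hA hC.ext hC.basis hC.ne_zero hfe ho
      rw [result_bind] at hD
      have hrec := ih _ (columns (merge R.basis)) (LoopInv.of_columns hgood hb1 fun j hj =>
        mem_range_of_mem_largeSet hC.ext hC.basis hC.ne_zero hfe hj) (by omega)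
        (hD.of_subset fun s hs => List.mem_append_right _ hs)
      refine Spec.mono (c := fuel * N ^ 60 + 0) (Spec.bind hrec ?_) (by omega) fun _ h => h
      rintro l ⟨o, hl⟩
      exact Spec.pure ⟨o, hpre.append (.iterate Kb σ ℓ R.basis ho hopt hex) hl⟩

lemma spec_solveRounded (hA : Admissible A b c) (hN : m + n + 2 ≤ N) (hb : ∀ i, V 0 (b i))
    {fuel : ℕ} (ih : ∀ Kb allowed, LoopInv A b c Kb allowed → n + 1 ≤ fuel + Kb.card →
      AuxNondegenerate A b c (mainLoop A b c fuel Kb allowed).result →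
      Spec (V 60) (fuel * N ^ 60) (mainLoop A b c fuel Kb allowed)
        fun l => ∃ o, Trace A b c l (.start Kb) (.halt o))
    {Kb : Finset (Fin n)} {σ : Fin m → Fin n} (hK : GoodSet A b c Kb) (hσ : Extends A Kb σ)
    (h0 : (reduced A b c Kb σ).rhs ≠ 0) (hcost : ∀ j, V 3 ((reduced A b c Kb σ).cost j))
    (hfuel : n + 1 ≤ fuel + 1 + Kb.card)
    (hD : AuxNondegenerate A b c (solveRounded A b c fuel Kb σ (restBasis Kb σ)
      (reduced A b c Kb σ).M (reduced A b c Kb σ).rhs (reduced A b c Kb σ).cost).result) :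
    Spec (V 60) (N ^ 53 + fuel * N ^ 60) (solveRounded A b c fuel Kb σ (restBasis Kb σ)
      (reduced A b c Kb σ).M (reduced A b c Kb σ).rhs (reduced A b c Kb σ).cost)
      fun l => ∃ o, Trace A b c l (.start Kb) (.halt o) := by
  set ℓ := restBasis Kb σ with hℓ
  obtain ⟨hbv, hRM⟩ := rounded_restBasis (b := b) (c := c) hσ
  rw [← hℓ] at hbv hRM
  obtain ⟨hnd₁, hnd⟩ := hD Kb σ ℓ mem_solveRounded
  have hC : Context A b c Kb σ ℓ :=
    ⟨hK, hσ, hσ.restBasis_isBasis, by rw [hbv]; exact h0, hnd₁, hnd⟩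
  have hMr : (reduced A b c Kb σ).M.IsTotallyUnimodular := hσ.reduced_isTotallyUnimodular hA.1
  have hcol : Fintype.card (Col Kb) + Kb.card = n := card_col
  have hrow : Fintype.card (Row Kb σ) + Kb.card = m := hσ.card_row
  have hm' : FinEnum.card (Row Kb σ) = Fintype.card (Row Kb σ) := FinEnum.card_eq_fintypeCard
  have hn' : FinEnum.card (Col Kb) = Fintype.card (Col Kb) := FinEnum.card_eq_fintypeCard
  have hrhs : ∀ i, V 2 ((reduced A b c Kb σ).rhs i) := fun i => by
    rw [reduced_rhs]
    exact hL.basicVal_original hA hN hb hσ.isBasis i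
  refine hL.bind_add (k := 52) (hL.spec_minNormSq hMr hC.basis (by omega) (by omega) hrhs)
    (by norm_num) (by norm_num) hD ?_
  rintro s ⟨hs, hsV⟩ hD
  set n' := FinEnum.card (Col Kb) with hn'def
  set m' := FinEnum.card (Row Kb σ) with hm'def
  have hspos : 0 < s := by rw [hs]; exact minNormSol_pos hC.basis hC.ne_zero
  have hround : ∀ i, (reduced A b c Kb σ).rhs i * ((m' + n' ^ 2 : ℕ) : ℝ) / √s =
      (reduced A b c Kb σ).basicVal ℓ i / scale (reduced A b c Kb σ) := fun i => by
    rw [hbv, scale_eq, hs, hm', hn', div_div_eq_mul_div]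
    push_cast
    rfl
  have hμ : m' + n' ^ 2 ≤ N ^ 3 := by
    have h1 : m' ≤ N ^ 2 := (show m' ≤ N by omega).trans (Nat.le_self_pow (by norm_num) _)
    exact hL.add_le_pow h1 (Nat.pow_le_pow_left (by omega) 2)
  have hB : n' * (m' + n' ^ 2) ≤ N ^ 4 := hL.mul_le_pow_succ (by omega) hμ
  have hbd : ∀ i, |⌈(reduced A b c Kb σ).basicVal ℓ i / scale (reduced A b c Kb σ)⌉| ≤
      ((n' * (m' + n' ^ 2) : ℕ) : ℤ) := fun i => by
    rw [hm', hn']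
    exact abs_rounded_rhs_le hC.basis hC.ne_zero hMr i
  refine hL.bind_add (k := 51) (hL.spec_tab_eq (k := 19)
    (g := fun i => ⌈(reduced A b c Kb σ).basicVal ℓ i / scale (reduced A b c Kb σ)⌉)
    (by omega) fun i => ?_) (by norm_num) (by norm_num) hD ?_
  · have := hL.spec_ceilScaled (e := 4) (k := 1) (v := (reduced A b c Kb σ).rhs i) hspos
      (by rw [hround]; exact hbd i) hB (hμ.trans (hL.pow_le (by norm_num))) hsV
      (hL.mono (by norm_num) (hrhs i))
    rw [hround] at this
    exact this
  rintro _ rfl hD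
  have hlog : n * boundLog m n < N ^ 18 := by
    have h1 : boundArg m n ≤ N ^ 8 := by
      unfold boundArg
      have e1 : m ^ 4 * n ≤ N ^ 6 := (Nat.mul_le_mul (Nat.pow_le_pow_left (show m ≤ N by omega) 4)
        (show n ≤ N by omega)).trans (by rw [← pow_succ]; exact hL.pow_le (by norm_num))
      have e2 : m ^ 3 * n ^ 3 ≤ N ^ 6 := by
        rw [show 6 = 3 + 3 from rfl, pow_add]
        exact Nat.mul_le_mul (Nat.pow_le_pow_left (by omega) 3)
          (Nat.pow_le_pow_left (by omega) 3)
      have e3 : m ^ 2 ≤ N ^ 7 := (Nat.pow_le_pow_left (by omega) 2).trans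
        (hL.pow_le (by norm_num))
      exact hL.add_le_pow (hL.add_le_pow e1 e2) e3
    have h2 : boundLog m n ≤ N ^ 16 := (boundLog_le m n).trans
      ((Nat.pow_le_pow_left h1 2).trans (by rw [← pow_mul]))
    calc n * boundLog m n ≤ n * N ^ 16 := Nat.mul_le_mul_left _ h2
      _ < N * N ^ 16 := Nat.mul_lt_mul_of_pos_right (by omega) (hL.one_le_pow 16)
      _ ≤ N ^ 18 := by rw [← pow_succ']; exact hL.pow_le (by norm_num)
  have htwo := hL.spec_twoPhase (P := rounded A b c Kb σ ℓ) (k := 3) (e := 18)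
    (g := fun i => ⌈(reduced A b c Kb σ).basicVal ℓ i / scale (reduced A b c Kb σ)⌉) rfl
    (hC.isTotallyUnimodular hA) (by omega) (fun i => (hbd i).trans ?_)
    (fun j => hL.mono (by norm_num) (hcost j)) hnd₁ hnd
    (fun T γ hp => (hC.phaseOne_length hA hp).trans_lt hlog)
    (fun β hβ T γ hp => ((hC.phaseTwo_length hA hβ hp).trans
      (Nat.mul_le_mul_right _ (Nat.sub_le n 1))).trans_lt hlog)
  rotate_left
  · have h2 := hB.trans Nat.lt_two_pow_self.le
    exact_mod_cast h2
  rw [hRM] at htwo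
  refine hL.bind_add (k := 50) htwo (by norm_num) (by norm_num) hD ?_
  rintro ⟨l₁, st, ro⟩ ⟨β₁, hQ⟩ hD
  obtain ⟨hq1, hq2, hq3, hq4, hq5, hq6⟩ := hQ
  simp only at hq1 hq2 hq3 hq5 hq6
  subst hq5
  have hne : (reduced A b c Kb σ).basicVal ℓ ≠ 0 := hC.ne_zero
  have htr : Trace A b c ([.start Kb, .roundedProblem Kb σ ℓ] ++ l₁.map (.phaseOne Kb σ ℓ))
      (.start Kb) (.phaseOne Kb σ ℓ β₁) := by
    refine Trace.append (t := .roundedProblem Kb σ ℓ) (s' := .phaseOne Kb σ ℓ Sum.inr) ?_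
      (.phaseOneInit Kb σ ℓ) (Trace.map (fun x y h => .phaseOnePivot Kb σ ℓ x y h) hq1 hq2 hq3)
    exact (Trace.singleton (.start Kb)).append (.round Kb σ ℓ hσ hC.basis hne)
      (Trace.singleton _)
  rcases hq6 with ⟨rfl, hpos⟩ | ⟨β, R, rfl, hβ, rfl, hR⟩
  · exact Spec.pure ⟨_, htr.append (.infeasible Kb σ ℓ β₁ hq4 hpos) (Trace.singleton _)⟩
  · have htr2 : Trace A b c (([.start Kb, .roundedProblem Kb σ ℓ] ++
        l₁.map (.phaseOne Kb σ ℓ)) ++ R.visited.map (.phaseTwo Kb σ ℓ))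
        (.start Kb) (.phaseTwo Kb σ ℓ R.basis) :=
      htr.append (.phaseTwoInit Kb σ ℓ β hq4)
        (Trace.map (fun x y h => .phaseTwoPivot Kb σ ℓ x y h) hR.head hR.chain hR.last)
    rcases hR.status with ⟨hst, ho⟩ | ⟨hst, hu⟩
    · have e : afterTwoPhase A b c fuel Kb σ ℓ (l₁, .optimal, some R) =
          afterOptimal A b c fuel Kb σ (([.start Kb, .roundedProblem Kb σ ℓ] ++
            l₁.map (.phaseOne Kb σ ℓ)) ++ R.visited.map (.phaseTwo Kb σ ℓ)) R := by
        simp only [afterTwoPhase, hst]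
      rw [e] at hD ⊢
      refine (hL.spec_afterOptimal hA hN hb ih hC hfuel hR ho htr2 hD).mono ?_ fun _ h => h
      exact Nat.add_le_add_right (hL.pow_le (by norm_num)) _
    · have e : afterTwoPhase A b c fuel Kb σ ℓ (l₁, .optimal, some R) =
          Pure.pure ((([.start Kb, .roundedProblem Kb σ ℓ] ++
            l₁.map (.phaseOne Kb σ ℓ)) ++ R.visited.map (.phaseTwo Kb σ ℓ)) ++
            [.halt .roundedUnbounded]) := by
        simp only [afterTwoPhase, hst]
      rw [e]
      exact Spec.pure ⟨_, htr2.append (.unbounded Kb σ ℓ R.basis hu) (Trace.singleton _)⟩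

lemma spec_mainLoop (hA : Admissible A b c) (hN : m + n + 2 ≤ N) (hb : ∀ i, V 0 (b i))
    (hc : ∀ j, V 0 (c j)) : ∀ (fuel : ℕ) (Kb : Finset (Fin n)) (allowed : List (Fin n)),
      LoopInv A b c Kb allowed → n + 1 ≤ fuel + Kb.card →
      AuxNondegenerate A b c (mainLoop A b c fuel Kb allowed).result →
      Spec (V 60) (fuel * N ^ 60) (mainLoop A b c fuel Kb allowed)
        fun l => ∃ o, Trace A b c l (.start Kb) (.halt o) := by
  intro fuel
  induction fuel with
  | zero =>
    intro Kb allowed hI hfuel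
    have := hI.good.card_le
    omega
  | succ fuel ih =>
    intro Kb allowed hI hfuel hD
    have hcol : Fintype.card (Col Kb) + Kb.card = n := card_col
    rw [mainLoop_succ A b c fuel Kb allowed] at hD ⊢
    have e : N ^ 56 + fuel * N ^ 60 ≤ (fuel + 1) * N ^ 60 := by
      rw [Nat.succ_mul]
      have := hL.pow_le (show 56 ≤ 60 by norm_num)
      omega
    refine Spec.mono ?_ e fun _ h => h
    obtain ⟨β₀, hβ₀, hall⟩ := hI.basis
    refine hL.bind_add (k := 55) (hL.spec_gauss_original hA hN hb hβ₀ hall hI.length_le)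
      (by norm_num) (by norm_num) hD ?_
    rintro _ ⟨σ, rfl, hσb, hσa⟩ hD
    have hσ := hI.ext σ hσb hσa
    have hrow : Fintype.card (Row Kb σ) + Kb.card = m := hσ.card_row
    have hsub : Fintype.card {i : Fin m // σ i ∈ Kb} ≤ m :=
      (Fintype.card_subtype_le _).trans (by simp)
    have hprod : ∀ (i : Fin m) (j : Fin n), V 1 ((original A b c).tableau σ i j * c (σ i)) :=
      fun i j => hL.mul (hL.tableau (P := original A b c) hA.1 hσb i j) (hc _)
    have hcostV : ∀ j, V 3 ((reduced A b c Kb σ).cost j) := fun j =>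
      hL.sub (k := 2) (hL.mono (by norm_num) (hc j)) (hL.sum (k := 1) (by omega)
        fun i : {i : Fin m // σ i ∈ Kb} => hprod i j)
    refine hL.bind_add (k := 54) (hL.spec_tab_eq (k := 5) (g := (reduced A b c Kb σ).cost)
      (by rw [FinEnum.card_eq_fintypeCard]; omega) fun j => ?_) (by norm_num) (by norm_num) hD ?_
    · refine hL.bind (k := 4) (hL.spec_sum (k := 1)
        (g := fun i : {i : Fin m // σ i ∈ Kb} => (original A b c).tableau σ i j * c (σ i))
        (by rw [FinEnum.card_eq_fintypeCard]; omega)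
        (fun i => hL.spec_mul (hprod i j)) fun i => hprod i j) le_rfl ?_
      rintro _ rfl
      exact hL.spec_sub (hL.mono (by norm_num) (hcostV j))
    rintro _ rfl hD
    refine hL.bind_add (k := 53) (hL.spec_firstNonzero _ (by
      rw [length_toList, FinEnum.card_eq_fintypeCard]; omega)) (by norm_num) (by norm_num) hD ?_
    have hrhs : (fun i : Row Kb σ => ((original A b c).tab σ).2 i) = (reduced A b c Kb σ).rhs :=
      rfl
    have hMM : (fun (i : Row Kb σ) (j : Col Kb) => ((original A b c).tab σ).1 i j) =
      (reduced A b c Kb σ).M := rfl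
    rintro o (⟨rfl, hz⟩ | ⟨i, -, rfl, hi⟩) hD
    · have h0 : (reduced A b c Kb σ).basicVal (restBasis Kb σ) = 0 := by
        rw [(rounded_restBasis hσ).1]
        exact funext fun i => hz i (by simp)
      refine Spec.mono (c := N ^ 53 + 0) (Spec.bind (hL.raise (hL.spec_scatter hN σ
        (fun i => decide (σ i ∈ Kb)) (fun i => hL.basicVal_original hA hN hb hσb i))
        (by norm_num) (hL.pow_le (by norm_num))) ?_) (by omega) fun _ h => h
      rintro _ rfl
      refine Spec.pure ⟨_, (Trace.singleton (.start Kb)).append ?_ (Trace.singleton _)⟩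
      have := Step.zeroRhs (b := b) (c := c) Kb σ _ hσ hσ.restBasis_isBasis h0
      simp only [decide_eq_true_eq]
      exact this
    · exact hL.spec_solveRounded hA hN hb ih hI.good hσ
        (fun h => hi (congrFun h i)) hcostV (by omega) hD

/-- The program follows the algorithm until it stops. -/
lemma spec_tardos (hA : Admissible A b c) (hN : m + n + 2 ≤ N) (hb : ∀ i, V 0 (b i))
    (hc : ∀ j, V 0 (c j)) (hD : AuxNondegenerate A b c (tardos A b c).result) :
    PolySpec N V 61 (tardos A b c) fun l => ∃ o, Trace A b c l (.start ∅) (.halt o) :=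
  hL.raise (hL.spec_mainLoop hA hN hb hc (n + 1) ∅ (List.finRange n) (LoopInv.init hA)
    (by simp) hD) (by norm_num) (hL.mul_le_pow_succ (by omega) le_rfl)

end Prog.Levels

end

end PrimalTardos

namespace PrimalTardos

namespace Prog

/-! ## Sizes of rational numbers -/

/-- `v` is a fraction of integers with about `e` bits. -/
def IsFrac (e : ℕ) (v : ℝ) : Prop :=
  ∃ p q : ℤ, q ≠ 0 ∧ |p| ≤ 2 ^ e ∧ |q| ≤ 2 ^ e ∧ v = p / q

lemma IsFrac.mono {e f : ℕ} {v : ℝ} (h : IsFrac e v) (hef : e ≤ f) : IsFrac f v := by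
  obtain ⟨p, q, hq, h1, h2, h3⟩ := h
  have := pow_le_pow_right₀ (show (1 : ℤ) ≤ 2 by norm_num) hef
  exact ⟨p, q, hq, h1.trans this, h2.trans this, h3⟩

lemma IsFrac.of_int {e : ℕ} {z : ℤ} (hz : |z| ≤ 2 ^ e) : IsFrac e z :=
  ⟨z, 1, one_ne_zero, hz, by simpa using one_le_pow₀ (show (1 : ℤ) ≤ 2 by norm_num), by simp⟩

lemma abs_mul_le_two_pow {x y : ℤ} {e f : ℕ} (hx : |x| ≤ 2 ^ e) (hy : |y| ≤ 2 ^ f) :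
    |x * y| ≤ 2 ^ (e + f) := by
  rw [abs_mul, pow_add]
  exact mul_le_mul hx hy (abs_nonneg _) (by positivity)

lemma IsFrac.arith {e f : ℕ} {x y : ℝ} (o : Arith) (hx : IsFrac e x) (hy : IsFrac f y) :
    IsFrac (e + f + 1) (evalArith o x y) := by
  obtain ⟨p, q, hq, h1, h2, rfl⟩ := hx
  obtain ⟨r, s, hs, h3, h4, rfl⟩ := hy
  have hq' : (q : ℝ) ≠ 0 := by exact_mod_cast hq
  have hs' : (s : ℝ) ≠ 0 := by exact_mod_cast hs
  have hup : (2 : ℤ) ^ (e + f) ≤ 2 ^ (e + f + 1) :=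
    pow_le_pow_right₀ (by norm_num) (Nat.le_succ _)
  have hps := abs_mul_le_two_pow h1 h4
  have hqr := abs_mul_le_two_pow h2 h3
  have hqs := (abs_mul_le_two_pow h2 h4).trans hup
  have hpr := (abs_mul_le_two_pow h1 h3).trans hup
  have hsum : (2 : ℤ) ^ (e + f + 1) = 2 ^ (e + f) + 2 ^ (e + f) := by rw [pow_succ]; ring
  cases o with
  | add =>
    refine ⟨p * s + q * r, q * s, mul_ne_zero hq hs, ?_, hqs, ?_⟩
    · have := abs_add_le (p * s) (q * r)
      omega
    · simp only [evalArith]; push_cast; rw [div_add_div _ _ hq' hs']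
  | sub =>
    refine ⟨p * s - q * r, q * s, mul_ne_zero hq hs, ?_, hqs, ?_⟩
    · have := abs_sub (p * s) (q * r)
      omega
    · simp only [evalArith]; push_cast; rw [div_sub_div _ _ hq' hs']
  | mul =>
    refine ⟨p * r, q * s, mul_ne_zero hq hs, hpr, hqs, ?_⟩
    simp only [evalArith]; push_cast; rw [div_mul_div_comm]
  | div =>
    by_cases hr : r = 0
    · subst hr
      refine ⟨0, 1, one_ne_zero, by simp, ?_, by simp [evalArith]⟩
      simpa using one_le_pow₀ (show (1 : ℤ) ≤ 2 by norm_num)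
    · have hr' : (r : ℝ) ≠ 0 := by exact_mod_cast hr
      refine ⟨p * s, q * r, mul_ne_zero hq hr, hps.trans hup, hqr.trans hup, ?_⟩
      simp only [evalArith]; push_cast; rw [div_div_div_eq]

lemma IsFrac.list_sum {ι : Type} {e : ℕ} {f : ι → ℝ} : ∀ {l : List ι},
    (∀ i ∈ l, IsFrac e (f i)) → IsFrac (l.length * (e + 1)) (l.map f).sum
  | [], _ => ⟨0, 1, one_ne_zero, by simp, by simp, by simp⟩
  | i :: l, h => by
    have h1 := (h i (by simp)).arith .add (IsFrac.list_sum (l := l) fun j hj => h j (by simp [hj]))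
    rw [List.map_cons, List.sum_cons, List.length_cons, Nat.succ_mul]
    exact h1.mono (by omega)

lemma levels_true {N : ℕ} (hN : 2 ≤ N) : Levels N fun _ _ => True :=
  ⟨hN, fun _ _ => trivial, fun _ => trivial, fun _ _ _ => trivial, fun _ _ => trivial⟩

lemma levels_isFrac {N : ℕ} (hN : 2 ≤ N) : Levels N fun k v => IsFrac (N ^ (3 * k + 1)) v where
  two_le := hN
  mono := fun hjk h => h.mono (Nat.pow_le_pow_right (by omega) (by omega))
  int := fun hz => IsFrac.of_int (hz.trans (pow_le_pow_right₀ (by norm_num)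
    (Nat.pow_le_pow_right (by omega) (by omega))))
  arith := fun {k x y} o hx hy => (hx.arith o hy).mono (by
    have h := (levels_true hN).add_le_pow ((levels_true hN).add_le_pow
      (le_refl (N ^ (3 * k + 1))) le_rfl) ((levels_true hN).one_le_pow _)
    exact h.trans ((levels_true hN).pow_le (by omega)))
  list_sum := fun {ι k l f} hl h => (IsFrac.list_sum h).mono (by
    have h1 := (levels_true hN).mul_le_pow_succ hl ((levels_true hN).add_le_pow
      (le_refl (N ^ (3 * k + 1))) ((levels_true hN).one_le_pow _))
    exact h1.trans ((levels_true hN).pow_le (by omega)))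

lemma isFrac_ratCast (q : ℚ) : IsFrac (bits q) (q : ℝ) := by
  have key : ∀ a : ℕ, Nat.size a ≤ bits q → (a : ℤ) ≤ 2 ^ bits q := fun a ha => by
    have := (Nat.size_le.1 ha).le
    exact_mod_cast this
  refine ⟨q.num, q.den, by exact_mod_cast q.den_nz, ?_, ?_, ?_⟩
  · rw [Int.abs_eq_natAbs]
    exact key _ (by unfold bits; omega)
  · rw [Nat.abs_cast]
    exact key _ (by unfold bits; omega)
  · exact_mod_cast (Rat.cast_def (K := ℝ) q)

lemma IsFrac.exists_rat {e : ℕ} {v : ℝ} (h : IsFrac e v) :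
    ∃ q : ℚ, v = q ∧ bits q ≤ 2 * e + 3 := by
  obtain ⟨p, q, hq, h1, h2, rfl⟩ := h
  refine ⟨p / q, by push_cast; rfl, ?_⟩
  have key : ∀ {a : ℕ}, (a : ℤ) ≤ 2 ^ e → Nat.size a ≤ e + 1 := fun {a} ha => by
    rw [Nat.size_le]
    have h3 : a ≤ 2 ^ e := by exact_mod_cast ha
    exact h3.trans_lt (Nat.pow_lt_pow_right (by norm_num) (Nat.lt_succ_self e))
  have hnum : (((p : ℚ) / q).num.natAbs : ℤ) ≤ 2 ^ e := by
    by_cases hp : p = 0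
    · subst hp; simp
    · have hd := Rat.num_dvd p hq
      rw [Rat.divInt_eq_div] at hd
      have := Int.natAbs_le_of_dvd_ne_zero hd hp
      rw [Int.abs_eq_natAbs] at h1
      omega
  have hden : ((((p : ℚ) / q).den : ℕ) : ℤ) ≤ 2 ^ e := by
    have hd := Rat.den_dvd p q
    rw [Rat.divInt_eq_div] at hd
    have := Int.natAbs_le_of_dvd_ne_zero hd hq
    rw [Int.abs_eq_natAbs] at h2
    omega
  have := key hnum
  have := key hden
  unfold bits
  omega

/-- The implementation is strongly polynomial. -/
theorem tardos_strongly_polynomial {m n : ℕ} {A : Matrix (Fin m) (Fin n) ℝ} {b : Fin m → ℝ}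
    {c : Fin n → ℝ} (hA : Admissible A b c)
    (hD : AuxNondegenerate A b c (tardos A b c).result) :
    IsRun A b c (tardos A b c).result ∧
    (∃ o, (tardos A b c).result.getLast? = some (.halt o)) ∧
    (tardos A b c).cost ≤ 2 ^ 186 * (m + n + 1) ^ 186 ∧
    ∀ (b' : Fin m → ℚ) (c' : Fin n → ℚ), (∀ i, b i = b' i) → (∀ j, c j = c' j) →
      ∀ v ∈ (tardos A b c).values, ∃ q : ℚ, v = q ∧
        bits q ≤ 2 ^ 186 * (m + n + ∑ i, bits (b' i) + ∑ j, bits (c' j) + 1) ^ 186 := by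
  have hpoly : ∀ X : ℕ, (X + 2) ^ 186 ≤ 2 ^ 186 * (X + 1) ^ 186 := fun X => by
    rw [← mul_pow]
    exact Nat.pow_le_pow_left (by omega) 186
  have h := (levels_true (N := m + n + 2) (by omega)).spec_tardos hA le_rfl
    (fun _ => trivial) (fun _ => trivial) hD
  obtain ⟨o, ho⟩ := h.post
  refine ⟨⟨ho.head, ho.chain⟩, ⟨o, ho.last⟩, ?_, ?_⟩
  · exact h.cost_le.trans (((levels_true (N := m + n + 2) (by omega)).pow_le
      (by norm_num)).trans (hpoly _))
  · intro b' c' hb hc v hv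
    set X := m + n + ∑ i, bits (b' i) + ∑ j, bits (c' j) with hX
    have hb1 : ∀ i, bits (b' i) ≤ ∑ i, bits (b' i) := fun i =>
      Finset.single_le_sum (f := fun i => bits (b' i)) (fun _ _ => Nat.zero_le _)
        (Finset.mem_univ i)
    have hc1 : ∀ j, bits (c' j) ≤ ∑ j, bits (c' j) := fun j =>
      Finset.single_le_sum (f := fun j => bits (c' j)) (fun _ _ => Nat.zero_le _)
        (Finset.mem_univ j)
    have hN : 2 ≤ X + 2 := by omega
    have h' := (levels_isFrac hN).spec_tardos hA (by omega)
      (fun i => by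
        have := hb1 i
        rw [hb]; exact (isFrac_ratCast _).mono (by simp; omega))
      (fun j => by
        have := hc1 j
        rw [hc]; exact (isFrac_ratCast _).mono (by simp; omega)) hD
    obtain ⟨q, hq, hbits⟩ := (h'.values v hv).exists_rat
    have hT := levels_true hN
    generalize he : 3 * 61 + 1 = e at hbits
    have h3 : 3 ≤ (X + 2) ^ (e + 1) :=
      le_trans (show 3 ≤ (X + 2) ^ 2 by nlinarith) (hT.pow_le (by omega))
    have h2 : 2 * (X + 2) ^ e ≤ (X + 2) ^ (e + 1) := by
      rw [pow_succ' (X + 2) e]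
      exact Nat.mul_le_mul_right _ hN
    have h4 := hbits.trans (hT.add_le_pow h2 h3)
    rw [show e + 1 + 1 = 186 by omega] at h4
    exact ⟨q, hq, h4.trans (hpoly X)⟩

end Prog

end PrimalTardos

theorem theorem1 :
    -- every run, for all choices that the algorithm leaves open
    (∀ (m n : ℕ) (A : Matrix (Fin m) (Fin n) ℝ) (b : Fin m → ℝ) (c : Fin n → ℝ),
      Admissible A b c →
      ∀ run : List (Config ℝ m n), IsRun A b c run → AuxNondegenerate A b c run →
        run.countP Config.isRounded ≤ m ∧
        (run.countP Config.isBasicSolution : ℝ) ≤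
          2 * m * n * ⌈((m : ℝ) ^ 4 * n + (m : ℝ) ^ 3 * (n : ℝ) ^ 3 + (m : ℝ) ^ 2) *
            Real.log ((m : ℝ) ^ 4 * n + (m : ℝ) ^ 3 * (n : ℝ) ^ 3 + (m : ℝ) ^ 2)⌉ ∧
        run.length ≤ run.countP Config.isBasicSolution + 2 * m + 2 ∧
        (∀ s, run.getLast? = some s → (∃ o, s = .halt o) ∨ ∃ s', Step A b c s s') ∧
        (∀ o, Config.halt o ∈ run → Correct A b c o)) ∧
    -- the order of magnitude of the number of basic solutions
    (∃ C : ℝ, ∀ (m n : ℕ) (A : Matrix (Fin m) (Fin n) ℝ) (b : Fin m → ℝ) (c : Fin n → ℝ),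
      Admissible A b c → 2 ≤ n →
      ∀ run : List (Config ℝ m n), IsRun A b c run → AuxNondegenerate A b c run →
        (run.countP Config.isBasicSolution : ℝ) ≤
          C * ((m : ℝ) ^ 4 * (n : ℝ) ^ 4 * Real.log n)) ∧
    -- strong polynomiality
    (∃ C d : ℕ, ∀ (m n : ℕ) (A : Matrix (Fin m) (Fin n) ℝ) (b : Fin m → ℝ) (c : Fin n → ℝ),
      Admissible A b c →
      AuxNondegenerate A b c (Prog.tardos A b c).result →
        IsRun A b c (Prog.tardos A b c).result ∧
        (∃ o, (Prog.tardos A b c).result.getLast? = some (.halt o)) ∧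
        (Prog.tardos A b c).cost ≤ C * (m + n + 1) ^ d ∧
        ∀ (b' : Fin m → ℚ) (c' : Fin n → ℚ), (∀ i, b i = b' i) → (∀ j, c j = c' j) →
          ∀ v ∈ (Prog.tardos A b c).values, ∃ q : ℚ, v = q ∧
            bits q ≤ C * (m + n + ∑ i, bits (b' i) + ∑ j, bits (c' j) + 1) ^ d) := by
  refine ⟨fun m n A b c hA run hrun hnd => run_bounds hA run hrun hnd,
    ⟨52, fun m n A b c hA hn run hrun hnd => run_order hA hn run hrun hnd⟩,
    ⟨2 ^ 186, 186, fun m n A b c hA hD => Prog.tardos_strongly_polynomial hA hD⟩⟩
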